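/- **Setting.** Let $M$ be a smooth compact connected Riemannian manifold with Riemannian distance and Riemannian volume $dx$. Let $\mathcal F=\{\bar f_j\}_{j=1}^{N}\subset C^2(M,M)$ be expanding, i.e. for some $\vartheta>1$, $\|(D_x\bar f_j)^{-1}\|\le\vartheta^{-1}$ for all $j,x$. Let $\mathcal G=\{\bar g_j\}_{j=1}^{N'}\subset C^1(M,\mathbb R)$, and let $\rho>0$ satisfy $\ln\rho\in C^1(M)$ and $\int_M\rho\,dx=1$. For sequences $\omega^f\in\{1,\dots,N\}^{\mathbb N}$, $\omega^g\in\{1,\dots,N'\}^{\mathbb N}$ (with $0\in\mathbb N$) put $f_k=\bar f_{\omega^f_k}$, $g_k=\bar g_{\omega^g_k}$, $$\hat g_k=g_k-\int_M g_k\circ f_{k-1}\circ\cdots\circ f_0\;\rho\,dx,\qquad \sigma_n^2=\int_M\Big(\sum_{k=0}^{n-1}\hat g_k\circ f_{k-1}\circ\cdots\circ f_0\Big)^2\rho\,dx .$$ Let $\mathcal L_k$ be the transfer operator of $f_k$ with respect to $dx$, i.e. $\int h\,\varphi\circ f_k\,dx=\int\varphi\,\mathcal L_kh\,dx$, and put $$\gamma_{S,k}=\frac1{\int_M1\,dx}\int_M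 g_k\,\mathcal L_{k-1}\cdots\mathcal L_{\max\{k-S,0\}}1\,dx .$$ A number $D\in\mathbb N$ is an admissible specification gap for $(\varepsilon,L)$ if for every $\omega^f$, all $a_k\in\mathbb N$ with $a_{k+1}-a_k-L\ge D$ and all points $x_k\in M$ ($k\in\mathbb N$) there is $z\in M$ such that $d\big(f_{a_k+i}\circ\cdots\circ f_0(z),\,f_{a_k+i}\circ\cdots\circ f_{a_k}(x_k)\big)\le\varepsilon$ for all $k\in\mathbb N$ and $0\le i\le L-1$. The *variance hypotheses* hold for $L$ if there are $a\in(0,1)$, $\varepsilon>0$ and an admissible specification gap $D$ for $(\varepsilon,L)$ such that $\|D\bar g_j\|_\infty\le a/(4\varepsilon)$ for all $j$; $8D\,\|\hat g_k\|_\infty\le aL$ for all $\omega^f,\omega^g,k$; and for all $\omega^f,\omega^g$ and all $r\in\mathbb N$ there is $x\in M$ with $$\sum_{i=1}^{L}\hat g_{r+i}\big(f_{r+i-1}\circ\cdots\circ f_r(x)\big)\ge aL .$$ Nonnegative integers $t=(\Delta,p,K,\Gamma,R)$ with $p\geq 1$ are called *bounds for the system* $(M,\mathcal F,\mathcal G,\rho)$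 if $\operatorname{diam}M\le\Delta$; $\|(D_x\bar f_j)^{-1}\|\le(1+1/p)^{-1}$ for all $j,x$; each $\ln|\det D\bar f_j|$ is $K$-Lipschitz on $M$; $\|\bar g_j\|_\infty\le\Gamma$ and $\|D\bar g_j\|_\infty\le\Gamma$ for all $j$; and $\|D\ln\rho\|_\infty\le R$. **Statement.** There are computable functions $\kappa,b,L_0:\mathbb N^5\to\mathbb N\setminus\{0\}$ such that for every system $(M,\mathcal F,\mathcal G,\rho)$ as above the following hold. 1. Bounds $t$ for the system exist. 2. Let $t$ be any bounds for the system and write $\kappa=\kappa(t)$, $b=b(t)$. Suppose that for some integer $L\ge L_0(t)$, with $S=\lceil b\ln L\rceil$, for every word $\{(\omega^1_i,\omega^2_i)\}_{i=0}^{L}$ in $\{1,\dots,N\}\times\{1,\dots,N'\}$ there is a point $x\in M$ with $$\sum_{i=1}^{L}\big(\bar g_{\omega^2_i}-\gamma_{S,i}\big)\big(\bar f_{\omega^1_{i-1}}\circ\cdots\circ\bar f_{\omega^1_0}(x)\big)\ge2\kappa\ln L,$$ where $\gamma_{S,i}$ is computed along the word, i.e. with $f_k=\bar f_{\omega^1_k}$,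 $g_k=\bar g_{\omega^2_k}$. Then the variance hypotheses hold for $L$, and there is $B>0$ such that $\sigma_n^2\ge Bn$ for all $n\in\mathbb N$ and all sequences $\omega^f,\omega^g$. -/

import Mathlib

open MeasureTheory Bundle
open scoped Manifold ContDiff Bundle

noncomputable section

namespace SeqExpanding

instance {d : ℕ} {M : Type*} [TopologicalSpace M] [ChartedSpace (EuclideanSpace ℝ (Fin d)) M]
    (x : M) : FiniteDimensional ℝ (TangentSpace (𝓡 d) x) :=
  inferInstanceAs (FiniteDimensional ℝ (EuclideanSpace ℝ (Fin d)))

/-- The Riemannian volume on the domain of the chart around `p`, extended by zero: the image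
under the inverse chart of Lebesgue measure with density `√(det (⟨∂ᵢ, ∂ⱼ⟩))`, which is the norm
determinant of the derivative of the inverse chart. -/
def chartVolume (d : ℕ) {M : Type*} [MetricSpace M] [ChartedSpace (EuclideanSpace ℝ (Fin d)) M]
    [RiemannianBundle (fun x : M ↦ TangentSpace (𝓡 d) x)] [MeasurableSpace M] (p : M) :
    Measure M :=
  Measure.map (extChartAt (𝓡 d) p).symm
    ((volume.restrict (extChartAt (𝓡 d) p).target).withDensity fun y ↦
      ENNReal.ofReal
        (mfderiv 𝓘(ℝ, EuclideanSpace ℝ (Fin d)) (𝓡 d)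
          (extChartAt (𝓡 d) p).symm y).toLinearMap.normDet)

/-- The Riemannian volume measure: the measures `chartVolume d p` agree on the overlaps of the
chart domains, and their supremum is the measure glued from them. -/
def riemannianVolume (d : ℕ) (M : Type*) [MetricSpace M]
    [ChartedSpace (EuclideanSpace ℝ (Fin d)) M]
    [RiemannianBundle (fun x : M ↦ TangentSpace (𝓡 d) x)] [MeasurableSpace M] : Measure M :=
  ⨆ p : M, chartVolume d p

/-- `‖∇u‖_∞ ≤ C`. -/
def GradBound (d : ℕ) {M : Type*} [MetricSpace M] [ChartedSpace (EuclideanSpace ℝ (Fin d)) M]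
    [RiemannianBundle (fun x : M ↦ TangentSpace (𝓡 d) x)] (u : M → ℝ) (C : ℝ) : Prop :=
  ∀ (x : M) (v : TangentSpace (𝓡 d) x), |mvfderiv (𝓡 d) u x v| ≤ C * ‖v‖

/-- `‖(D_x f)⁻¹‖ ≤ ϑ⁻¹` for all `x`. -/
def ExpandsBy (d : ℕ) {M : Type*} [MetricSpace M] [ChartedSpace (EuclideanSpace ℝ (Fin d)) M]
    [RiemannianBundle (fun x : M ↦ TangentSpace (𝓡 d) x)] (f : M → M) (ϑ : ℝ) : Prop :=
  ∀ (x : M) (v : TangentSpace (𝓡 d) x), ϑ * ‖v‖ ≤ ‖mfderiv (𝓡 d) (𝓡 d) f x v‖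

/-- `|det D_x f|`, computed in orthonormal bases of the tangent spaces at `x` and `f x`. -/
def jacobian (d : ℕ) {M : Type*} [MetricSpace M] [ChartedSpace (EuclideanSpace ℝ (Fin d)) M]
    [RiemannianBundle (fun x : M ↦ TangentSpace (𝓡 d) x)] (f : M → M) (x : M) : ℝ :=
  (mfderiv (𝓡 d) (𝓡 d) f x).toLinearMap.normDet

/-- `comp f j m = f_{j+m-1} ∘ ⋯ ∘ f_j` (`m` maps, the identity for `m = 0`). -/
def comp {M : Type*} (f : ℕ → M → M) (j : ℕ) : ℕ → M → M
  | 0 => id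
  | m + 1 => f (j + m) ∘ comp f j m

/-- The transfer operator of `f` with respect to `μ`: `transferOp μ f h` is the density with
respect to `μ` of the image under `f` of the signed measure `h μ`; equivalently
`∫ h · φ ∘ f dμ = ∫ φ · transferOp μ f h dμ`. -/
def transferOp {M : Type*} [MeasurableSpace M] (μ : Measure M) (f : M → M) (h : M → ℝ) : M → ℝ :=
  SignedMeasure.rnDeriv ((μ.withDensityᵥ h).map f) μ

/-- `transferIter μ f j m h = ℒ_{j+m-1} ⋯ ℒ_j h`, where `ℒ_k` is the transfer operator of `f_k`. -/
def transferIter {M : Type*} [MeasurableSpace M] (μ : Measure M) (f : ℕ → M → M) (j : ℕ) :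
    ℕ → (M → ℝ) → M → ℝ
  | 0, h => h
  | m + 1, h => transferOp μ (f (j + m)) (transferIter μ f j m h)

/-- `γ_{S,k} = (∫ 1)⁻¹ ∫ g_k ℒ_{k-1} ⋯ ℒ_{max(k-S,0)} 1`; truncated subtraction gives the maximum,
so that `k - (k - S)` operators are applied. -/
def gammaAvg {M : Type*} [MeasurableSpace M] (μ : Measure M) (f : ℕ → M → M) (g : ℕ → M → ℝ)
    (S k : ℕ) : ℝ :=
  (∫ _ : M, (1 : ℝ) ∂μ)⁻¹ *
    ∫ x, g k x * transferIter μ f (k - S) (k - (k - S)) (fun _ ↦ 1) x ∂μ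

/-- `ĝ_k = g_k - ∫ g_k ∘ f_{k-1} ∘ ⋯ ∘ f_0 · ρ`. -/
def centered {M : Type*} [MeasurableSpace M] (μ : Measure M) (ρ : M → ℝ) (f : ℕ → M → M)
    (g : ℕ → M → ℝ) (k : ℕ) (x : M) : ℝ :=
  g k x - ∫ y, g k (comp f 0 k y) * ρ y ∂μ

/-- `σ_n² = 𝔼(Ŝ_n²)`, where `Ŝ_n = ∑_{k<n} ĝ_k ∘ f_{k-1} ∘ ⋯ ∘ f_0`. -/
def variance {M : Type*} [MeasurableSpace M] (μ : Measure M) (ρ : M → ℝ) (f : ℕ → M → M)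
    (g : ℕ → M → ℝ) (n : ℕ) : ℝ :=
  ∫ x, (∑ k ∈ Finset.range n, centered μ ρ f g k (comp f 0 k x)) ^ 2 * ρ x ∂μ

/-- `D` is an admissible specification gap `D_ℱ(ε, L)`: along every sequence of maps from the
family, any orbit segments of length `L` with gaps at least `D` between them are `ε`-shadowed by
one orbit. -/
def IsSpecificationGap {M : Type*} [MetricSpace M] {N : ℕ} (F : Fin N → M → M) (ε : ℝ)
    (L D : ℕ) : Prop :=
  ∀ (α : ℕ → Fin N) (a : ℕ → ℕ) (x : ℕ → M), (∀ k, a k + L + D ≤ a (k + 1)) →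
    ∃ z : M, ∀ k, ∀ i < L,
      dist (comp (fun j ↦ F (α j)) 0 (a k + i + 1) z)
        (comp (fun j ↦ F (α j)) (a k) (i + 1) (x k)) ≤ ε

/-- The hypotheses of the variance growth proposition for the length `L`: for some `a ∈ (0, 1)`,
every block of length `L` of every sequence of maps and observables admits a point whose centered
Birkhoff sum is at least `a L`, where `ε ≤ a / (4 sup ‖D ḡ_j‖)` and
`L ≥ (8 / a) D_ℱ(ε, L) max ‖ĝ‖_∞`. -/
def VarianceHypotheses (d : ℕ) {M : Type*} [MetricSpace M]
    [ChartedSpace (EuclideanSpace ℝ (Fin d)) M]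
    [RiemannianBundle (fun x : M ↦ TangentSpace (𝓡 d) x)] [MeasurableSpace M]
    {N N' : ℕ} (F : Fin N → M → M) (G : Fin N' → M → ℝ) (ρ : M → ℝ) (L : ℕ) : Prop :=
  ∃ (a ε : ℝ) (D : ℕ), 0 < a ∧ a < 1 ∧ 0 < ε ∧ IsSpecificationGap F ε L D ∧
    (∀ j, GradBound d (G j) (a / (4 * ε))) ∧
    (∀ (α : ℕ → Fin N) (η : ℕ → Fin N') (k : ℕ) (x : M),
      8 * D * |centered (riemannianVolume d M) ρ (fun i ↦ F (α i)) (fun i ↦ G (η i)) k x|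
        ≤ a * L) ∧
    ∀ (α : ℕ → Fin N) (η : ℕ → Fin N') (r : ℕ), ∃ x : M,
      a * L ≤ ∑ i ∈ Finset.Icc 1 L,
        centered (riemannianVolume d M) ρ (fun i ↦ F (α i)) (fun i ↦ G (η i)) (r + i)
          (comp (fun i ↦ F (α i)) r i x)

/-- The checkable condition: for `S = ⌈b ln L⌉` and every word `w = (ω¹_i, ω²_i)_{0 ≤ i ≤ L}` there
is a point `x` with `∑_{i=1}^L g̃_i (f_{i-1} ∘ ⋯ ∘ f_0 (x)) ≥ 2 κ ln L`, where `f_i` and `g_i` are the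
map and the observable with the indices `ω¹_i` and `ω²_i`, and `g̃_i = g_i - γ_{S,i}`. (Only entries
with index at most `L` of the sequences enter.) -/
def CheckableCondition (d : ℕ) {M : Type*} [MetricSpace M]
    [ChartedSpace (EuclideanSpace ℝ (Fin d)) M]
    [RiemannianBundle (fun x : M ↦ TangentSpace (𝓡 d) x)] [MeasurableSpace M]
    {N N' : ℕ} (F : Fin N → M → M) (G : Fin N' → M → ℝ) (κ b : ℝ) (L : ℕ) : Prop :=
  ∀ w : Fin (L + 1) → Fin N × Fin N',
    let f : ℕ → M → M := fun i ↦ F (w (Fin.ofNat (L + 1) i)).1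
    let g : ℕ → M → ℝ := fun i ↦ G (w (Fin.ofNat (L + 1) i)).2
    ∃ x : M, 2 * κ * Real.log L ≤ ∑ i ∈ Finset.Icc 1 L,
      (g i (comp f 0 i x) - gammaAvg (riemannianVolume d M) f g ⌈b * Real.log L⌉₊ i)

/-- `(Δ, p, K, Γ, R)` are integer bounds for the system: `diam M ≤ Δ`, the maps expand by
`1 + 1 / p`, the logarithms of their Jacobians have Lipschitz constant `K`,
the observables satisfy `‖ḡ_j‖_∞, ‖D ḡ_j‖_∞ ≤ Γ`, and `‖D ln ρ‖_∞ ≤ R`. -/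
def HasBounds (d : ℕ) {M : Type*} [MetricSpace M] [ChartedSpace (EuclideanSpace ℝ (Fin d)) M]
    [RiemannianBundle (fun x : M ↦ TangentSpace (𝓡 d) x)]
    {N N' : ℕ} (F : Fin N → M → M) (G : Fin N' → M → ℝ) (ρ : M → ℝ) :
    ℕ × ℕ × ℕ × ℕ × ℕ → Prop
  | (Δ, p, K, Γ, R) =>
    (∀ x y : M, dist x y ≤ Δ) ∧
    0 < p ∧ (∀ j, ExpandsBy d (F j) (1 + 1 / p)) ∧
    (∀ j x y, |Real.log (jacobian d (F j) x) - Real.log (jacobian d (F j) y)| ≤ K * dist x y) ∧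
    (∀ j, (∀ x, |G j x| ≤ Γ) ∧ GradBound d (G j) Γ) ∧
    GradBound d (fun x ↦ Real.log (ρ x)) R

end SeqExpanding

end

/-! Everything rests on a cone of densities. Take positive densities whose logarithm is
`C`-Lipschitz. The transfer operator of a map that expands by 1 + 1/p and has a K-Lipschitz
log-Jacobian turns the constant C into (C + K)/(1 + 1/p) (`IsExpandingMap.exists_push`). For C ≥ 2pK
this leaves room to subtract beforehand a constant carrying a small proportion θ of the mass
(`LogLip.sub_const`). Two densities of equal mass lose the same constant, so their difference is
carried to a difference of cone densities of mass smaller by the factor 1 - θ. Memory is thus lost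
exponentially (`abs_integral_comp_le`), with an explicit θ = 1/q.

Consequently γ_{S,i} differs from the ρ-mean of the i-th observable by at most 2Γ(1 - 1/q)^min(i,S).
With S = ⌈q ln L⌉ these errors add up to at most 2Γ(q + 1), whatever L is (`sum_pow_sub_sub_le`).
Expansion also gives specification (`isSpecificationGap`), here with gap p⌈3 ln L⌉. The error and
the loss over a gap are both at most constant multiples of ln L, so a κ independent of L absorbs
them, and a = κ ln L / L satisfies the variance hypotheses
(`CheckableCondition.varianceHypotheses`).

Growth of the variance comes from a reverse martingale decomposition. Let h_k be the density at time
k, v_{k+1} = ℒ_k(ĝ_k h_k + v_k) with v_0 = 0, and χ_k = v_k / h_k. Then D_k = ĝ_k + χ_k - χ_{k+1} ∘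
f_k is orthogonal to all functions of f_k, and σ_n² is at least the sum of the ∫ D_k² h_k
(`sum_integral_sq_le`). Shadowing enough blocks yields an orbit whose sum over a window of fixed
length exceeds the bounded boundary terms χ. Some D_k is then large at a point, hence on a ball of
uniform radius, and each window contributes a fixed amount (`IsContractingSystem.exists_window`).
For short words, σ_n = 0 would make the Birkhoff sum constant, and repeating the word periodically
would give zero variance at arbitrarily late times, against the growth
(`IsContractingSystem.variance_pos`). Finitely many words remain, so the bound is uniform.

Riemannian geometry serves to verify `HasChains` and `IsExpandingMap`, by lengths of paths, the
inverse function theorem and change of variables in charts. -/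

namespace SeqExpanding

open Set Filter Topology
open scoped ENNReal NNReal


/-! ### Lipschitz estimates and chains from lengths of paths -/

section Lipschitz

variable {E : Type*} [NormedAddCommGroup E] [NormedSpace ℝ E]
  {H : Type*} [TopologicalSpace H] {I : ModelWithCorners ℝ E H}
  {M : Type*} [MetricSpace M] [ChartedSpace H M]
  [RiemannianBundle (fun x : M ↦ TangentSpace I x)] [IsRiemannianManifold I M]
  {E' : Type*} [NormedAddCommGroup E'] [NormedSpace ℝ E']
  {H' : Type*} [TopologicalSpace H'] {I' : ModelWithCorners ℝ E' H'}
  {N : Type*} [MetricSpace N] [ChartedSpace H' N]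
  [RiemannianBundle (fun x : N ↦ TangentSpace I' x)] [IsRiemannianManifold I' N]

lemma pathELength_comp_le {h : M → N} {γ : ℝ → M} {C : ℝ≥0}
    (hγ : ContMDiffOn 𝓘(ℝ, ℝ) I 1 γ (Icc 0 1))
    (hh : ∀ t ∈ Icc (0 : ℝ) 1, ContMDiffAt I I' 1 h (γ t))
    (hC : ∀ t ∈ Icc (0 : ℝ) 1, ∀ v : TangentSpace I (γ t),
      ‖mfderiv I I' h (γ t) v‖ ≤ C * ‖v‖) :
    Manifold.pathELength I' (h ∘ γ) 0 1 ≤ C * Manifold.pathELength I γ 0 1 := by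
  rw [Manifold.pathELength_eq_lintegral_mfderivWithin_Icc,
    Manifold.pathELength_eq_lintegral_mfderivWithin_Icc,
    ← lintegral_const_mul' _ _ ENNReal.coe_ne_top]
  refine setLIntegral_mono' measurableSet_Icc fun t ht ↦ ?_
  have hu : UniqueMDiffWithinAt 𝓘(ℝ, ℝ) (Icc (0 : ℝ) 1) t := by
    rw [uniqueMDiffWithinAt_iff_uniqueDiffWithinAt]
    exact uniqueDiffOn_Icc zero_lt_one t ht
  have h1 := mfderiv_comp_mfderivWithin (I := 𝓘(ℝ, ℝ)) (I' := I) (I'' := I') t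
    ((hh t ht).mdifferentiableAt one_ne_zero) ((hγ t ht).mdifferentiableWithinAt one_ne_zero) hu
  have h2 : mfderivWithin 𝓘(ℝ, ℝ) I' (h ∘ γ) (Icc 0 1) t 1 =
      mfderiv I I' h (γ t) (mfderivWithin 𝓘(ℝ, ℝ) I γ (Icc 0 1) t 1) := congr($h1 1)
  rw [h2]
  have h3 := hC t ht (mfderivWithin 𝓘(ℝ, ℝ) I γ (Icc 0 1) t 1)
  rw [← ofReal_norm, ← ofReal_norm, ← ENNReal.ofReal_coe_nnreal, ← ENNReal.ofReal_mul C.coe_nonneg]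
  exact ENNReal.ofReal_le_ofReal h3

variable (I) in
lemma edist_le_pathELength {γ : ℝ → M} {s t : ℝ} (h0 : 0 ≤ s)
    (hst : s ≤ t) (h1 : t ≤ 1)
    (hγ : ContMDiffOn 𝓘(ℝ, ℝ) I 1 γ (Icc 0 1)) :
    edist (γ s) (γ t) ≤ Manifold.pathELength I γ s t := by
  rw [IsRiemannianManifold.out (I := I)]
  exact Manifold.riemannianEDist_le_pathELength
    (hγ.mono (Icc_subset_Icc h0 h1)) rfl rfl hst

/-- A `C^1` map whose derivative is bounded by `C` on a ball is `C`-Lipschitz on the concentric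
ball with a third of the radius. -/
lemma dist_le_of_mfderiv_le_ball {h : M → N} {x₀ : M} {r : ℝ} {C : ℝ≥0}
    (hh : ∀ z ∈ Metric.ball x₀ (3 * r), ContMDiffAt I I' 1 h z)
    (hC : ∀ z ∈ Metric.ball x₀ (3 * r), ∀ v : TangentSpace I z,
      ‖mfderiv I I' h z v‖ ≤ C * ‖v‖) {x y : M}
    (hx : x ∈ Metric.ball x₀ r) (hy : y ∈ Metric.ball x₀ r) :
    dist (h x) (h y) ≤ C * dist x y := by
  have hxy : dist x y < 2 * r := by
    have := dist_triangle_right x y x₀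
    simp only [Metric.mem_ball] at hx hy
    linarith
  refine le_of_forall_gt_imp_ge_of_dense fun c hc ↦ ?_
  obtain ⟨s, hs1, hs2, hs3⟩ : ∃ s, dist x y < s ∧ s ≤ 2 * r ∧ C * s ≤ c := by
    by_cases hC0 : (C : ℝ) = 0
    · exact ⟨2 * r, hxy, le_rfl, by rw [hC0, zero_mul] at hc ⊢; exact hc.le⟩
    · have hCp : 0 < (C : ℝ) := lt_of_le_of_ne C.coe_nonneg (Ne.symm hC0)
      refine ⟨min (2 * r) (c / C), lt_min hxy ?_, min_le_left _ _, ?_⟩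
      · rw [lt_div_iff₀ hCp, mul_comm]; exact hc
      · calc C * min (2 * r) (c / C) ≤ C * (c / C) := by gcongr; exact min_le_right _ _
          _ = c := by field_simp
  have hs0 : 0 ≤ s := dist_nonneg.trans hs1.le
  have hlt : Manifold.riemannianEDist I x y < ENNReal.ofReal s := by
    rw [← IsRiemannianManifold.out (I := I), edist_dist]
    exact (ENNReal.ofReal_lt_ofReal_iff_of_nonneg dist_nonneg).2 hs1
  obtain ⟨γ, hγ0, hγ1, hγ, hlen⟩ := Manifold.exists_lt_of_riemannianEDist_lt hlt
  -- A path of length less than s ≤ 2r starting within r of the centre cannot leave the ball of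
  -- radius 3r, so the derivative bound holds all along it.
  have hmem : ∀ t ∈ Icc (0 : ℝ) 1, γ t ∈ Metric.ball x₀ (3 * r) := by
    intro t ht
    have h1 : edist x (γ t) < ENNReal.ofReal s := by
      rw [← hγ0]
      refine ((edist_le_pathELength I le_rfl ht.1 ht.2 hγ).trans ?_).trans_lt hlen
      exact Manifold.pathELength_mono le_rfl ht.2
    rw [edist_dist, ENNReal.ofReal_lt_ofReal_iff_of_nonneg dist_nonneg] at h1
    rw [Metric.mem_ball] at hx ⊢
    have := dist_triangle_left (γ t) x₀ x
    linarith
  have hγ' : ContMDiffOn 𝓘(ℝ, ℝ) I' 1 (h ∘ γ) (Icc 0 1) := fun t ht ↦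
    (hh (γ t) (hmem t ht)).comp_contMDiffWithinAt t (hγ t ht)
  have h1 : edist (h x) (h y) ≤ C * ENNReal.ofReal s := by
    rw [← hγ0, ← hγ1]
    refine (edist_le_pathELength I' (γ := h ∘ γ) le_rfl zero_le_one le_rfl hγ').trans ?_
    refine (pathELength_comp_le hγ (fun t ht ↦ hh _ (hmem t ht))
      (fun t ht v ↦ hC _ (hmem t ht) v)).trans ?_
    gcongr
  rw [edist_dist, ← ENNReal.ofReal_coe_nnreal, ← ENNReal.ofReal_mul C.coe_nonneg,
    ENNReal.ofReal_le_ofReal_iff (by positivity)] at h1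
  exact h1.trans hs3

/-- A `C^1` map with derivative bounded by `C` is `C`-Lipschitz. -/
lemma dist_le_of_mfderiv_le {h : M → N} {C : ℝ≥0} (hh : ContMDiff I I' 1 h)
    (hC : ∀ z, ∀ v : TangentSpace I z, ‖mfderiv I I' h z v‖ ≤ C * ‖v‖) (x y : M) :
    dist (h x) (h y) ≤ C * dist x y :=
  dist_le_of_mfderiv_le_ball (x₀ := x) (r := dist x y + 1) (fun z _ ↦ hh z) (fun z _ v ↦ hC z v)
    (by rw [Metric.mem_ball, dist_self]; positivity)
    (by rw [Metric.mem_ball, dist_comm]; linarith)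

/-- In a Riemannian manifold, two points are joined by chains with arbitrarily small steps and
total length arbitrarily close to the distance. -/
lemma exists_chain {E : Type*} [NormedAddCommGroup E] [NormedSpace ℝ E]
    {H : Type*} [TopologicalSpace H] (I : ModelWithCorners ℝ E H)
    {M : Type*} [MetricSpace M] [ChartedSpace H M]
    [RiemannianBundle (fun x : M ↦ TangentSpace I x)] [IsRiemannianManifold I M] (x y : M) {r δ : ℝ} (hr : 0 < r) (hδ : 0 < δ) :
    ∃ (n : ℕ) (c : ℕ → M), c 0 = x ∧ c n = y ∧ (∀ i < n, dist (c i) (c (i + 1)) < r) ∧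
      ∑ i ∈ Finset.range n, dist (c i) (c (i + 1)) ≤ dist x y + δ := by
  have hlt : Manifold.riemannianEDist I x y < ENNReal.ofReal (dist x y + δ) := by
    rw [← IsRiemannianManifold.out (I := I), edist_dist]
    exact (ENNReal.ofReal_lt_ofReal_iff_of_nonneg dist_nonneg).2 (by linarith)
  obtain ⟨γ, hγ0, hγ1, hγ, hlen⟩ := Manifold.exists_lt_of_riemannianEDist_lt hlt
  have huc : UniformContinuousOn γ (Icc 0 1) :=
    isCompact_Icc.uniformContinuousOn_of_continuous hγ.continuousOn
  obtain ⟨η, hη, hη'⟩ := Metric.uniformContinuousOn_iff.1 huc r hr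
  obtain ⟨n, hn⟩ := exists_nat_gt (1 / η)
  have hn0 : (0 : ℝ) < n := (by positivity : (0 : ℝ) < 1 / η).trans hn
  have hmem : ∀ i ≤ n, (i : ℝ) / n ∈ Icc (0 : ℝ) 1 := fun i hi ↦
    ⟨by positivity, (div_le_one hn0).2 (by exact_mod_cast hi)⟩
  have hstep : ∀ i : ℕ, (i : ℝ) / n ≤ ((i + 1 : ℕ) : ℝ) / n := fun i ↦ by
    gcongr; exact_mod_cast Nat.le_succ i
  refine ⟨n, fun i ↦ γ ((i : ℝ) / n), by simp [hγ0], by simp [hn0.ne', hγ1], fun i hi ↦ ?_, ?_⟩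
  · refine hη' _ (hmem i hi.le) _ (hmem (i + 1) hi) ?_
    rw [dist_comm, Real.dist_eq, ← sub_div, abs_of_nonneg] <;> push_cast
    · rw [add_sub_cancel_left, div_lt_iff₀ hn0]
      rw [div_lt_iff₀ hη] at hn
      linarith
    · simp only [add_sub_cancel_left]; positivity
  -- Each step is at most the length of the piece of the path between its ends, and lengths of
  -- consecutive pieces add up.
  · have key : ∀ k ≤ n, ∑ i ∈ Finset.range k,
        edist (γ ((i : ℝ) / n)) (γ (((i + 1 : ℕ) : ℝ) / n)) ≤
        Manifold.pathELength I γ 0 ((k : ℝ) / n) := by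
      intro k
      induction k with
      | zero => intro _; simp
      | succ k ih =>
        intro hk
        rw [Finset.sum_range_succ, ← Manifold.pathELength_add (hmem k (by omega)).1 (hstep k)]
        exact add_le_add (ih (by omega))
          (edist_le_pathELength I (hmem k (by omega)).1 (hstep k) (hmem (k + 1) hk).2 hγ)
    have h1 := (key n le_rfl).trans_lt (by simpa [hn0.ne'] using hlen)
    simp only [edist_dist] at h1
    rw [← ENNReal.ofReal_sum_of_nonneg (fun _ _ ↦ dist_nonneg)] at h1
    exact ((ENNReal.ofReal_lt_ofReal_iff_of_nonneg
      (Finset.sum_nonneg fun _ _ ↦ dist_nonneg)).1 h1).le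

end Lipschitz


/-! ### Gradient bounds on a Riemannian manifold -/

section Geometry

variable {d : ℕ} {M : Type*} [MetricSpace M]
  [ChartedSpace (EuclideanSpace ℝ (Fin d)) M] [IsManifold (𝓡 d) ∞ M]
  [RiemannianBundle (fun x : M ↦ TangentSpace (𝓡 d) x)]
  [IsContMDiffRiemannianBundle (𝓡 d) ∞ (EuclideanSpace ℝ (Fin d))
    (fun x : M ↦ TangentSpace (𝓡 d) x)]

lemma norm_mfderiv_real {u : M → ℝ} (x : M) (v : TangentSpace (𝓡 d) x) :
    ‖mfderiv (𝓡 d) 𝓘(ℝ, ℝ) u x v‖ = |mvfderiv (𝓡 d) u x v| := by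
  rw [norm_tangentSpace_vectorSpace]; rfl

lemma GradBound.abs_sub_le [IsRiemannianManifold (𝓡 d) M] {u : M → ℝ} {C : ℝ} (hC : 0 ≤ C)
    (hu : ContMDiff (𝓡 d) 𝓘(ℝ, ℝ) 1 u) (h : GradBound d u C) (x y : M) :
    |u x - u y| ≤ C * dist x y := by
  rw [← Real.dist_eq]
  refine dist_le_of_mfderiv_le (I := 𝓡 d) (I' := 𝓘(ℝ, ℝ)) (C := ⟨C, hC⟩) hu (fun z v ↦ ?_) x y
  rw [norm_mfderiv_real]
  exact h z v

/-- In the chart φ at the point, du = d(u ∘ φ⁻¹) ∘ dφ. The first factor is continuous, and the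
second has locally bounded norm because the metric is continuous. -/
lemma eventually_mfderiv_le (x₀ : M) {u : M → ℝ} (hu : ContMDiff (𝓡 d) 𝓘(ℝ, ℝ) 1 u) :
    ∃ C : ℝ, ∀ᶠ x in 𝓝 x₀, ∀ v : TangentSpace (𝓡 d) x, |mvfderiv (𝓡 d) u x v| ≤ C * ‖v‖ := by
  have : IsManifold (𝓡 d) 1 M := .of_le (n := ∞) (by simp)
  have : IsContinuousRiemannianBundle (EuclideanSpace ℝ (Fin d))
    (fun x : M ↦ TangentSpace (𝓡 d) x) := by
      obtain ⟨g, hg, hg'⟩ := IsContMDiffRiemannianBundle.exists_contMDiff (IB := 𝓡 d) (n := ∞)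
        (F := EuclideanSpace ℝ (Fin d)) (E := fun x : M ↦ TangentSpace (𝓡 d) x)
      exact ⟨g, hg.continuous, hg'⟩
  obtain ⟨C, hC, hφ⟩ := eventually_norm_mfderiv_extChartAt_lt (𝓡 d) x₀
  set φ := extChartAt (𝓡 d) x₀
  have hF : ContDiffAt ℝ 1 (u ∘ φ.symm) (φ x₀) := by
    rw [← contMDiffAt_iff_contDiffAt]
    exact hu.contMDiffAt.comp _ ((contMDiffOn_extChartAt_symm x₀).contMDiffAt
      (extChartAt_target_mem_nhds x₀))
  have hD : ContinuousAt (fderiv ℝ (u ∘ φ.symm)) (φ x₀) := hF.continuousAt_fderiv one_ne_zero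
  have hb : ∀ᶠ y in 𝓝 (φ x₀), ‖fderiv ℝ (u ∘ φ.symm) y‖ < ‖fderiv ℝ (u ∘ φ.symm) (φ x₀)‖ + 1 :=
    hD.norm.eventually_lt continuousAt_const (by linarith)
  have hdiff : ∀ᶠ y in 𝓝 (φ x₀), DifferentiableAt ℝ (u ∘ φ.symm) y :=
    (hF.eventually (by simp)).mono fun y hy ↦ hy.differentiableAt one_ne_zero
  refine ⟨(‖fderiv ℝ (u ∘ φ.symm) (φ x₀)‖ + 1) * C, ?_⟩
  have hcont : ContinuousAt φ x₀ := continuousAt_extChartAt x₀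
  filter_upwards [hφ, hcont.eventually hb, hcont.eventually hdiff,
    (isOpen_extChartAt_source (I := 𝓡 d) x₀).mem_nhds (mem_extChartAt_source x₀)]
    with x hx1 hx2 hx3 hx4 v
  have he : u =ᶠ[𝓝 x] (u ∘ φ.symm) ∘ φ := by
    filter_upwards [(isOpen_extChartAt_source (I := 𝓡 d) x₀).mem_nhds hx4] with z hz
    simp only [Function.comp, φ]
    rw [(extChartAt (𝓡 d) x₀).left_inv hz]
  have hc : mfderiv (𝓡 d) 𝓘(ℝ, ℝ) u x = (fderiv ℝ (u ∘ φ.symm) (φ x)).comp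
      (mfderiv (𝓡 d) 𝓘(ℝ, EuclideanSpace ℝ (Fin d)) φ x) := by
    rw [he.mfderiv_eq, mfderiv_comp (I' := 𝓘(ℝ, EuclideanSpace ℝ (Fin d))) x
      hx3.mdifferentiableAt (mdifferentiableAt_extChartAt (by simpa [φ] using hx4)),
      mfderiv_eq_fderiv]
    rfl
  have hv : mvfderiv (𝓡 d) u x v = fderiv ℝ (u ∘ φ.symm) (φ x)
    (mfderiv (𝓡 d) 𝓘(ℝ, EuclideanSpace ℝ (Fin d)) φ x v) := congr($hc v)
  rw [hv, ← Real.norm_eq_abs, mul_assoc]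
  refine (ContinuousLinearMap.le_opNorm _ _).trans ?_
  refine mul_le_mul hx2.le ?_ (norm_nonneg _) (by positivity)
  let := normedAddCommGroupTangentSpaceVectorSpace (φ x)
  let := normedSpaceTangentSpaceVectorSpace (φ x)
  refine le_trans ?_ (mul_le_mul_of_nonneg_right hx1.le (norm_nonneg _))
  exact ContinuousLinearMap.le_opNorm (mfderiv (𝓡 d) 𝓘(ℝ, EuclideanSpace ℝ (Fin d)) φ x) v

lemma exists_gradBound [CompactSpace M] {u : M → ℝ} (hu : ContMDiff (𝓡 d) 𝓘(ℝ, ℝ) 1 u) :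
    ∃ C : ℝ, 0 ≤ C ∧ GradBound d u C := by
  choose C hC using fun x₀ : M ↦ eventually_mfderiv_le x₀ hu
  obtain ⟨t, ht⟩ := CompactSpace.elim_nhds_subcover _ hC
  refine ⟨∑ x ∈ t, |C x|, Finset.sum_nonneg fun _ _ ↦ abs_nonneg _, fun x v ↦ ?_⟩
  have hx : x ∈ ⋃ x ∈ t, {y | ∀ v : TangentSpace (𝓡 d) y, |mvfderiv (𝓡 d) u y v| ≤ C x * ‖v‖} := by
    rw [ht]; trivial
  simp only [mem_iUnion] at hx
  obtain ⟨z, hz, hxz⟩ := hx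
  refine (hxz v).trans (mul_le_mul_of_nonneg_right ?_ (norm_nonneg _))
  exact (le_abs_self _).trans
    (Finset.single_le_sum (f := fun z ↦ |C z|) (fun _ _ ↦ abs_nonneg _) hz)

end Geometry


/-! ### Contracting local inverse branches -/

section LocalInverse

variable {d : ℕ} {M : Type*} [MetricSpace M]
  [ChartedSpace (EuclideanSpace ℝ (Fin d)) M] [IsManifold (𝓡 d) ∞ M]

/-- A `C^1` map with injective derivative at `x₀` has a local inverse of class `C^1`. -/
lemma exists_local_inverse {f : M → M} {x₀ : M} (hf : ContMDiffAt (𝓡 d) (𝓡 d) 1 f x₀)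
    (hinj : Function.Injective (mfderiv (𝓡 d) (𝓡 d) f x₀)) :
    ∃ h : M → M, (∀ᶠ z in 𝓝 (f x₀), ContMDiffAt (𝓡 d) (𝓡 d) 1 h z) ∧
      (∀ᶠ z in 𝓝 (f x₀), f (h z) = z) ∧ ∀ᶠ y in 𝓝 x₀, h (f y) = y := by
  have : IsManifold (𝓡 d) 1 M := .of_le (n := ∞) (by simp)
  set φ := extChartAt (𝓡 d) x₀ with hφ
  set ψ := extChartAt (𝓡 d) (f x₀) with hψ
  set F := writtenInExtChartAt (𝓡 d) (𝓡 d) x₀ f with hFdef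
  have hFx : F (φ x₀) = ψ (f x₀) := by
    simp only [F, writtenInExtChartAt, Function.comp, φ, ψ, extChartAt_to_inv]
  have hF : ContDiffAt ℝ 1 F (φ x₀) := by
    have := (contMDiffAt_iff.1 hf).2
    simpa [contDiffWithinAt_univ, F, writtenInExtChartAt, φ, -extChartAt] using this
  have hder : mfderiv (𝓡 d) (𝓡 d) f x₀ = fderiv ℝ F (φ x₀) := by
    rw [(hf.mdifferentiableAt one_ne_zero).mfderiv]
    simp [F, φ, fderivWithin_univ, -extChartAt]
    rfl
  let A : EuclideanSpace ℝ (Fin d) →L[ℝ] EuclideanSpace ℝ (Fin d) := fderiv ℝ F (φ x₀)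
  have hA : Function.Injective A := by
    have h1 := hinj
    rw [hder] at h1
    exact h1
  let e : EuclideanSpace ℝ (Fin d) ≃L[ℝ] EuclideanSpace ℝ (Fin d) :=
    (LinearEquiv.ofInjectiveEndo A.toLinearMap hA).toContinuousLinearEquiv
  have he : HasFDerivAt F (e : EuclideanSpace ℝ (Fin d) →L[ℝ] EuclideanSpace ℝ (Fin d)) (φ x₀) := by
    have h1 : (e : EuclideanSpace ℝ (Fin d) →L[ℝ] EuclideanSpace ℝ (Fin d)) = A := by
      ext v; rfl
    rw [h1]
    exact (hF.differentiableAt one_ne_zero).hasFDerivAt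
  have hstrict := hF.hasStrictFDerivAt' he one_ne_zero
  set g := hF.localInverse he one_ne_zero with hg
  have hgC : ContDiffAt ℝ 1 g (ψ (f x₀)) := by
    have := hF.to_localInverse he one_ne_zero
    rwa [hFx] at this
  have hgx : g (ψ (f x₀)) = φ x₀ := by
    rw [← hFx]; exact hF.localInverse_apply_image he one_ne_zero
  have hgr : ∀ᶠ z in 𝓝 (ψ (f x₀)), F (g z) = z := by
    have := hstrict.eventually_right_inverse
    rwa [hFx] at this
  have hgl : ∀ᶠ y in 𝓝 (φ x₀), g (F y) = y := hstrict.eventually_left_inverse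
  have hψc : ContinuousAt ψ (f x₀) := continuousAt_extChartAt _
  have hφc : ContinuousAt φ x₀ := continuousAt_extChartAt _
  have hφs : ContinuousAt φ.symm (φ x₀) := continuousAt_extChartAt_symm _
  have hgψ : Tendsto (fun z ↦ g (ψ z)) (𝓝 (f x₀)) (𝓝 (φ x₀)) := by
    have := hgC.continuousAt.tendsto.comp hψc.tendsto
    rwa [hgx] at this
  have hhc : Tendsto (fun z ↦ φ.symm (g (ψ z))) (𝓝 (f x₀)) (𝓝 x₀) := by
    have := hφs.tendsto.comp hgψ
    rwa [extChartAt_to_inv] at this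
  have hsrcφ := extChartAt_source_mem_nhds (I := 𝓡 d) x₀
  have hsrcψ := extChartAt_source_mem_nhds (I := 𝓡 d) (f x₀)
  refine ⟨fun z ↦ φ.symm (g (ψ z)), ?_, ?_, ?_⟩
  · have : ContMDiffAt (𝓡 d) (𝓡 d) 1 (fun z ↦ φ.symm (g (ψ z))) (f x₀) := by
      have h1 : ContMDiffAt (𝓡 d) 𝓘(ℝ, EuclideanSpace ℝ (Fin d)) 1 (fun z ↦ g (ψ z)) (f x₀) :=
        (contMDiffAt_iff_contDiffAt.2 hgC).comp (f x₀) contMDiffAt_extChartAt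
      refine ContMDiffAt.comp (f x₀) (I' := 𝓘(ℝ, EuclideanSpace ℝ (Fin d))) ?_ h1
      rw [hgx]
      exact (contMDiffOn_extChartAt_symm x₀).contMDiffAt (extChartAt_target_mem_nhds x₀)
    have h2 := (contMDiffAt_iff_contMDiffAt_nhds (I := 𝓡 d) (I' := 𝓡 d) (n := 1) (by simp)).1 this
    exact h2
  · have h2 : ∀ᶠ z in 𝓝 (f x₀), f (φ.symm (g (ψ z))) ∈ ψ.source := by
      have hfc : Tendsto f (𝓝 x₀) (𝓝 (f x₀)) := hf.continuousAt
      exact (hfc.comp hhc).eventually hsrcψ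
    filter_upwards [hψc.eventually hgr, h2, hsrcψ] with z h1 h2 h3
    exact ψ.injOn h2 h3 h1
  · have h2 : ∀ᶠ y in 𝓝 x₀, f y ∈ ψ.source := hf.continuousAt.eventually hsrcψ
    filter_upwards [hφc.eventually hgl, hsrcφ] with y h1 h3
    have h4 : F (φ y) = ψ (f y) := by
      simp only [F, writtenInExtChartAt, Function.comp]
      rw [φ.left_inv h3]
    rw [← h4, h1, φ.left_inv h3]

variable [RiemannianBundle (fun x : M ↦ TangentSpace (𝓡 d) x)]

lemma ExpandsBy.injective {f : M → M} {ϑ : ℝ} (hϑ : 0 < ϑ) (h : ExpandsBy d f ϑ) (x : M) :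
    Function.Injective (mfderiv (𝓡 d) (𝓡 d) f x) := by
  rw [injective_iff_map_eq_zero]
  intro v hv
  have h1 := h x v
  rw [hv, norm_zero] at h1
  exact norm_le_zero_iff.1 (nonpos_of_mul_nonpos_right h1 hϑ)

/-- An expanding map has local inverse branches which contract distances. -/
lemma ExpandsBy.exists_local_lift [IsRiemannianManifold (𝓡 d) M] {f : M → M} {ϑ : ℝ} (hϑ : 0 < ϑ)
    (hf : ContMDiff (𝓡 d) (𝓡 d) 1 f) (h : ExpandsBy d f ϑ) (x₀ : M) :
    ∃ U ∈ 𝓝 x₀, InjOn f U ∧ ∃ r > 0, ∀ y ∈ U, ∀ x', dist (f y) x' < r →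
      ∃ y', f y' = x' ∧ ϑ * dist y y' ≤ dist (f y) x' := by
  obtain ⟨g, hg1, hg2, hg3⟩ := exists_local_inverse hf.contMDiffAt (h.injective hϑ x₀)
  obtain ⟨r, hr, hball⟩ := Metric.eventually_nhds_iff_ball.1 (hg1.and hg2.eventually_nhds)
  have hC : ∀ z ∈ Metric.ball (f x₀) (3 * (r / 3)), ∀ v : TangentSpace (𝓡 d) z,
      ‖mfderiv (𝓡 d) (𝓡 d) g z v‖ ≤ (⟨ϑ⁻¹, inv_nonneg.2 hϑ.le⟩ : ℝ≥0) * ‖v‖ := by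
    intro z hz v
    rw [show 3 * (r / 3) = r by ring] at hz
    obtain ⟨h1, h2⟩ := hball z hz
    -- Since f ∘ g is the identity near z, ‖v‖ = ‖Df(Dg v)‖ ≥ ϑ‖Dg v‖.
    have h3 : mfderiv (𝓡 d) (𝓡 d) (f ∘ g) z = ContinuousLinearMap.id ℝ _ := by
      have : f ∘ g =ᶠ[𝓝 z] id := h2
      rw [this.mfderiv_eq]
      exact mfderiv_id
    have h4 : mfderiv (𝓡 d) (𝓡 d) (f ∘ g) z =
        (mfderiv (𝓡 d) (𝓡 d) f (g z)).comp (mfderiv (𝓡 d) (𝓡 d) g z) :=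
      mfderiv_comp z (hf.mdifferentiable one_ne_zero _) (h1.mdifferentiableAt one_ne_zero)
    have h5 := h (g z) (mfderiv (𝓡 d) (𝓡 d) g z v)
    have h7 : f (g z) = z := h2.self_of_nhds
    have h6 : ‖mfderiv (𝓡 d) (𝓡 d) f (g z) (mfderiv (𝓡 d) (𝓡 d) g z v)‖ = ‖v‖ := by
      -- The norm depends on the base point, which is `f (g z)` on one side and `z` on the other;
      -- the equality of the points identifies the two norms.
      have h8 : ∀ w, w = z → ∀ u : TangentSpace (𝓡 d) w,
          ‖u‖ = ‖(show TangentSpace (𝓡 d) z from u)‖ := by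
        rintro w rfl u; rfl
      rw [h8 _ h7]
      congr 1
      have h9 : mfderiv (𝓡 d) (𝓡 d) f (g z) (mfderiv (𝓡 d) (𝓡 d) g z v) =
        mfderiv (𝓡 d) (𝓡 d) (f ∘ g) z v := by rw [h4]; rfl
      change mfderiv (𝓡 d) (𝓡 d) f (g z) (mfderiv (𝓡 d) (𝓡 d) g z v) = v
      rw [h9, h3]; rfl
    rw [h6] at h5
    change _ ≤ ϑ⁻¹ * ‖v‖
    rw [le_inv_mul_iff₀ hϑ]
    exact h5
  have hCM : ∀ z ∈ Metric.ball (f x₀) (3 * (r / 3)), ContMDiffAt (𝓡 d) (𝓡 d) 1 g z := by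
    intro z hz
    rw [show 3 * (r / 3) = r by ring] at hz
    exact (hball z hz).1
  -- With both radii r/6, f y and x' lie in the ball of radius r/3, where the Lipschitz estimate for
  -- g follows from its derivative bound on radius r.
  refine ⟨{y | g (f y) = y} ∩ f ⁻¹' Metric.ball (f x₀) (r / 6),
    inter_mem hg3 (hf.continuous.continuousAt.preimage_mem_nhds
      (Metric.ball_mem_nhds _ (by positivity))), ?_, r / 6, by positivity, ?_⟩
  · intro y hy z hz hyz
    rw [← hy.1, hyz, hz.1]
  · intro y hy x' hx'
    have h2 : dist (f y) (f x₀) < r / 6 := hy.2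
    have hx'3 : x' ∈ Metric.ball (f x₀) (r / 3) := by
      rw [Metric.mem_ball]
      have := dist_triangle_left x' (f x₀) (f y)
      linarith
    refine ⟨g x', (hball x' ?_).2.self_of_nhds, ?_⟩
    · exact Metric.ball_subset_ball (by linarith) hx'3
    · have h3 := dist_le_of_mfderiv_le_ball hCM hC (x := f y) (y := x')
        (Metric.ball_subset_ball (by linarith) hy.2) hx'3
      rw [hy.1] at h3
      change _ ≤ ϑ⁻¹ * _ at h3
      rwa [le_inv_mul_iff₀ hϑ] at h3

end LocalInverse


/-! ### The volume density of a chart and the Jacobian are of class C¹ -/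

section Density

lemma contDiff_det {n : ℕ} {k : ℕ∞ω} :
    ContDiff ℝ k (fun A : Fin n → Fin n → ℝ ↦ (Matrix.of A).det) := by
  simp only [Matrix.det_apply']
  refine ContDiff.sum fun σ _ ↦ contDiff_const.mul (contDiff_prod fun i _ ↦ ?_)
  simp only [Matrix.of_apply]
  fun_prop

lemma normDet_pos {U V : Type*} [NormedAddCommGroup U] [InnerProductSpace ℝ U]
    [FiniteDimensional ℝ U] [NormedAddCommGroup V] [InnerProductSpace ℝ V] {A : U →ₗ[ℝ] V}
    (hA : Function.Injective A) : 0 < A.normDet :=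
  lt_of_le_of_ne A.normDet_nonneg (Ne.symm ((A.normDet_ne_zero_tfae.out 4 0).1 hA))

variable {d : ℕ} {M : Type*} [MetricSpace M]
  [ChartedSpace (EuclideanSpace ℝ (Fin d)) M] [IsManifold (𝓡 d) ∞ M]
  [RiemannianBundle (fun x : M ↦ TangentSpace (𝓡 d) x)]

/-- The inverse of the trivialization of the tangent bundle over the chart around `p`. -/
noncomputable def frameMap (p x : M) : EuclideanSpace ℝ (Fin d) →L[ℝ] TangentSpace (𝓡 d) x :=
  haveI : IsManifold (𝓡 d) 1 M := .of_le (n := ∞) (by simp)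
  (trivializationAt (EuclideanSpace ℝ (Fin d)) (TangentSpace (𝓡 d)) p).symmL ℝ x

/-- The density of the Riemannian volume in the chart around `p`. -/
noncomputable def frameDet (p x : M) : ℝ := (frameMap p x : EuclideanSpace ℝ (Fin d) →L[ℝ]
  TangentSpace (𝓡 d) x).toLinearMap.normDet

lemma contMDiffAt_frameMap {p x : M} (hx : x ∈ (chartAt (EuclideanSpace ℝ (Fin d)) p).source)
    (i : Fin d) :
    ContMDiffAt (𝓡 d) ((𝓡 d).tangent) 1 (fun z ↦
      (⟨z, frameMap p z (EuclideanSpace.basisFun (Fin d) ℝ i)⟩ : TangentBundle (𝓡 d) M)) x := by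
  have : IsManifold (𝓡 d) 1 M := .of_le (n := ∞) (by simp)
  have : IsManifold (𝓡 d) 2 M := .of_le (n := ∞) (by norm_cast)
  let e := trivializationAt (EuclideanSpace ℝ (Fin d)) (TangentSpace (𝓡 d)) p
  have hb : e.baseSet = (chartAt (EuclideanSpace ℝ (Fin d)) p).source := rfl
  have h1 := contMDiffAt_localFrame_of_mem (I := 𝓡 d) 1 e
    (EuclideanSpace.basisFun (Fin d) ℝ).toBasis i (x := x) (hb ▸ hx)
  refine h1.congr_of_eventuallyEq ?_
  filter_upwards [e.open_baseSet.mem_nhds (hb ▸ hx)] with z hz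
  rw [Bundle.Trivialization.localFrame_apply_of_mem_baseSet e _ hz]
  simp [Bundle.Trivialization.basisAt, frameMap, e]
  exact Bundle.Trivialization.symmL_apply _ (R := ℝ) hz _

lemma sq_normDet_eq_det {V : Type*} [NormedAddCommGroup V] [InnerProductSpace ℝ V]
    (A : EuclideanSpace ℝ (Fin d) →ₗ[ℝ] V) :
    A.normDet ^ 2 = (Matrix.of fun i j ↦ inner ℝ (A (EuclideanSpace.basisFun (Fin d) ℝ i))
      (A (EuclideanSpace.basisFun (Fin d) ℝ j))).det := by
  have := A.normDet_sq_eq_det_gram (EuclideanSpace.basisFun (Fin d) ℝ)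
  simpa [Matrix.gram] using this

variable [IsContMDiffRiemannianBundle (𝓡 d) ∞ (EuclideanSpace ℝ (Fin d))
    (fun x : M ↦ TangentSpace (𝓡 d) x)]

/-- The norm determinant is the square root of the Gram determinant of the image frame, which is C¹
with the frame and the metric; injectivity keeps it positive, where the root is smooth. The case A =
id gives the chart density, the case A = Df the Jacobian. -/
lemma contMDiffAt_normDet_comp_frameMap {f : M → M} {p x : M}
    {A : ∀ z : M, TangentSpace (𝓡 d) z →L[ℝ] TangentSpace (𝓡 d) (f z)}
    (hA : ∀ i, ContMDiffAt (𝓡 d) ((𝓡 d).tangent) 1 (fun z ↦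
      (⟨f z, A z (frameMap p z (EuclideanSpace.basisFun (Fin d) ℝ i))⟩ : TangentBundle (𝓡 d) M)) x)
    (hinj : Function.Injective ((A x).comp (frameMap p x))) :
    ContMDiffAt (𝓡 d) 𝓘(ℝ, ℝ) 1 (fun z ↦ ((A z).comp (frameMap p z)).toLinearMap.normDet) x := by
  have : IsContMDiffRiemannianBundle (𝓡 d) 1 (EuclideanSpace ℝ (Fin d))
    (fun x : M ↦ TangentSpace (𝓡 d) x) := .of_le (n' := 1) (n := ∞) (by simp)
  have h1 : ContMDiffAt (𝓡 d) 𝓘(ℝ, Fin d → Fin d → ℝ) 1 (fun z i j ↦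
      inner ℝ (A z (frameMap p z (EuclideanSpace.basisFun (Fin d) ℝ i)))
        (A z (frameMap p z (EuclideanSpace.basisFun (Fin d) ℝ j)))) x := by
    rw [contMDiffAt_pi_space]
    intro i
    rw [contMDiffAt_pi_space]
    intro j
    exact (hA i).inner_bundle (hA j)
  have h2 := (contDiff_det (n := d) (k := 1)).contMDiff.contMDiffAt.comp x h1
  have h3 : ∀ z, ((A z).comp (frameMap p z)).toLinearMap.normDet = √((Matrix.of fun i j ↦
      inner ℝ (A z (frameMap p z (EuclideanSpace.basisFun (Fin d) ℝ i)))
        (A z (frameMap p z (EuclideanSpace.basisFun (Fin d) ℝ j)))).det) := by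
    intro z
    have h4 := sq_normDet_eq_det ((A z).comp (frameMap p z)).toLinearMap
    rw [← Real.sqrt_sq (LinearMap.normDet_nonneg _), h4]
    rfl
  have h5 : ((A x).comp (frameMap p x)).toLinearMap.normDet ≠ 0 := (normDet_pos hinj).ne'
  simp only [h3]
  rw [h3, Real.sqrt_ne_zero'] at h5
  exact (Real.contDiffAt_sqrt h5.ne').contMDiffAt.comp x h2

omit [IsContMDiffRiemannianBundle (𝓡 d) ∞ (EuclideanSpace ℝ (Fin d))
    (fun x : M ↦ TangentSpace (𝓡 d) x)] in
omit [RiemannianBundle (fun x : M ↦ TangentSpace (𝓡 d) x)] in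
lemma frameMap_injective {p x : M} (hx : x ∈ (chartAt (EuclideanSpace ℝ (Fin d)) p).source) :
    Function.Injective (frameMap p x : EuclideanSpace ℝ (Fin d) →L[ℝ] TangentSpace (𝓡 d) x) := by
  have : IsManifold (𝓡 d) 1 M := .of_le (n := ∞) (by simp)
  let e := trivializationAt (EuclideanSpace ℝ (Fin d)) (TangentSpace (𝓡 d)) p
  have hb : x ∈ e.baseSet := hx
  intro v w hvw
  have h1 := congrArg (e.continuousLinearMapAt ℝ x) hvw
  simpa only [frameMap, e, Bundle.Trivialization.continuousLinearMapAt_symmL _ hb] using h1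

omit [IsContMDiffRiemannianBundle (𝓡 d) ∞ (EuclideanSpace ℝ (Fin d))
    (fun x : M ↦ TangentSpace (𝓡 d) x)] in
lemma frameDet_pos {p x : M} (hx : x ∈ (chartAt (EuclideanSpace ℝ (Fin d)) p).source) :
    0 < frameDet (d := d) p x :=
  normDet_pos (frameMap_injective hx)

lemma contMDiffAt_frameDet {p x : M} (hx : x ∈ (chartAt (EuclideanSpace ℝ (Fin d)) p).source) :
    ContMDiffAt (𝓡 d) 𝓘(ℝ, ℝ) 1 (frameDet (d := d) p) x :=
  contMDiffAt_normDet_comp_frameMap (f := id) (A := fun z ↦ ContinuousLinearMap.id ℝ _)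
    (fun i ↦ contMDiffAt_frameMap hx i) (frameMap_injective hx)

omit [IsContMDiffRiemannianBundle (𝓡 d) ∞ (EuclideanSpace ℝ (Fin d))
    (fun x : M ↦ TangentSpace (𝓡 d) x)] in
lemma normDet_mfderiv_comp_frameMap (f : M → M) (p x : M) :
    ((mfderiv (𝓡 d) (𝓡 d) f x).comp (frameMap p x)).toLinearMap.normDet =
      jacobian d f x * frameDet (d := d) p x := by
  rw [jacobian, frameDet]
  exact LinearMap.normDet_comp_of_finrank_eq _ _ rfl

omit [IsManifold (𝓡 d) ∞ M] [IsContMDiffRiemannianBundle (𝓡 d) ∞ (EuclideanSpace ℝ (Fin d))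
    (fun x : M ↦ TangentSpace (𝓡 d) x)] in
lemma jacobian_pos {f : M → M} {x : M} (h : Function.Injective (mfderiv (𝓡 d) (𝓡 d) f x)) :
    0 < jacobian d f x :=
  normDet_pos h

/-- Near each point the Jacobian is the quotient of the norm determinants of Df ∘ frame and of the
frame. Here f has to be C², so that its tangent map is C¹. -/
lemma contMDiff_jacobian {f : M → M} (hf : ContMDiff (𝓡 d) (𝓡 d) 2 f)
    (hinj : ∀ x, Function.Injective (mfderiv (𝓡 d) (𝓡 d) f x)) :
    ContMDiff (𝓡 d) 𝓘(ℝ, ℝ) 1 (jacobian d f) := by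
  intro x
  have : IsManifold (𝓡 d) 1 M := .of_le (n := ∞) (by simp)
  have hx : x ∈ (chartAt (EuclideanSpace ℝ (Fin d)) x).source := mem_chart_source _ x
  have h1 : ContMDiffAt (𝓡 d) 𝓘(ℝ, ℝ) 1 (fun z ↦
      ((mfderiv (𝓡 d) (𝓡 d) f z).comp (frameMap x z)).toLinearMap.normDet) x := by
    refine contMDiffAt_normDet_comp_frameMap (fun i ↦ ?_) ((hinj x).comp (frameMap_injective hx))
    have h2 := hf.contMDiff_tangentMap (m := 1) (by norm_num)
    exact h2.contMDiffAt.comp x (contMDiffAt_frameMap hx i)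
  have h2 : ContMDiffAt (𝓡 d) 𝓘(ℝ, ℝ) 1 (fun z ↦
      ((mfderiv (𝓡 d) (𝓡 d) f z).comp (frameMap x z)).toLinearMap.normDet /
        frameDet (d := d) x z) x := h1.div₀ (contMDiffAt_frameDet hx) (frameDet_pos hx).ne'
  refine h2.congr_of_eventuallyEq ?_
  filter_upwards [(chartAt (EuclideanSpace ℝ (Fin d)) x).open_source.mem_nhds hx] with z hz
  rw [normDet_mfderiv_comp_frameMap, mul_div_cancel_right₀ _ (frameDet_pos hz).ne']

lemma contMDiff_log_jacobian {f : M → M} (hf : ContMDiff (𝓡 d) (𝓡 d) 2 f)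
    (hinj : ∀ x, Function.Injective (mfderiv (𝓡 d) (𝓡 d) f x)) :
    ContMDiff (𝓡 d) 𝓘(ℝ, ℝ) 1 (fun x ↦ Real.log (jacobian d f x)) := fun x ↦
  (Real.contDiffAt_log.2 (jacobian_pos (hinj x)).ne').contMDiffAt.comp x
    (contMDiff_jacobian hf hinj x)

end Density


/-! ### Change of variables between charts -/

section ChartVolume

variable {d : ℕ} {M : Type*} [MetricSpace M]
  [ChartedSpace (EuclideanSpace ℝ (Fin d)) M] [IsManifold (𝓡 d) ∞ M]

lemma frameMap_extChartAt_symm {p : M} {y : EuclideanSpace ℝ (Fin d)}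
    (hy : y ∈ (extChartAt (𝓡 d) p).target) (v : EuclideanSpace ℝ (Fin d)) :
    mfderiv 𝓘(ℝ, EuclideanSpace ℝ (Fin d)) (𝓡 d) (extChartAt (𝓡 d) p).symm y v =
      frameMap p ((extChartAt (𝓡 d) p).symm y) v := by
  have : IsManifold (𝓡 d) 1 M := .of_le (n := ∞) (by simp)
  have hx : (extChartAt (𝓡 d) p).symm y ∈ (chartAt (EuclideanSpace ℝ (Fin d)) p).source := by
    have := (extChartAt (𝓡 d) p).map_target hy
    rwa [extChartAt_source] at this
  have h1 := TangentBundle.symmL_trivializationAt (𝕜 := ℝ) (I := 𝓡 d) hx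
  rw [(extChartAt (𝓡 d) p).right_inv hy] at h1
  have h2 : mfderivWithin 𝓘(ℝ, EuclideanSpace ℝ (Fin d)) (𝓡 d) (extChartAt (𝓡 d) p).symm
      (range (𝓡 d)) y =
      mfderiv 𝓘(ℝ, EuclideanSpace ℝ (Fin d)) (𝓡 d) (extChartAt (𝓡 d) p).symm y := by
    rw [ModelWithCorners.range_eq_univ, mfderivWithin_univ]
  rw [← h2, frameMap, h1]
  rfl

lemma mfderiv_frameMap {f : M → M} (hf : ContMDiff (𝓡 d) (𝓡 d) 1 f) {p q : M}
    {y : EuclideanSpace ℝ (Fin d)} (hy : y ∈ (extChartAt (𝓡 d) p).target)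
    (hq : f ((extChartAt (𝓡 d) p).symm y) ∈ (extChartAt (𝓡 d) q).source) :
    ∃ A : EuclideanSpace ℝ (Fin d) →L[ℝ] EuclideanSpace ℝ (Fin d),
      HasFDerivAt (extChartAt (𝓡 d) q ∘ f ∘ (extChartAt (𝓡 d) p).symm) A y ∧
      ∀ v, mfderiv (𝓡 d) (𝓡 d) f ((extChartAt (𝓡 d) p).symm y)
        (frameMap p ((extChartAt (𝓡 d) p).symm y) v) =
        frameMap q (f ((extChartAt (𝓡 d) p).symm y)) (A v) := by
  have : IsManifold (𝓡 d) 1 M := .of_le (n := ∞) (by simp)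
  set x := (extChartAt (𝓡 d) p).symm y with hx
  have hq' : f x ∈ (chartAt (EuclideanSpace ℝ (Fin d)) q).source := by
    rwa [extChartAt_source] at hq
  have h1 : MDifferentiableAt 𝓘(ℝ, EuclideanSpace ℝ (Fin d)) (𝓡 d)
      (extChartAt (𝓡 d) p).symm y :=
    ((contMDiffOn_extChartAt_symm (n := 1) p).contMDiffAt
      ((isOpen_extChartAt_target p).mem_nhds hy)).mdifferentiableAt one_ne_zero
  have h2 : MDifferentiableAt (𝓡 d) (𝓡 d) f x := hf.mdifferentiable one_ne_zero x
  have h3 : MDifferentiableAt (𝓡 d) 𝓘(ℝ, EuclideanSpace ℝ (Fin d)) (extChartAt (𝓡 d) q) (f x) :=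
    mdifferentiableAt_extChartAt hq'
  have h4 : HasMFDerivAt 𝓘(ℝ, EuclideanSpace ℝ (Fin d)) 𝓘(ℝ, EuclideanSpace ℝ (Fin d))
      (extChartAt (𝓡 d) q ∘ f ∘ (extChartAt (𝓡 d) p).symm) y
      ((mfderiv (𝓡 d) 𝓘(ℝ, EuclideanSpace ℝ (Fin d)) (extChartAt (𝓡 d) q) (f x)).comp
        ((mfderiv (𝓡 d) (𝓡 d) f x).comp
        (mfderiv 𝓘(ℝ, EuclideanSpace ℝ (Fin d)) (𝓡 d) (extChartAt (𝓡 d) p).symm y))) :=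
    h3.hasMFDerivAt.comp y (h2.hasMFDerivAt.comp y h1.hasMFDerivAt)
  refine ⟨_, h4.hasFDerivAt, fun v ↦ ?_⟩
  have h5 : f x ∈ (trivializationAt (EuclideanSpace ℝ (Fin d)) (TangentSpace (𝓡 d)) q).baseSet :=
    hq'
  have h6 := TangentBundle.continuousLinearMapAt_trivializationAt (𝕜 := ℝ) (I := 𝓡 d) hq'
  have h7 := Bundle.Trivialization.symmL_continuousLinearMapAt (R := ℝ)
    (trivializationAt (EuclideanSpace ℝ (Fin d)) (TangentSpace (𝓡 d)) q) h5
    (mfderiv (𝓡 d) (𝓡 d) f x (frameMap p x v))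
  rw [h6] at h7
  rw [← frameMap_extChartAt_symm hy] at h7 ⊢
  exact h7.symm

variable [RiemannianBundle (fun x : M ↦ TangentSpace (𝓡 d) x)]

/-- The identity of a Euclidean space as an isometry onto its tangent space. -/
noncomputable def tangentIsometry (y : EuclideanSpace ℝ (Fin d)) :
    EuclideanSpace ℝ (Fin d) →ₗᵢ[ℝ] TangentSpace 𝓘(ℝ, EuclideanSpace ℝ (Fin d)) y where
  toFun v := v
  map_add' _ _ := rfl
  map_smul' _ _ := rfl
  norm_map' _ := norm_tangentSpace_vectorSpace

lemma normDet_extChartAt_symm {p : M} {y : EuclideanSpace ℝ (Fin d)}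
    (hy : y ∈ (extChartAt (𝓡 d) p).target) :
    (mfderiv 𝓘(ℝ, EuclideanSpace ℝ (Fin d)) (𝓡 d)
      (extChartAt (𝓡 d) p).symm y).toLinearMap.normDet =
      frameDet (d := d) p ((extChartAt (𝓡 d) p).symm y) := by
  have h1 := LinearMap.normDet_comp_of_finrank_eq (tangentIsometry y).toLinearMap
    (mfderiv 𝓘(ℝ, EuclideanSpace ℝ (Fin d)) (𝓡 d) (extChartAt (𝓡 d) p).symm y).toLinearMap rfl
  rw [LinearIsometry.normDet_eq_one, mul_one] at h1
  rw [← h1, frameDet]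
  congr 1
  ext v
  exact frameMap_extChartAt_symm hy _

/-- Both sides are the norm determinant of Df applied to the frame at x, factored in two ways. This
converts the Euclidean Jacobian in charts into the Riemannian one. -/
lemma abs_det_mul_frameDet {f : M → M} {p q x : M}
    {A : EuclideanSpace ℝ (Fin d) →L[ℝ] EuclideanSpace ℝ (Fin d)}
    (hA : ∀ v, mfderiv (𝓡 d) (𝓡 d) f x (frameMap p x v) = frameMap q (f x) (A v)) :
    |A.det| * frameDet (d := d) q (f x) = jacobian d f x * frameDet (d := d) p x := by
  rw [← normDet_mfderiv_comp_frameMap]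
  have h1 : ((mfderiv (𝓡 d) (𝓡 d) f x).comp (frameMap p x)).toLinearMap =
      (frameMap q (f x) : EuclideanSpace ℝ (Fin d) →L[ℝ] TangentSpace (𝓡 d) (f x)).toLinearMap ∘ₗ
        A.toLinearMap := LinearMap.ext hA
  rw [h1, LinearMap.normDet_comp_of_finrank_eq _ _ rfl, LinearMap.normDet_eq_abs_det, mul_comm]
  rfl

variable [IsContMDiffRiemannianBundle (𝓡 d) ∞ (EuclideanSpace ℝ (Fin d))
    (fun x : M ↦ TangentSpace (𝓡 d) x)] [MeasurableSpace M] [BorelSpace M]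

lemma continuousOn_frameDet_symm (p : M) :
    ContinuousOn (fun y ↦ frameDet (d := d) p ((extChartAt (𝓡 d) p).symm y))
      (extChartAt (𝓡 d) p).target := by
  intro y hy
  have hx : (extChartAt (𝓡 d) p).symm y ∈ (chartAt (EuclideanSpace ℝ (Fin d)) p).source := by
    have := (extChartAt (𝓡 d) p).map_target hy
    rwa [extChartAt_source] at this
  exact (contMDiffAt_frameDet hx).continuousAt.comp_continuousWithinAt
    (continuousOn_extChartAt_symm p y hy)

lemma lintegral_chartVolume (p : M) {w : M → ℝ≥0∞} (hw : Measurable w) :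
    ∫⁻ x, w x ∂(chartVolume d p) = ∫⁻ y in (extChartAt (𝓡 d) p).target,
      ENNReal.ofReal (frameDet (d := d) p ((extChartAt (𝓡 d) p).symm y)) *
        w ((extChartAt (𝓡 d) p).symm y) := by
  have hT : MeasurableSet (extChartAt (𝓡 d) p).target := (isOpen_extChartAt_target p).measurableSet
  have hm : AEMeasurable (extChartAt (𝓡 d) p).symm
      (volume.restrict (extChartAt (𝓡 d) p).target) :=
    (continuousOn_extChartAt_symm p).aemeasurable hT
  have hN : AEMeasurable (fun y ↦ ENNReal.ofReal
      (mfderiv 𝓘(ℝ, EuclideanSpace ℝ (Fin d)) (𝓡 d)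
        (extChartAt (𝓡 d) p).symm y).toLinearMap.normDet)
      (volume.restrict (extChartAt (𝓡 d) p).target) := by
    refine (((continuousOn_frameDet_symm p).aemeasurable hT).congr ?_).ennreal_ofReal
    filter_upwards [ae_restrict_mem hT] with y hy
    rw [normDet_extChartAt_symm hy]
  rw [chartVolume, lintegral_map' hw.aemeasurable
    (hm.mono_ac (withDensity_absolutelyContinuous _ _)),
    lintegral_withDensity_eq_lintegral_mul₀ hN
      (g := fun y ↦ w ((extChartAt (𝓡 d) p).symm y)) (hw.comp_aemeasurable hm)]
  refine setLIntegral_congr_fun hT fun y hy ↦ ?_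
  simp only [Pi.mul_apply]
  rw [normDet_extChartAt_symm hy]

/-- The Euclidean change of variables for f read in the charts, combined with
`abs_det_mul_frameDet`. For f = id it says that chart volumes agree on overlaps. -/
lemma chartVolume_image [PolishSpace M] {f : M → M} (hf : ContMDiff (𝓡 d) (𝓡 d) 1 f)
    (hJ : Measurable (jacobian d f)) {p q : M} {A : Set M} (hA : MeasurableSet A) (hinj : InjOn f A)
    (hAp : A ⊆ (extChartAt (𝓡 d) p).source) (hAq : MapsTo f A (extChartAt (𝓡 d) q).source) :
    chartVolume d q (f '' A) = ∫⁻ x in A, ENNReal.ofReal (jacobian d f x) ∂(chartVolume d p) := by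
  set φ := extChartAt (𝓡 d) p
  set ψ := extChartAt (𝓡 d) q
  have hfA : MeasurableSet (f '' A) := hA.image_of_continuousOn_injOn hf.continuous.continuousOn hinj
  have hφA : MeasurableSet (φ '' A) := hA.image_of_continuousOn_injOn
    ((continuousOn_extChartAt p).mono hAp) (φ.injOn.mono hAp)
  have hφAT : φ '' A ⊆ φ.target := by
    rintro _ ⟨x, hx, rfl⟩; exact φ.map_source (hAp hx)
  have hleft : ∀ x ∈ A, φ.symm (φ x) = x := fun x hx ↦ φ.left_inv (hAp hx)
  have himage : ψ.target ∩ ψ.symm ⁻¹' (f '' A) = (ψ ∘ f ∘ φ.symm) '' (φ '' A) := by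
    ext y
    constructor
    · rintro ⟨hy, x, hx, hxy⟩
      refine ⟨φ x, ⟨x, hx, rfl⟩, ?_⟩
      simp only [Function.comp_apply, hleft x hx]
      rw [hxy, ψ.right_inv hy]
    · rintro ⟨_, ⟨x, hx, rfl⟩, rfl⟩
      simp only [Function.comp_apply, hleft x hx]
      refine ⟨ψ.map_source (hAq hx), x, hx, ?_⟩
      rw [ψ.left_inv (hAq hx)]
  have hinj' : InjOn (ψ ∘ f ∘ φ.symm) (φ '' A) := by
    rintro _ ⟨x, hx, rfl⟩ _ ⟨z, hz, rfl⟩ h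
    simp only [Function.comp_apply, hleft x hx, hleft z hz] at h
    rw [hinj hx hz (ψ.injOn (hAq hx) (hAq hz) h)]
  have hmf : ∀ y ∈ φ '' A, ∃ B : EuclideanSpace ℝ (Fin d) →L[ℝ] EuclideanSpace ℝ (Fin d),
      HasFDerivAt (ψ ∘ f ∘ φ.symm) B y ∧
      ∀ v, mfderiv (𝓡 d) (𝓡 d) f (φ.symm y) (frameMap p (φ.symm y) v) =
        frameMap q (f (φ.symm y)) (B v) := by
    rintro _ ⟨x, hx, rfl⟩
    exact mfderiv_frameMap hf (hφAT ⟨x, hx, rfl⟩) (by rw [hleft x hx]; exact hAq hx)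
  choose! B hB1 hB2 using hmf
  calc chartVolume d q (f '' A)
      = ∫⁻ x, (f '' A).indicator 1 x ∂(chartVolume d q) := (lintegral_indicator_one hfA).symm
    _ = ∫⁻ y in ψ.target, (ψ.symm ⁻¹' (f '' A)).indicator
          (fun y ↦ ENNReal.ofReal (frameDet (d := d) q (ψ.symm y))) y := by
        rw [lintegral_chartVolume q (measurable_one.indicator hfA)]
        refine lintegral_congr fun y ↦ ?_
        by_cases hy : ψ.symm y ∈ f '' A
        · rw [indicator_of_mem hy, indicator_of_mem (show y ∈ ψ.symm ⁻¹' (f '' A) from hy)]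
          simp [ψ]
        · rw [indicator_of_notMem hy, indicator_of_notMem (show y ∉ ψ.symm ⁻¹' (f '' A) from hy),
            mul_zero]
    _ = ∫⁻ y in (ψ ∘ f ∘ φ.symm) '' (φ '' A), ENNReal.ofReal (frameDet (d := d) q (ψ.symm y)) := by
        have hTm : MeasurableSet ψ.target := (isOpen_extChartAt_target q).measurableSet
        have hm : MeasurableSet (ψ.target ∩ ψ.symm ⁻¹' (f '' A)) := by
          rw [himage]
          refine hφA.image_of_continuousOn_injOn (fun y hy ↦ ?_) hinj'
          exact (hB1 y hy).continuousAt.continuousWithinAt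
        rw [← himage, ← lintegral_indicator hTm, ← lintegral_indicator hm]
        refine lintegral_congr fun y ↦ ?_
        rw [indicator_indicator]
    _ = ∫⁻ y in φ '' A, ENNReal.ofReal |(B y).det| *
          ENNReal.ofReal (frameDet (d := d) q (ψ.symm ((ψ ∘ f ∘ φ.symm) y))) :=
        lintegral_image_eq_lintegral_abs_det_fderiv_mul volume hφA
          (fun y hy ↦ (hB1 y hy).hasFDerivWithinAt) hinj' _
    _ = ∫⁻ y in φ '' A, ENNReal.ofReal (frameDet (d := d) p (φ.symm y)) *
          ENNReal.ofReal (jacobian d f (φ.symm y)) := by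
        refine setLIntegral_congr_fun hφA fun y hy ↦ ?_
        have h1 := abs_det_mul_frameDet (hB2 y hy)
        have h2 : ψ.symm ((ψ ∘ f ∘ φ.symm) y) = f (φ.symm y) := by
          obtain ⟨x, hx, rfl⟩ := hy
          simp only [Function.comp_apply, hleft x hx]
          exact ψ.left_inv (hAq hx)
        simp only [h2]
        rw [← ENNReal.ofReal_mul (abs_nonneg _), h1, mul_comm,
          ENNReal.ofReal_mul (show 0 ≤ frameDet p _ from LinearMap.normDet_nonneg _)]
    _ = ∫⁻ x, A.indicator (fun x ↦ ENNReal.ofReal (jacobian d f x)) x ∂(chartVolume d p) := by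
        rw [lintegral_chartVolume p (hJ.ennreal_ofReal.indicator hA)]
        have hTm : MeasurableSet φ.target := (isOpen_extChartAt_target p).measurableSet
        rw [← lintegral_indicator hTm, ← lintegral_indicator hφA]
        refine lintegral_congr fun y ↦ ?_
        by_cases hy : y ∈ φ '' A
        · have h3 : φ.symm y ∈ A := by
            obtain ⟨x, hx, rfl⟩ := hy; rwa [hleft x hx]
          rw [indicator_of_mem hy, indicator_of_mem (hφAT hy), indicator_of_mem h3]
        · rw [indicator_of_notMem hy]
          by_cases hyT : y ∈ φ.target
          · have h3 : φ.symm y ∉ A := fun h ↦ hy ⟨_, h, φ.right_inv hyT⟩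
            rw [indicator_of_mem hyT, indicator_of_notMem h3, mul_zero]
          · rw [indicator_of_notMem hyT]
    _ = _ := lintegral_indicator hA _

end ChartVolume


/-! ### The glued Riemannian volume -/

section RiemannianVolume

lemma exists_finite_measurable_partition {M : Type*} [TopologicalSpace M] [CompactSpace M]
    [MeasurableSpace M] [BorelSpace M] (U : M → Set M) (hU : ∀ x, U x ∈ 𝓝 x) :
    ∃ (n : ℕ) (V : Fin n → Set M) (c : Fin n → M), (∀ i, MeasurableSet (V i)) ∧
      (∀ i, V i ⊆ U (c i)) ∧ Pairwise (Function.onFun Disjoint V) ∧ ⋃ i, V i = univ := by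
  obtain ⟨t, ht⟩ := CompactSpace.elim_nhds_subcover (fun x ↦ interior (U x))
    (fun x ↦ interior_mem_nhds.2 (hU x))
  let e := (Fintype.equivFin t).symm
  let W : Fin (Fintype.card t) → Set M := fun i ↦ interior (U (e i))
  have hW : ⋃ i, W i = univ := by
    refine eq_univ_of_forall fun x ↦ ?_
    have hx : x ∈ ⋃ x ∈ t, interior (U x) := by rw [ht]; trivial
    obtain ⟨y, hy⟩ := mem_iUnion.1 hx
    obtain ⟨hyt, hxy⟩ := mem_iUnion.1 hy
    exact mem_iUnion.2 ⟨e.symm ⟨y, hyt⟩, by simpa [W] using hxy⟩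
  refine ⟨_, disjointed W, fun i ↦ e i, fun i ↦ ?_,
    fun i ↦ (disjointed_subset W i).trans interior_subset, disjoint_disjointed W,
    by rw [← hW]; exact iUnion_disjointed⟩
  rw [disjointed_apply, Finset.sup_eq_iSup]
  exact isOpen_interior.measurableSet.diff
    (Finset.measurableSet_biUnion _ fun _ _ ↦ isOpen_interior.measurableSet)

variable {d : ℕ} {M : Type*} [MetricSpace M] [CompactSpace M]
  [ChartedSpace (EuclideanSpace ℝ (Fin d)) M] [IsManifold (𝓡 d) ∞ M]
  [RiemannianBundle (fun x : M ↦ TangentSpace (𝓡 d) x)]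
  [IsContMDiffRiemannianBundle (𝓡 d) ∞ (EuclideanSpace ℝ (Fin d))
    (fun x : M ↦ TangentSpace (𝓡 d) x)] [MeasurableSpace M] [BorelSpace M]

lemma jacobian_id : jacobian d (id : M → M) = fun _ ↦ 1 := by
  ext x
  rw [jacobian, mfderiv_id]
  exact LinearMap.normDet_id

lemma chartVolume_eq_of_subset {p q : M} {A : Set M} (hA : MeasurableSet A)
    (hAp : A ⊆ (extChartAt (𝓡 d) p).source) (hAq : A ⊆ (extChartAt (𝓡 d) q).source) :
    chartVolume d q A = chartVolume d p A := by
  have h := chartVolume_image (d := d) (f := id) contMDiff_id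
    (by rw [jacobian_id]; exact measurable_const) hA (injOn_id A) hAp hAq
  rw [image_id] at h
  rw [h, jacobian_id]
  simp

lemma chartVolume_compl_source (p : M) :
    chartVolume d p (extChartAt (𝓡 d) p).sourceᶜ = 0 := by
  have hS : MeasurableSet (extChartAt (𝓡 d) p).sourceᶜ :=
    (isOpen_extChartAt_source p).measurableSet.compl
  rw [← lintegral_indicator_one hS, lintegral_chartVolume p (measurable_one.indicator hS)]
  have hT : MeasurableSet (extChartAt (𝓡 d) p).target := (isOpen_extChartAt_target p).measurableSet
  rw [← lintegral_zero (μ := volume.restrict (extChartAt (𝓡 d) p).target)]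
  refine setLIntegral_congr_fun hT fun y hy ↦ ?_
  have h1 : (extChartAt (𝓡 d) p).symm y ∉ (extChartAt (𝓡 d) p).sourceᶜ :=
    fun h ↦ h ((extChartAt (𝓡 d) p).map_target hy)
  simp only [indicator_of_notMem h1, mul_zero]

/-- The Riemannian volume of a subset of a chart domain is its volume in the chart. -/
lemma riemannianVolume_eq_chartVolume {p : M} {A : Set M} (hA : MeasurableSet A)
    (hAp : A ⊆ (extChartAt (𝓡 d) p).source) :
    riemannianVolume d M A = chartVolume d p A := by
  obtain ⟨n, V, c, hV, hVU, hVd, hVcov⟩ := exists_finite_measurable_partition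
    (fun x : M ↦ (extChartAt (𝓡 d) x).source) (fun x ↦ extChartAt_source_mem_nhds x)
  -- A supremum of measures is not computed set by set. The measure ν, glued over a finite partition
  -- subordinate to charts, dominates every chart volume and hence the supremum, and inside a chart
  -- domain it equals the chart volume.
  let ν : Measure M := ∑ i, (chartVolume d (c i)).restrict (V i)
  have hsplit : ∀ (m : Measure M) {B : Set M}, MeasurableSet B → m B = ∑ i, m (B ∩ V i) := by
    intro m B hB
    rw [← tsum_fintype (L := SummationFilter.unconditional _), ← measure_iUnion, ← inter_iUnion,
      hVcov, inter_univ]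
    · exact fun i j hij ↦ (hVd hij).mono inter_subset_right inter_subset_right
    · exact fun i ↦ hB.inter (hV i)
  have hν : ∀ {B : Set M}, MeasurableSet B → ν B = ∑ i, chartVolume d (c i) (B ∩ V i) := by
    intro B hB
    simp only [ν, Measure.coe_finsetSum, Finset.sum_apply, Measure.restrict_apply hB]
  have hνle : riemannianVolume d M ≤ ν := by
    refine iSup_le fun q ↦ Measure.le_iff.2 fun B hB ↦ ?_
    have hq : chartVolume d q B = chartVolume d q (B ∩ (extChartAt (𝓡 d) q).source) := by
      rw [measure_inter_conull (chartVolume_compl_source q)]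
    have hBq := hB.inter (isOpen_extChartAt_source (I := 𝓡 d) q).measurableSet
    rw [hq, hsplit _ hBq, hν hB]
    refine Finset.sum_le_sum fun i _ ↦ ?_
    rw [chartVolume_eq_of_subset (p := (c i)) (hBq.inter (hV i))
      (inter_subset_right.trans (hVU i)) (inter_subset_left.trans inter_subset_right)]
    exact measure_mono (inter_subset_inter_left _ inter_subset_left)
  have hle : ∀ q, chartVolume d q ≤ riemannianVolume d M := fun q ↦ le_iSup _ q
  refine le_antisymm ?_ (hle p A)
  refine (hνle A).trans ?_
  rw [hν hA, hsplit (chartVolume d p) hA]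
  refine Finset.sum_le_sum fun i _ ↦ ?_
  rw [chartVolume_eq_of_subset (hA.inter (hV i)) (inter_subset_left.trans hAp)
    (inter_subset_right.trans (hVU i))]

lemma restrict_riemannianVolume (p : M) {A : Set M} (hA : MeasurableSet A)
    (hAp : A ⊆ (extChartAt (𝓡 d) p).source) :
    (riemannianVolume d M).restrict A = (chartVolume d p).restrict A := by
  ext B hB
  rw [Measure.restrict_apply hB, Measure.restrict_apply hB,
    riemannianVolume_eq_chartVolume (hB.inter hA) (inter_subset_right.trans hAp)]

/-- Local change of variables for the Riemannian volume. -/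
lemma exists_riemannianVolume_image {f : M → M} (hf : ContMDiff (𝓡 d) (𝓡 d) 1 f)
    (hJ : Measurable (jacobian d f)) (x₀ : M) :
    ∃ U ∈ 𝓝 x₀, ∀ A ⊆ U, MeasurableSet A → InjOn f A →
      riemannianVolume d M (f '' A) =
        ∫⁻ x in A, ENNReal.ofReal (jacobian d f x) ∂(riemannianVolume d M) := by
  refine ⟨(extChartAt (𝓡 d) x₀).source ∩ f ⁻¹' (extChartAt (𝓡 d) (f x₀)).source,
    inter_mem (extChartAt_source_mem_nhds x₀) (hf.continuous.continuousAt.preimage_mem_nhds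
      (extChartAt_source_mem_nhds (f x₀))), fun A hAU hA hinj ↦ ?_⟩
  have hAp := hAU.trans inter_subset_left
  have hAq : MapsTo f A (extChartAt (𝓡 d) (f x₀)).source := fun x hx ↦ (hAU hx).2
  have hfA : MeasurableSet (f '' A) :=
    hA.image_of_continuousOn_injOn hf.continuous.continuousOn hinj
  rw [restrict_riemannianVolume x₀ hA hAp, ← chartVolume_image hf hJ hA hinj hAp hAq]
  exact riemannianVolume_eq_chartVolume hfA hAq.image_subset

lemma isOpenPosMeasure_riemannianVolume : (riemannianVolume d M).IsOpenPosMeasure := by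
  refine ⟨fun U hU hne h0 ↦ ?_⟩
  obtain ⟨p, hp⟩ := hne
  set φ := extChartAt (𝓡 d) p
  have hW : IsOpen (U ∩ φ.source) := hU.inter (isOpen_extChartAt_source p)
  have h1 : chartVolume d p (U ∩ φ.source) = 0 := by
    rw [← riemannianVolume_eq_chartVolume hW.measurableSet inter_subset_right]
    exact measure_mono_null inter_subset_left h0
  rw [← lintegral_indicator_one hW.measurableSet,
    lintegral_chartVolume p (measurable_one.indicator hW.measurableSet)] at h1
  have hO : IsOpen (φ.target ∩ φ.symm ⁻¹' (U ∩ φ.source)) :=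
    (continuousOn_extChartAt_symm p).isOpen_inter_preimage (isOpen_extChartAt_target p) hW
  have h2 : ∫⁻ y in φ.target ∩ φ.symm ⁻¹' (U ∩ φ.source),
      ENNReal.ofReal (frameDet (d := d) p (φ.symm y)) = 0 := by
    refine le_antisymm (le_trans ?_ h1.le) zero_le
    rw [← lintegral_indicator hO.measurableSet,
      ← lintegral_indicator (isOpen_extChartAt_target p).measurableSet]
    refine lintegral_mono fun y ↦ ?_
    by_cases hy : y ∈ φ.target ∩ φ.symm ⁻¹' (U ∩ φ.source)
    · rw [indicator_of_mem hy, indicator_of_mem hy.1,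
        indicator_of_mem (show φ.symm y ∈ U ∩ φ.source from hy.2)]
      simp [φ]
    · rw [indicator_of_notMem hy]; exact zero_le
  have h3 : ∀ y ∈ φ.target ∩ φ.symm ⁻¹' (U ∩ φ.source),
      0 < ENNReal.ofReal (frameDet (d := d) p (φ.symm y)) := by
    intro y hy
    have := hy.2.2
    rw [extChartAt_source] at this
    exact ENNReal.ofReal_pos.2 (frameDet_pos this)
  have hpos : volume (φ.target ∩ φ.symm ⁻¹' (U ∩ φ.source)) ≠ 0 := by
    refine (hO.measure_pos volume ⟨φ p, mem_extChartAt_target p, ?_⟩).ne'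
    simp only [mem_preimage, φ, extChartAt_to_inv]
    exact ⟨hp, mem_extChartAt_source p⟩
  rw [setLIntegral_eq_zero_iff' hO.measurableSet] at h2
  · refine hpos (measure_mono_null ?_ h2)
    exact fun y hy h ↦ (h3 y hy).ne' (h hy)
  · exact (((continuousOn_frameDet_symm p).mono inter_subset_left).aemeasurable
      hO.measurableSet).ennreal_ofReal

end RiemannianVolume


/-! ### Global lifts and the specification property -/

section Expanding

/-- Any two points are joined by chains with arbitrarily small steps whose total length is
arbitrarily close to the distance of the points. -/
def HasChains (M : Type*) [MetricSpace M] : Prop :=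
  ∀ (x y : M) (r δ : ℝ), 0 < r → 0 < δ →
    ∃ (n : ℕ) (c : ℕ → M), c 0 = x ∧ c n = y ∧ (∀ i < n, dist (c i) (c (i + 1)) < r) ∧
      ∑ i ∈ Finset.range n, dist (c i) (c (i + 1)) ≤ dist x y + δ

/-- A continuous map which is locally injective, has local inverse branches contracting by `ϑ⁻¹`
and transforms the measure `μ` with the Jacobian `J`. -/
structure IsExpandingMap {M : Type*} [MetricSpace M] [MeasurableSpace M] (μ : Measure M)
    (J : M → ℝ) (ϑ : ℝ) (f : M → M) : Prop where
  continuous : Continuous f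
  jac_continuous : Continuous J
  jac_pos : ∀ x, 0 < J x
  lift : ∀ x₀, ∃ U ∈ 𝓝 x₀, InjOn f U ∧ ∃ r > 0, ∀ y ∈ U, ∀ x', dist (f y) x' < r →
      ∃ y', f y' = x' ∧ ϑ * dist y y' ≤ dist (f y) x'
  image : ∀ x₀, ∃ U ∈ 𝓝 x₀, ∀ A ⊆ U, MeasurableSet A → InjOn f A →
      μ (f '' A) = ∫⁻ x in A, ENNReal.ofReal (J x) ∂μ

/-- Every point of `M` has a preimage under `f` at `ϑ⁻¹` times the distance of the images. -/
def HasLift {M : Type*} [MetricSpace M] (ϑ : ℝ) (f : M → M) : Prop :=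
  ∀ y x', ∃ y', f y' = x' ∧ ϑ * dist y y' ≤ dist (f y) x'

variable {M : Type*} [MetricSpace M]

lemma IsExpandingMap.exists_uniform_lift [CompactSpace M] [MeasurableSpace M] {μ : Measure M}
    {J : M → ℝ} {ϑ : ℝ} {f : M → M} (h : IsExpandingMap μ J ϑ f) :
    ∃ r > 0, ∀ y x', dist (f y) x' < r → ∃ y', f y' = x' ∧ ϑ * dist y y' ≤ dist (f y) x' := by
  choose U hU _ r hr hlift using h.lift
  obtain ⟨t, ht⟩ := CompactSpace.elim_nhds_subcover U hU
  by_cases hne : t.Nonempty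
  · obtain ⟨z, hz, hmin⟩ := t.exists_min_image r hne
    refine ⟨r z, hr z, fun y x' hd ↦ ?_⟩
    have hy : y ∈ ⋃ x ∈ t, U x := by rw [ht]; trivial
    obtain ⟨w, hw⟩ := mem_iUnion.1 hy
    obtain ⟨hwt, hyw⟩ := mem_iUnion.1 hw
    exact hlift w y hyw x' (hd.trans_le (hmin w hwt))
  · refine ⟨1, one_pos, fun y ↦ ?_⟩
    have hy : y ∈ ⋃ x ∈ t, U x := by rw [ht]; trivial
    rw [Finset.not_nonempty_iff_eq_empty.1 hne] at hy
    simp at hy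

lemma IsExpandingMap.exists_separation [CompactSpace M] [MeasurableSpace M] {μ : Measure M}
    {J : M → ℝ} {ϑ : ℝ} {f : M → M} (h : IsExpandingMap μ J ϑ f) :
    ∃ s > 0, ∀ y y', f y = f y' → dist y y' < s → y = y' := by
  choose U hU hinj _ using h.lift
  obtain ⟨s, hs, hleb⟩ := lebesgue_number_lemma_of_metric (s := univ) (c := fun x ↦ interior (U x))
    isCompact_univ (fun _ ↦ isOpen_interior)
    (fun x _ ↦ mem_iUnion.2 ⟨x, mem_interior_iff_mem_nhds.2 (hU x)⟩)
  refine ⟨s, hs, fun y y' hf hd ↦ ?_⟩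
  obtain ⟨x, hx⟩ := hleb y trivial
  exact hinj x (interior_subset (hx (Metric.mem_ball_self hs)))
    (interior_subset (hx (by rwa [Metric.mem_ball, dist_comm]))) hf

/-- A chain from f y to x' with steps below the uniform lifting radius is lifted step by step, each
step shrinking by ϑ⁻¹. This makes the local lifts global. -/
lemma IsExpandingMap.hasLift [CompactSpace M] [MeasurableSpace M] {μ : Measure M}
    {J : M → ℝ} {ϑ : ℝ} (hϑ : 0 < ϑ) {f : M → M} (h : IsExpandingMap μ J ϑ f)
    (hM : HasChains M) : HasLift ϑ f := by
  obtain ⟨r, hr, hlift⟩ := h.exists_uniform_lift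
  intro y x'
  have key : ∀ δ > 0, ∃ y', f y' = x' ∧ ϑ * dist y y' ≤ dist (f y) x' + δ := by
    intro δ hδ
    obtain ⟨n, c, h0, hn, hstep, hsum⟩ := hM (f y) x' r δ hr hδ
    have hind : ∀ k ≤ n, ∃ y', f y' = c k ∧
        ϑ * dist y y' ≤ ∑ i ∈ Finset.range k, dist (c i) (c (i + 1)) := by
      intro k
      induction k with
      | zero => exact fun _ ↦ ⟨y, h0.symm, by simp⟩
      | succ k ih =>
        intro hk
        obtain ⟨w, hw1, hw2⟩ := ih (by omega)
        obtain ⟨y', hy1, hy2⟩ := hlift w (c (k + 1)) (by rw [hw1]; exact hstep k (by omega))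
        refine ⟨y', hy1, ?_⟩
        rw [Finset.sum_range_succ]
        rw [hw1] at hy2
        have := mul_le_mul_of_nonneg_left (dist_triangle y w y') hϑ.le
        linarith
    obtain ⟨y', h1, h2⟩ := hind n le_rfl
    exact ⟨y', by rw [h1, hn], h2.trans hsum⟩
  -- The fibre is compact, so it has a point nearest to y; that point satisfies the estimate for
  -- every δ and hence for δ = 0.
  have hcomp : IsCompact (f ⁻¹' {x'}) := (isClosed_singleton.preimage h.continuous).isCompact
  obtain ⟨y₁, hy₁, -⟩ := key 1 one_pos
  obtain ⟨y', hy', hmin⟩ := hcomp.exists_isMinOn (f := fun z ↦ dist y z) ⟨y₁, hy₁⟩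
    (continuous_const.dist continuous_id).continuousOn
  refine ⟨y', hy', le_of_forall_pos_le_add fun δ hδ ↦ ?_⟩
  obtain ⟨z, hz1, hz2⟩ := key δ hδ
  exact (mul_le_mul_of_nonneg_left (hmin hz1) hϑ.le).trans hz2

lemma comp_add (f : ℕ → M → M) (j m n : ℕ) (x : M) :
    comp f j (m + n) x = comp f (j + m) n (comp f j m x) := by
  induction n with
  | zero => rfl
  | succ n ih =>
    change f (j + (m + n)) (comp f j (m + n) x) = f (j + m + n) _
    rw [ih, add_assoc]

lemma comp_succ' (f : ℕ → M → M) (j n : ℕ) (x : M) :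
    comp f j (n + 1) x = comp f (j + 1) n (f j x) := by
  rw [add_comm n 1, comp_add]; rfl

lemma continuous_comp {f : ℕ → M → M} (hf : ∀ i, Continuous (f i)) (j n : ℕ) :
    Continuous (comp f j n) := by
  induction n with
  | zero => exact continuous_id
  | succ n ih => exact (hf _).comp ih

/-- The endpoint is lifted backwards through one map at a time, gaining a factor ϑ⁻¹ each time: at
time m the two orbits are within ϑ^(m-n) of the final distance. -/
lemma exists_lift_comp {ϑ : ℝ} (hϑ : 0 < ϑ) {f : ℕ → M → M} (hf : ∀ i, HasLift ϑ (f i)) (j n : ℕ)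
    (y x' : M) : ∃ y', comp f j n y' = x' ∧ ∀ m ≤ n,
      ϑ ^ (n - m) * dist (comp f j m y) (comp f j m y') ≤ dist (comp f j n y) x' := by
  induction n generalizing x' with
  | zero =>
    refine ⟨x', rfl, fun m hm ↦ ?_⟩
    obtain rfl : m = 0 := by omega
    simp [comp]
  | succ n ih =>
    obtain ⟨w, hw1, hw2⟩ := hf (j + n) (comp f j n y) x'
    obtain ⟨y', hy1, hy2⟩ := ih w
    have h1 : comp f j (n + 1) y' = x' := by rw [← hw1, ← hy1]; rfl
    refine ⟨y', h1, fun m hm ↦ ?_⟩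
    rcases Nat.of_le_succ hm with hm | rfl
    · have h2 := mul_le_mul_of_nonneg_left (hy2 m hm) hϑ.le
      rw [Nat.succ_sub hm, pow_succ', mul_assoc]
      exact h2.trans hw2
    · simp [h1]

/-- Expanding families have the specification property, with gap `D` if `ϑ ^ D ε` exceeds the
diameter. -/
lemma isSpecificationGap [CompactSpace M] {N : ℕ} {F : Fin N → M → M} {ϑ Δ ε : ℝ} {L D : ℕ}
    (hϑ : 1 ≤ ϑ) (hF : ∀ i, HasLift ϑ (F i)) (hc : ∀ i, Continuous (F i))
    (hΔ : ∀ x y : M, dist x y ≤ Δ) (hD : Δ ≤ ϑ ^ D * ε) : IsSpecificationGap F ε L D := by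
  intro α a x ha
  have hϑ0 : 0 < ϑ := by linarith
  set f : ℕ → M → M := fun j ↦ F (α j) with hf
  have hfl : ∀ i, HasLift ϑ (f i) := fun i ↦ hF _
  have hε : 0 ≤ ε := by
    have h1 : 0 ≤ ϑ ^ D * ε := dist_nonneg.trans ((hΔ (x 0) (x 0)).trans hD)
    exact nonneg_of_mul_nonneg_right h1 (by positivity)
  have hmono : Monotone a := monotone_nat_of_le_succ fun k ↦ by have := ha k; omega
  -- Finitely many segments first, with the initial index free. A point w shadowing the later
  -- segments is pulled back along the orbit of x k₀; the pullback hits w exactly, so the later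
  -- segments are undisturbed.
  have key : ∀ K k₀, ∃ z, ∀ k ≤ K, ∀ i < L,
      dist (comp f (a k₀) (a (k₀ + k) - a k₀ + (i + 1)) z)
        (comp f (a (k₀ + k)) (i + 1) (x (k₀ + k))) ≤ ε := by
    intro K
    induction K with
    | zero =>
      intro k₀
      refine ⟨x k₀, fun k hk i _ ↦ ?_⟩
      obtain rfl : k = 0 := by omega
      simp [hε]
    | succ K ih =>
      intro k₀
      obtain ⟨w, hw⟩ := ih (k₀ + 1)
      obtain ⟨z, hz1, hz2⟩ := exists_lift_comp hϑ0 hfl (a k₀) (a (k₀ + 1) - a k₀) (x k₀) w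
      have hak := ha k₀
      refine ⟨z, fun k hk i hi ↦ ?_⟩
      rcases k with _ | k
      -- As i + 1 ≤ L, at least D maps remain before the next segment, so the distance is at most Δ
      -- ϑ^(-D) ≤ ε.
      · have h1 := (hz2 (i + 1) (by omega)).trans (hΔ _ _)
        have h2 : ϑ ^ D ≤ ϑ ^ (a (k₀ + 1) - a k₀ - (i + 1)) := pow_le_pow_right₀ hϑ (by omega)
        have h3 : ϑ ^ D * dist (comp f (a k₀) (i + 1) (x k₀)) (comp f (a k₀) (i + 1) z) ≤
            ϑ ^ D * ε := (mul_le_mul_of_nonneg_right h2 dist_nonneg).trans (h1.trans hD)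
        have h4 := le_of_mul_le_mul_left h3 (by positivity)
        rw [dist_comm] at h4
        simpa using h4
      · have h1 := hw k (by omega) i hi
        have h2 : a (k₀ + 1) ≤ a (k₀ + 1 + k) := hmono (by omega)
        have h3 : a (k₀ + (k + 1)) - a k₀ + (i + 1) =
            (a (k₀ + 1) - a k₀) + (a (k₀ + 1 + k) - a (k₀ + 1) + (i + 1)) := by
          rw [show k₀ + (k + 1) = k₀ + 1 + k by ring]; omega
        rw [h3, comp_add, hz1, show a k₀ + (a (k₀ + 1) - a k₀) = a (k₀ + 1) by omega,
          show k₀ + (k + 1) = k₀ + 1 + k by ring]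
        exact h1
  -- The sets of points shadowing the segments up to K are nested, compact and nonempty; a common
  -- point shadows all segments.
  let C : ℕ → Set M := fun K ↦ {z | ∀ k ≤ K, ∀ i < L,
    dist (comp f 0 (a k + i + 1) z) (comp f (a k) (i + 1) (x k)) ≤ ε}
  have hCc : ∀ K, IsClosed (C K) := by
    intro K
    simp only [C, ofPred_forall]
    refine isClosed_iInter fun k ↦ isClosed_iInter fun _ ↦ isClosed_iInter fun i ↦
      isClosed_iInter fun _ ↦ ?_
    exact isClosed_le ((continuous_comp (fun i ↦ hc _) _ _).dist continuous_const) continuous_const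
  have hCne : ∀ K, (C K).Nonempty := by
    intro K
    obtain ⟨w, hw⟩ := key K 0
    obtain ⟨z, hz, -⟩ := exists_lift_comp hϑ0 hfl 0 (a 0) w w
    refine ⟨z, fun k hk i hi ↦ ?_⟩
    have h1 := hw k hk i hi
    have h2 : a 0 ≤ a k := hmono (Nat.zero_le k)
    simp only [zero_add] at h1
    rw [show a k + i + 1 = a 0 + (a k - a 0 + (i + 1)) by omega, comp_add, hz, zero_add]
    exact h1
  obtain ⟨z, hz⟩ := IsCompact.nonempty_iInter_of_sequence_nonempty_isCompact_isClosed C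
    (fun K z hz k hk ↦ hz k (by omega)) hCne (hCc 0).isCompact hCc
  exact ⟨z, fun k ↦ mem_iInter.1 hz k k le_rfl⟩

end Expanding


/-! ### Sums over fibres and their change of variables -/

section FiberSum

variable {M : Type*} [MetricSpace M]

/-- Local estimates multiply along a chain and their exponents add up to C times its length. Values
in [0, ∞] are allowed because the finiteness of fibre sums is itself deduced from this estimate. -/
lemma HasChains.le_exp_mul (hM : HasChains M) {u : M → ℝ≥0∞} {C r : ℝ} (hC : 0 ≤ C) (hr : 0 < r)
    (h : ∀ x y, dist x y < r → u x ≤ ENNReal.ofReal (Real.exp (C * dist x y)) * u y) (x y : M) :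
    u x ≤ ENNReal.ofReal (Real.exp (C * dist x y)) * u y := by
  have h1 : ∀ δ > 0, u x ≤ ENNReal.ofReal (Real.exp (C * (dist x y + δ))) * u y := by
    intro δ hδ
    obtain ⟨n, c, h0, hn, hstep, hsum⟩ := hM x y r δ hr hδ
    have key : ∀ k ≤ n, u (c 0) ≤ ENNReal.ofReal
        (Real.exp (C * ∑ i ∈ Finset.range k, dist (c i) (c (i + 1)))) * u (c k) := by
      intro k
      induction k with
      | zero => simp
      | succ k ih =>
        intro hk
        rw [Finset.sum_range_succ, mul_add, Real.exp_add, ENNReal.ofReal_mul (Real.exp_pos _).le,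
          mul_assoc]
        exact (ih (by omega)).trans (mul_le_mul_right (h _ _ (hstep k (by omega))) _)
    have h2 := key n le_rfl
    rw [h0, hn] at h2
    refine h2.trans (mul_le_mul_left (ENNReal.ofReal_le_ofReal ?_) _)
    gcongr
  have h2 : Tendsto (fun δ ↦ ENNReal.ofReal (Real.exp (C * (dist x y + δ))) * u y) (𝓝[>] 0)
      (𝓝 (ENNReal.ofReal (Real.exp (C * (dist x y + 0))) * u y)) := by
    refine ENNReal.Tendsto.mul_const ?_ (Or.inl (ENNReal.ofReal_pos.2 (Real.exp_pos _)).ne')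
    refine (ENNReal.continuous_ofReal.tendsto _).comp ?_
    exact (Continuous.tendsto (f := fun δ : ℝ ↦ Real.exp (C * (dist x y + δ)))
      (by fun_prop) 0).mono_left nhdsWithin_le_nhds
  rw [add_zero] at h2
  refine ge_of_tendsto h2 ?_
  filter_upwards [self_mem_nhdsWithin] with δ hδ using h1 δ hδ

/-- The sum of `w` over the fiber of `f`. -/
noncomputable def fiberSum {M : Type*} (f : M → M) (w : M → ℝ≥0∞) (x : M) : ℝ≥0∞ :=
  ∑' y : f ⁻¹' {x}, w y

variable [CompactSpace M] [MeasurableSpace M] [BorelSpace M] {μ : Measure M}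
  {J : M → ℝ} {ϑ : ℝ} {f : M → M}

lemma IsExpandingMap.exists_partition (h : IsExpandingMap μ J ϑ f) :
    ∃ (n : ℕ) (V : Fin n → Set M), (∀ i, MeasurableSet (V i)) ∧
      Pairwise (Function.onFun Disjoint V) ∧ ⋃ i, V i = univ ∧ (∀ i, InjOn f (V i)) ∧
      ∀ i, ∀ A ⊆ V i, MeasurableSet A → μ (f '' A) = ∫⁻ x in A, ENNReal.ofReal (J x) ∂μ := by
  choose U₁ hU₁ hinj _ using h.lift
  choose U₂ hU₂ him using h.image
  obtain ⟨n, V, c, hV, hVU, hVd, hVc⟩ := exists_finite_measurable_partition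
    (fun x ↦ U₁ x ∩ U₂ x) (fun x ↦ inter_mem (hU₁ x) (hU₂ x))
  have hVi : ∀ i, InjOn f (V i) := fun i ↦
    (hinj (c i)).mono ((hVU i).trans inter_subset_left)
  exact ⟨n, V, hV, hVd, hVc, hVi, fun i A hA hAm ↦ him (c i) A
    (hA.trans ((hVU i).trans inter_subset_right)) hAm ((hVi i).mono hA)⟩

lemma IsExpandingMap.map_restrict (h : IsExpandingMap μ J ϑ f) {V : Set M} (hV : MeasurableSet V)
    (him : ∀ A ⊆ V, MeasurableSet A → μ (f '' A) = ∫⁻ x in A, ENNReal.ofReal (J x) ∂μ) :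
    ((μ.withDensity fun x ↦ ENNReal.ofReal (J x)).restrict V).map f = μ.restrict (f '' V) := by
  ext B hB
  have hfB := h.continuous.measurable hB
  rw [Measure.map_apply h.continuous.measurable hB, Measure.restrict_apply hfB,
    withDensity_apply _ (hfB.inter hV), ← him _ inter_subset_right (hfB.inter hV),
    Measure.restrict_apply hB, image_preimage_inter]

/-- On each piece of a finite partition into sets of injectivity, w is transported to the image by
the inverse of f and extended by zero; the fibre sum is the sum of these functions, and the local
change of variables applies to each. -/
lemma IsExpandingMap.lintegral_fiberSum (h : IsExpandingMap μ J ϑ f) {w : M → ℝ≥0∞}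
    (hw : Measurable w) :
    Measurable (fiberSum f w) ∧ ∀ ψ : M → ℝ≥0∞, Measurable ψ →
      ∫⁻ x, ψ x * fiberSum f w x ∂μ = ∫⁻ y, ENNReal.ofReal (J y) * (ψ (f y) * w y) ∂μ := by
  obtain ⟨n, V, hV, hVd, hVc, hVi, him⟩ := h.exists_partition
  have hemb : ∀ i, MeasurableEmbedding ((V i).domRestrict f) := fun i ↦
    h.continuous.continuousOn.measurableEmbedding (hV i) (hVi i)
  let u : Fin n → M → ℝ≥0∞ := fun i ↦
    Function.extend ((V i).domRestrict f) (fun y ↦ w y) (fun _ ↦ 0)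
  have hu : ∀ i, Measurable (u i) := fun i ↦
    (hemb i).measurable_extend (hw.comp measurable_subtype_coe) measurable_const
  have hu1 : ∀ i, ∀ y ∈ V i, u i (f y) = w y := fun i y hy ↦
    (hemb i).injective.extend_apply (fun y : V i ↦ w y) (fun _ ↦ 0) ⟨y, hy⟩
  have hu2 : ∀ i, ∀ x ∉ f '' V i, u i x = 0 := by
    intro i x hx
    refine Function.extend_apply' _ _ _ ?_
    rintro ⟨⟨y, hy⟩, hyx⟩
    exact hx ⟨y, hy, hyx⟩
  have hsum : ∀ x, fiberSum f w x = ∑ i, u i x := by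
    intro x
    have h1 : ∀ i, u i x = ∑' y, (f ⁻¹' {x} ∩ V i).indicator w y := by
      intro i
      by_cases hx : x ∈ f '' V i
      · obtain ⟨y, hy, rfl⟩ := hx
        rw [tsum_eq_single y, hu1 i y hy,
          indicator_of_mem (show y ∈ f ⁻¹' {f y} ∩ V i from ⟨rfl, hy⟩)]
        intro z hz
        refine indicator_of_notMem (fun hz' ↦ hz (hVi i hz'.2 hy hz'.1)) _
      · rw [hu2 i x hx, eq_comm, ENNReal.tsum_eq_zero]
        exact fun y ↦ indicator_of_notMem (fun hy ↦ hx ⟨y, hy.2, hy.1⟩) _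
    simp only [h1]
    rw [fiberSum, tsum_subtype, ← Summable.tsum_finsetSum (fun _ _ ↦ ENNReal.summable)]
    refine tsum_congr fun y ↦ ?_
    obtain ⟨i, hi⟩ := mem_iUnion.1 (hVc ▸ mem_univ y)
    rw [Finset.sum_eq_single i]
    · by_cases hy : y ∈ f ⁻¹' {x}
      · rw [indicator_of_mem hy, indicator_of_mem (show y ∈ f ⁻¹' {x} ∩ V i from ⟨hy, hi⟩)]
      · rw [indicator_of_notMem hy, indicator_of_notMem (fun h ↦ hy h.1)]
    · intro j _ hj
      exact indicator_of_notMem (fun hy ↦ (disjoint_left.1 (hVd hj) hy.2) hi) _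
    · simp
  have hmeas : Measurable (fiberSum f w) := by
    rw [funext hsum]
    exact Finset.measurable_sum _ fun i _ ↦ hu i
  have hJm : Measurable fun x ↦ ENNReal.ofReal (J x) :=
    h.jac_continuous.measurable.ennreal_ofReal
  refine ⟨hmeas, fun ψ hψ ↦ ?_⟩
  simp only [hsum, Finset.mul_sum]
  have hψu : ∀ i, Measurable fun x ↦ ψ x * u i x := fun i ↦ hψ.mul (hu i)
  rw [lintegral_finsetSum _ fun i _ ↦ hψu i]
  have h2 : ∀ i, ∫⁻ x, ψ x * u i x ∂μ =
      ∫⁻ y in V i, ENNReal.ofReal (J y) * (ψ (f y) * w y) ∂μ := by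
    intro i
    have hfV : MeasurableSet (f '' V i) :=
      (hV i).image_of_continuousOn_injOn h.continuous.continuousOn (hVi i)
    have h3 : ∫⁻ x, ψ x * u i x ∂μ = ∫⁻ x in f '' V i, ψ x * u i x ∂μ := by
      rw [← lintegral_indicator hfV]
      refine lintegral_congr fun x ↦ ?_
      by_cases hx : x ∈ f '' V i
      · rw [indicator_of_mem hx]
      · rw [indicator_of_notMem hx, hu2 i x hx, mul_zero]
    rw [h3, ← h.map_restrict (hV i) (him i),
      lintegral_map (hψu i) h.continuous.measurable, restrict_withDensity (hV i),
      lintegral_withDensity_eq_lintegral_mul _ hJm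
        (g := fun y ↦ ψ (f y) * u i (f y)) ((hψu i).comp h.continuous.measurable)]
    refine setLIntegral_congr_fun (hV i) fun y hy ↦ ?_
    simp only [Pi.mul_apply, hu1 i y hy]
  simp only [h2]
  rw [← setLIntegral_univ, ← hVc, lintegral_iUnion hV hVd, tsum_fintype]

end FiberSum


/-! ### Log-Lipschitz densities and their push-forward -/

section Densities

/-- A positive function whose logarithm has Lipschitz constant `C`. -/
def LogLip {M : Type*} [MetricSpace M] (C : ℝ) (h : M → ℝ) : Prop :=
  (∀ x, 0 < h x) ∧ ∀ x y, h x ≤ Real.exp (C * dist x y) * h y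

variable {M : Type*} [MetricSpace M] {C C' : ℝ} {h h₁ h₂ : M → ℝ}

lemma LogLip.continuous (hh : LogLip C h) : Continuous h := by
  have h1 : LipschitzWith C.toNNReal fun x ↦ Real.log (h x) := by
    refine LipschitzWith.of_le_add_mul _ fun x y ↦ ?_
    have h2 := Real.log_le_log (hh.1 x) (hh.2 x y)
    rw [Real.log_mul (Real.exp_pos _).ne' (hh.1 y).ne', Real.log_exp] at h2
    have h3 := mul_le_mul_of_nonneg_right (Real.le_coe_toNNReal C) (dist_nonneg (x := x) (y := y))
    linarith
  have h2 : h = fun x ↦ Real.exp (Real.log (h x)) := funext fun x ↦ (Real.exp_log (hh.1 x)).symm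
  rw [h2]
  exact h1.continuous.rexp

lemma LogLip.mono (hh : LogLip C h) (hC : C ≤ C') : LogLip C' h :=
  ⟨hh.1, fun x y ↦ (hh.2 x y).trans (mul_le_mul_of_nonneg_right
    (Real.exp_le_exp.2 (mul_le_mul_of_nonneg_right hC dist_nonneg)) (hh.1 y).le)⟩

lemma LogLip.add (h1 : LogLip C h₁) (h2 : LogLip C h₂) : LogLip C fun x ↦ h₁ x + h₂ x :=
  ⟨fun x ↦ add_pos (h1.1 x) (h2.1 x), fun x y ↦ by
    have := h1.2 x y
    have := h2.2 x y
    rw [mul_add]; linarith⟩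

lemma LogLip.const_mul (hh : LogLip C h) {c : ℝ} (hc : 0 < c) : LogLip C fun x ↦ c * h x :=
  ⟨fun x ↦ mul_pos hc (hh.1 x), fun x y ↦ by
    have := mul_le_mul_of_nonneg_left (hh.2 x y) hc.le
    linarith⟩

lemma LogLip.const (hC : 0 ≤ C) {c : ℝ} (hc : 0 < c) : LogLip (M := M) C fun _ ↦ c :=
  ⟨fun _ ↦ hc, fun x y ↦ le_mul_of_one_le_left hc.le
    (Real.one_le_exp (mul_nonneg hC dist_nonneg))⟩

/-- A small constant may be subtracted from a density with log-Lipschitz constant `C`, if the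
constant is increased slightly. -/
lemma LogLip.sub_const (hC : 0 ≤ C) (hh : LogLip C h) {m : ℕ} (hm : 0 < m) {c : ℝ} (hc : 0 < c)
    (hch : ∀ x, c * (m + 1) ≤ h x) : LogLip ((1 + 1 / m) * C) fun x ↦ h x - c := by
  have hm' : (0 : ℝ) < m := by exact_mod_cast hm
  refine ⟨fun x ↦ by nlinarith [hch x], fun x y ↦ ?_⟩
  -- The claim h x - c ≤ w^(m+1) (h y - c) reduces to c(w^(m+1) - 1) ≤ w^m (w - 1) h y. The left
  -- side is c(w - 1) times a geometric sum, which is at most (m + 1) w^m, and c(m + 1) ≤ h y.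
  set w := Real.exp (C * dist x y / m) with hw
  have hw1 : 1 ≤ w := Real.one_le_exp (by positivity)
  have hwm : w ^ m = Real.exp (C * dist x y) := by
    rw [hw, ← Real.exp_nat_mul]; congr 1; field_simp
  have hwm1 : Real.exp ((1 + 1 / m) * C * dist x y) = w ^ m * w := by
    rw [hwm, hw, ← Real.exp_add]; congr 1; field_simp
  have h1 : h x ≤ w ^ m * h y := hwm ▸ hh.2 x y
  have h2 : ∑ i ∈ Finset.range (m + 1), w ^ i ≤ (m + 1) * w ^ m := by
    refine (Finset.sum_le_card_nsmul _ _ (w ^ m) fun i hi ↦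
      pow_le_pow_right₀ hw1 (by simp at hi; omega)).trans (by simp)
  have h3 := geom_sum_mul w (m + 1)
  have h4 : c * (w ^ (m + 1) - 1) ≤ w ^ m * (w - 1) * h y := by
    rw [← h3]
    have h5 : c * ((∑ i ∈ Finset.range (m + 1), w ^ i) * (w - 1)) ≤
        c * ((m + 1) * w ^ m * (w - 1)) := by gcongr
    have h6 : w ^ m * (w - 1) * (c * (m + 1)) ≤ w ^ m * (w - 1) * h y := by
      have : 0 ≤ w - 1 := by linarith
      gcongr
      exact hch y
    linarith
  rw [hwm1]
  have : w ^ (m + 1) = w ^ m * w := pow_succ w m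
  rw [this] at h4
  linarith

variable [CompactSpace M] [MeasurableSpace M] [BorelSpace M] {μ : Measure M} [IsFiniteMeasure μ]
  {J : M → ℝ} {ϑ K : ℝ} {f : M → M}

lemma integrable_of_continuous {u : M → ℝ} (hu : Continuous u) : Integrable u μ :=
  hu.integrable_of_hasCompactSupport (HasCompactSupport.of_compactSpace u)

/-- The Perron–Frobenius operator of an expanding map preserves densities with Lipschitz
logarithms. -/
lemma IsExpandingMap.exists_push [NeZero μ] (hf : IsExpandingMap μ J ϑ f) (hM : HasChains M)
    (hϑ : 0 < ϑ) (hCK : 0 ≤ C + K)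
    (hJ : ∀ x y, |Real.log (J x) - Real.log (J y)| ≤ K * dist x y) (hh : LogLip C h) :
    ∃ h', LogLip ((C + K) / ϑ) h' ∧
      (μ.withDensity fun x ↦ ENNReal.ofReal (h x)).map f =
        μ.withDensity fun x ↦ ENNReal.ofReal (h' x) := by
  set w : M → ℝ≥0∞ := fun y ↦ ENNReal.ofReal (h y / J y) with hw
  have hwle : ∀ y y', w y ≤ ENNReal.ofReal (Real.exp ((C + K) * dist y y')) * w y' := by
    intro y y'
    rw [hw, ← ENNReal.ofReal_mul (Real.exp_pos _).le]
    refine ENNReal.ofReal_le_ofReal ?_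
    have h1 : J y' ≤ Real.exp (K * dist y y') * J y := by
      rw [← Real.log_le_log_iff (hf.jac_pos _) (mul_pos (Real.exp_pos _) (hf.jac_pos _)),
        Real.log_mul (Real.exp_pos _).ne' (hf.jac_pos _).ne', Real.log_exp]
      have := (abs_le.1 (hJ y y')).1
      linarith
    rw [add_mul, Real.exp_add, div_le_iff₀ (hf.jac_pos _)]
    calc h y ≤ Real.exp (C * dist y y') * h y' := hh.2 _ _
      _ = Real.exp (C * dist y y') * (h y' / J y') * J y' := by
        have := (hf.jac_pos y').ne'
        field_simp
      _ ≤ Real.exp (C * dist y y') * (h y' / J y') * (Real.exp (K * dist y y') * J y) := by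
        have := div_pos (hh.1 y') (hf.jac_pos y')
        gcongr
      _ = _ := by ring
  have hwm : Measurable w :=
    (hh.continuous.div hf.jac_continuous fun x ↦ (hf.jac_pos x).ne').measurable.ennreal_ofReal
  obtain ⟨hmeas, hint⟩ := hf.lintegral_fiberSum hwm
  obtain ⟨r, hr, hlift⟩ := hf.exists_uniform_lift
  obtain ⟨s, hs, hsep⟩ := hf.exists_separation
  -- Each preimage of x is matched with a preimage of x' at distance at most dist x x' / ϑ, whence
  -- the constant (C + K)/ϑ. Two preimages with the same partner would be less than s apart, so the
  -- matching is injective, which suffices for an inequality of sums.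
  have hloc : ∀ x x', dist x x' < min r (ϑ * s / 2) →
      fiberSum f w x ≤ ENNReal.ofReal (Real.exp ((C + K) / ϑ * dist x x')) * fiberSum f w x' := by
    intro x x' hd
    have hl : ∀ y : f ⁻¹' {x}, ∃ y', f y' = x' ∧ ϑ * dist (y : M) y' ≤ dist x x' := by
      rintro ⟨y, rfl⟩
      exact hlift y x' (hd.trans_le (min_le_left _ _))
    choose e he1 he2 using hl
    have hinj : Function.Injective fun y : f ⁻¹' {x} ↦ (⟨e y, he1 y⟩ : f ⁻¹' {x'}) := by
      intro y z hyz
      have hyz' : e y = e z := congrArg Subtype.val hyz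
      refine Subtype.ext (hsep _ _ (y.2.trans z.2.symm) ?_)
      have h1 := dist_triangle_right (y : M) z (e y)
      have h2 := he2 y
      have h3 := he2 z
      rw [← hyz'] at h3
      have h4 := hd.trans_le (min_le_right _ _)
      have h5 : ϑ * dist (y : M) z < ϑ * s := by
        have := mul_le_mul_of_nonneg_left h1 hϑ.le
        linarith
      exact lt_of_mul_lt_mul_left h5 hϑ.le
    rw [fiberSum, fiberSum]
    refine le_trans ?_ (mul_le_mul_right (ENNReal.tsum_comp_le_tsum_of_injective hinj
      fun y : f ⁻¹' {x'} ↦ w y) _)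
    rw [← ENNReal.tsum_mul_left]
    refine ENNReal.tsum_le_tsum fun y ↦ (hwle y (e y)).trans ?_
    refine mul_le_mul_left (ENNReal.ofReal_le_ofReal (Real.exp_le_exp.2 ?_)) _
    rw [div_mul_eq_mul_div, mul_div_assoc]
    refine mul_le_mul_of_nonneg_left ?_ hCK
    rw [le_div_iff₀ hϑ, mul_comm]
    exact he2 y
  have hglob := hM.le_exp_mul (div_nonneg hCK hϑ.le) (lt_min hr (by positivity)) hloc
  have hkey : ∀ ψ : M → ℝ≥0∞, Measurable ψ →
      ∫⁻ x, ψ x * fiberSum f w x ∂μ = ∫⁻ y, ψ (f y) * ENNReal.ofReal (h y) ∂μ := by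
    intro ψ hψ
    rw [hint ψ hψ]
    refine lintegral_congr fun y ↦ ?_
    rw [mul_left_comm, hw, ← ENNReal.ofReal_mul (hf.jac_pos y).le,
      mul_div_cancel₀ _ (hf.jac_pos y).ne']
  have hone := hkey (fun _ ↦ 1) measurable_const
  simp only [one_mul] at hone
  have hfin : ∫⁻ y, ENNReal.ofReal (h y) ∂μ ≠ ⊤ :=
    (integrable_of_continuous hh.continuous).lintegral_lt_top.ne
  -- Integrability gives finiteness at one point, and the comparison `hglob` spreads it to all
  -- points. Positivity spreads in the same way.
  have hltop : ∀ x, fiberSum f w x < ⊤ := by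
    have hae := ae_lt_top hmeas (hone ▸ hfin)
    obtain ⟨y, hy⟩ := hae.exists
    exact fun x ↦ (hglob x y).trans_lt (ENNReal.mul_lt_top ENNReal.ofReal_lt_top hy)
  have hpos : ∀ x, fiberSum f w x ≠ 0 := by
    intro x hx
    have h1 : ∀ y, fiberSum f w y = 0 := fun y ↦ by
      have := hglob y x
      rw [hx, mul_zero] at this
      exact le_antisymm this zero_le
    have h2 : ∫⁻ y, ENNReal.ofReal (h y) ∂μ = 0 := by
      rw [← hone]; simp [h1]
    rw [lintegral_eq_zero_iff hh.continuous.measurable.ennreal_ofReal] at h2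
    obtain ⟨y, hy⟩ := h2.exists
    exact (ENNReal.ofReal_pos.2 (hh.1 y)).ne' hy
  refine ⟨fun x ↦ (fiberSum f w x).toReal, ⟨fun x ↦ ENNReal.toReal_pos (hpos x) (hltop x).ne,
    fun x y ↦ ?_⟩, ?_⟩
  · have := ENNReal.toReal_mono (ENNReal.mul_lt_top ENNReal.ofReal_lt_top (hltop y)).ne (hglob x y)
    rwa [ENNReal.toReal_mul, ENNReal.toReal_ofReal (Real.exp_pos _).le] at this
  · simp only [ENNReal.ofReal_toReal (hltop _).ne]
    ext B hB
    have hfB := hf.continuous.measurable hB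
    rw [Measure.map_apply hf.continuous.measurable hB, withDensity_apply _ hfB,
      withDensity_apply _ hB]
    have := hkey (B.indicator fun _ ↦ 1) (measurable_const.indicator hB)
    rw [← lintegral_indicator hB, ← lintegral_indicator hfB]
    convert this.symm using 3 with y x
    · by_cases hy : f y ∈ B
      · rw [indicator_of_mem (show y ∈ f ⁻¹' B from hy), indicator_of_mem hy, one_mul]
      · rw [indicator_of_notMem (show y ∉ f ⁻¹' B from hy), indicator_of_notMem hy, zero_mul]
    · by_cases hy : x ∈ B
      · rw [indicator_of_mem hy, indicator_of_mem hy, one_mul]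
      · rw [indicator_of_notMem hy, indicator_of_notMem hy, zero_mul]

omit [CompactSpace M] [IsFiniteMeasure μ] in
lemma integral_withDensity_ofReal (hh : LogLip C h) (ψ : M → ℝ) :
    ∫ x, ψ x ∂(μ.withDensity fun x ↦ ENNReal.ofReal (h x)) = ∫ x, ψ x * h x ∂μ := by
  rw [integral_withDensity_eq_integral_toReal_smul hh.continuous.measurable.ennreal_ofReal
    (by simp)]
  refine integral_congr_ae (Eventually.of_forall fun x ↦ ?_)
  simp [ENNReal.toReal_ofReal (hh.1 x).le, mul_comm]

omit [CompactSpace M] [IsFiniteMeasure μ] in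
lemma integral_comp_mul_of_map_eq (hf : Measurable f) (h1 : LogLip C h₁) (h2 : LogLip C' h₂)
    (h : (μ.withDensity fun x ↦ ENNReal.ofReal (h₁ x)).map f =
        μ.withDensity fun x ↦ ENNReal.ofReal (h₂ x)) {ψ : M → ℝ} (hψ : Measurable ψ) :
    ∫ x, ψ (f x) * h₁ x ∂μ = ∫ x, ψ x * h₂ x ∂μ := by
  rw [← integral_withDensity_ofReal h1 fun x ↦ ψ (f x), ← integral_withDensity_ofReal h2, ← h,
    integral_map hf.aemeasurable hψ.aestronglyMeasurable]

end Densities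


/-! ### Exponential loss of memory -/

section MemoryLoss

variable {M : Type*} [MetricSpace M] [CompactSpace M] [MeasurableSpace M] [BorelSpace M]
  {μ : Measure M} [IsFiniteMeasure μ] {J : M → ℝ} {ϑ K C θ Δ m : ℝ} {h u : M → ℝ}

/-- The Perron–Frobenius operator of `f` preserves the densities with log-Lipschitz constant `C`,
also after a fixed proportion `θ` of the mass is removed as a constant. -/
structure IsContracting (μ : Measure M) (C θ : ℝ) (f : M → M) : Prop where
  continuous : Continuous f
  push : ∀ h, LogLip C h → ∃ h', LogLip C h' ∧ ∀ ψ : M → ℝ, Measurable ψ →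
    ∫ x, ψ (f x) * h x ∂μ = ∫ x, ψ x * h' x ∂μ
  contract : ∀ h, LogLip C h → ∃ h', LogLip C h' ∧ ∀ ψ : M → ℝ, Measurable ψ →
    ∫ x, ψ (f x) * (h x - θ * (∫ y, h y ∂μ) / μ.real univ) ∂μ = ∫ x, ψ x * h' x ∂μ

lemma LogLip.mul_measureReal_le (hC : 0 ≤ C) (hΔ : ∀ x y : M, dist x y ≤ Δ) (hh : LogLip C h)
    (x : M) : h x * μ.real univ ≤ Real.exp (C * Δ) * ∫ y, h y ∂μ := by
  have h1 : ∫ _, h x ∂μ ≤ ∫ y, Real.exp (C * Δ) * h y ∂μ := by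
    refine integral_mono (integrable_const _) ((integrable_of_continuous hh.continuous).const_mul _)
      fun y ↦ (hh.2 x y).trans ?_
    exact mul_le_mul_of_nonneg_right (Real.exp_le_exp.2 (mul_le_mul_of_nonneg_left (hΔ x y) hC))
      (hh.1 y).le
  rwa [integral_const, integral_const_mul, smul_eq_mul, mul_comm] at h1

lemma LogLip.integral_le (hC : 0 ≤ C) (hΔ : ∀ x y : M, dist x y ≤ Δ) (hh : LogLip C h) (x : M) :
    ∫ y, h y ∂μ ≤ Real.exp (C * Δ) * (h x * μ.real univ) := by
  have h1 : ∫ y, h y ∂μ ≤ ∫ _, Real.exp (C * Δ) * h x ∂μ := by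
    refine integral_mono (integrable_of_continuous hh.continuous) (integrable_const _)
      fun y ↦ (hh.2 y x).trans ?_
    exact mul_le_mul_of_nonneg_right (Real.exp_le_exp.2 (mul_le_mul_of_nonneg_left (hΔ y x) hC))
      (hh.1 x).le
  rw [integral_const, smul_eq_mul] at h1
  linarith

variable [NeZero μ]

omit [MetricSpace M] [CompactSpace M] [BorelSpace M] in
lemma measureReal_univ_pos' : 0 < μ.real univ :=
  measureReal_univ_pos

lemma LogLip.integral_pos (hh : LogLip C h) : 0 < ∫ y, h y ∂μ := by
  refine (integral_pos_iff_support_of_nonneg (fun x ↦ (hh.1 x).le)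
    (integrable_of_continuous hh.continuous)).2 ?_
  have : Function.support h = univ := eq_univ_of_forall fun x ↦ (hh.1 x).ne'
  rw [this]
  exact Measure.measure_univ_pos.2 (NeZero.ne μ)

/-- Removing a constant costs a factor 1 + 1/(2p), and K ≤ C/(2p), so the new constant times 1 + 1/p
is at most (1 + 1/(2p))C + C/(2p) = (1 + 1/p)C. The removable proportion is limited by h ≥ e^(-CΔ) ·
mean, since `LogLip.sub_const` with m = 2p asks for θ · mean · (2p + 1) ≤ h. -/
lemma IsExpandingMap.isContracting {f : M → M} {p : ℕ} (hp : 0 < p)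
    (hf : IsExpandingMap μ J (1 + 1 / p) f) (hM : HasChains M) (hK : 0 ≤ K)
    (hJ : ∀ x y, |Real.log (J x) - Real.log (J y)| ≤ K * dist x y) (hC : 2 * p * K ≤ C)
    (hΔ : ∀ x y : M, dist x y ≤ Δ) (hθ : 0 < θ)
    (hθC : θ * (2 * p + 1) * Real.exp (C * Δ) ≤ 1) : IsContracting μ C θ f := by
  have hp' : (0 : ℝ) < p := by exact_mod_cast hp
  have hϑ : (0 : ℝ) < 1 + 1 / p := by positivity
  have hC0 : 0 ≤ C := le_trans (by positivity) hC
  have hV := measureReal_univ_pos' (μ := μ)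
  have hCK : ((1 + 1 / ((2 * p : ℕ) : ℝ)) * C + K) / (1 + 1 / p) ≤ C := by
    rw [div_le_iff₀ hϑ]
    have h1 : K ≤ C / (2 * p) := by rw [le_div_iff₀ (by positivity)]; linarith
    have h2 : C * (1 + 1 / p) = C + C / (2 * p) + C / (2 * p) := by field_simp; ring
    have h3 : (1 + 1 / ((2 * p : ℕ) : ℝ)) * C = C + C / (2 * p) := by push_cast; field_simp
    rw [h2, h3]; linarith
  have hgen : ∀ h, LogLip ((1 + 1 / ((2 * p : ℕ) : ℝ)) * C) h → ∃ h', LogLip C h' ∧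
      ∀ ψ : M → ℝ, Measurable ψ → ∫ x, ψ (f x) * h x ∂μ = ∫ x, ψ x * h' x ∂μ := by
    intro h hh
    obtain ⟨h', h1, h2⟩ := hf.exists_push hM hϑ (by positivity) hJ hh
    exact ⟨h', h1.mono hCK, fun ψ hψ ↦
      integral_comp_mul_of_map_eq hf.continuous.measurable hh h1 h2 hψ⟩
  refine ⟨hf.continuous, fun h hh ↦ hgen h (hh.mono ?_), fun h hh ↦ hgen _
    (hh.sub_const hC0 (by omega) ?_ fun x ↦ ?_)⟩
  · rw [add_mul, one_mul]
    have : 0 ≤ 1 / ((2 * p : ℕ) : ℝ) * C := by positivity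
    linarith
  · have := hh.integral_pos (μ := μ)
    positivity
  · rw [div_mul_eq_mul_div, div_le_iff₀ hV]
    have h1 := hh.integral_le (μ := μ) hC0 hΔ x
    have h2 : 0 < h x * μ.real univ := mul_pos (hh.1 x) hV
    calc θ * (∫ y, h y ∂μ) * (((2 * p : ℕ) : ℝ) + 1)
        ≤ θ * (Real.exp (C * Δ) * (h x * μ.real univ)) * (((2 * p : ℕ) : ℝ) + 1) := by gcongr
      _ = θ * (2 * p + 1) * Real.exp (C * Δ) * (h x * μ.real univ) := by push_cast; ring
      _ ≤ 1 * (h x * μ.real univ) := by gcongr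
      _ = _ := one_mul _

/-- The differences of two densities of mass `m` with log-Lipschitz constant `C`. -/
def IsDiff (μ : Measure M) (C m : ℝ) (u : M → ℝ) : Prop :=
  ∃ u₁ u₂, LogLip C u₁ ∧ LogLip C u₂ ∧ ∫ x, u₁ x ∂μ = m ∧ ∫ x, u₂ x ∂μ = m ∧
    ∀ x, u x = u₁ x - u₂ x

omit [NeZero μ] [CompactSpace M] [IsFiniteMeasure μ] in
lemma IsDiff.continuous (hu : IsDiff μ C m u) : Continuous u := by
  obtain ⟨u₁, u₂, h1, h2, -, -, h⟩ := hu
  rw [funext h]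
  exact h1.continuous.sub h2.continuous

omit [NeZero μ] in
lemma IsDiff.add {m' : ℝ} {u' : M → ℝ} (hu : IsDiff μ C m u) (hu' : IsDiff μ C m' u') :
    IsDiff μ C (m + m') fun x ↦ u x + u' x := by
  obtain ⟨u₁, u₂, h1, h2, h3, h4, h⟩ := hu
  obtain ⟨v₁, v₂, k1, k2, k3, k4, k⟩ := hu'
  refine ⟨fun x ↦ u₁ x + v₁ x, fun x ↦ u₂ x + v₂ x, h1.add k1, h2.add k2, ?_, ?_, fun x ↦ ?_⟩
  · rw [integral_add (integrable_of_continuous h1.continuous)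
      (integrable_of_continuous k1.continuous), h3, k3]
  · rw [integral_add (integrable_of_continuous h2.continuous)
      (integrable_of_continuous k2.continuous), h4, k4]
  · change u x + u' x = u₁ x + v₁ x - (u₂ x + v₂ x)
    rw [h, k]; ring

lemma IsDiff.abs_integral_le (hu : IsDiff μ C m u) {ψ : M → ℝ} {B : ℝ}
    (hψ : Continuous ψ) (hB : ∀ x, |ψ x| ≤ B) : |∫ x, ψ x * u x ∂μ| ≤ 2 * B * m := by
  obtain ⟨u₁, u₂, h1, h2, h3, h4, h⟩ := hu
  have i1 := integrable_of_continuous (μ := μ) h1.continuous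
  have i2 := integrable_of_continuous (μ := μ) h2.continuous
  calc |∫ x, ψ x * u x ∂μ| ≤ ∫ x, |ψ x * u x| ∂μ := abs_integral_le_integral_abs
    _ ≤ ∫ x, B * (u₁ x + u₂ x) ∂μ := by
      refine integral_mono (integrable_of_continuous ?_) ((i1.add i2).const_mul _) fun x ↦ ?_
      · rw [funext h]; exact (hψ.mul (h1.continuous.sub h2.continuous)).abs
      · simp only [abs_mul, h x]
        refine mul_le_mul (hB x) ?_ (abs_nonneg _) ((abs_nonneg _).trans (hB x))
        rw [abs_le]
        constructor <;> linarith [h1.1 x, h2.1 x]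
    _ = 2 * B * m := by rw [integral_const_mul, integral_add i1 i2, h3, h4]; ring

/-- Both densities have mass m, so the same constant is removed from each and cancels in the
difference; what is left of each has mass (1 - θ)m. -/
lemma IsContracting.push_isDiff {f : M → M} (hf : IsContracting μ C θ f) (hu : IsDiff μ C m u) :
    ∃ u', IsDiff μ C ((1 - θ) * m) u' ∧ ∀ ψ : M → ℝ, Continuous ψ →
      ∫ x, ψ (f x) * u x ∂μ = ∫ x, ψ x * u' x ∂μ := by
  obtain ⟨u₁, u₂, h1, h2, h3, h4, h⟩ := hu
  obtain ⟨v₁, k1, l1⟩ := hf.contract u₁ h1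
  obtain ⟨v₂, k2, l2⟩ := hf.contract u₂ h2
  have hV := measureReal_univ_pos' (μ := μ)
  have hmass : ∀ w v : M → ℝ, LogLip C w → ∫ x, w x ∂μ = m →
      (∀ ψ : M → ℝ, Measurable ψ →
        ∫ x, ψ (f x) * (w x - θ * (∫ y, w y ∂μ) / μ.real univ) ∂μ = ∫ x, ψ x * v x ∂μ) →
      ∫ x, v x ∂μ = (1 - θ) * m := by
    intro w v hw hwm hwv
    have := hwv (fun _ ↦ 1) measurable_const
    simp only [one_mul] at this
    rw [← this, integral_sub (integrable_of_continuous hw.continuous) (integrable_const _), hwm,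
      integral_const, smul_eq_mul]
    field_simp
  refine ⟨fun x ↦ v₁ x - v₂ x, ⟨v₁, v₂, k1, k2, hmass u₁ v₁ h1 h3 l1, hmass u₂ v₂ h2 h4 l2,
    fun _ ↦ rfl⟩, fun ψ hψ ↦ ?_⟩
  simp only [mul_sub]
  rw [integral_sub (integrable_of_continuous (hψ.fun_mul k1.continuous))
    (integrable_of_continuous (hψ.fun_mul k2.continuous)), ← l1 ψ hψ.measurable,
    ← l2 ψ hψ.measurable, ← integral_sub]
  · refine integral_congr_ae (Eventually.of_forall fun x ↦ ?_)
    simp only [h x, h3, h4]; ring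
  · exact integrable_of_continuous
      ((hψ.comp hf.continuous).mul (h1.continuous.sub continuous_const))
  · exact integrable_of_continuous
      ((hψ.comp hf.continuous).mul (h2.continuous.sub continuous_const))

variable {f : ℕ → M → M}

lemma exists_comp_isDiff (hf : ∀ i, IsContracting μ C θ (f i)) (hu : IsDiff μ C m u) (j n : ℕ) :
    ∃ u', IsDiff μ C ((1 - θ) ^ n * m) u' ∧ ∀ ψ : M → ℝ, Continuous ψ →
      ∫ x, ψ (comp f j n x) * u x ∂μ = ∫ x, ψ x * u' x ∂μ := by
  induction n with
  | zero => exact ⟨u, by simpa using hu, fun ψ _ ↦ rfl⟩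
  | succ n ih =>
    obtain ⟨v, h1, h2⟩ := ih
    obtain ⟨w, h3, h4⟩ := (hf (j + n)).push_isDiff h1
    refine ⟨w, by rwa [pow_succ', mul_assoc], fun ψ hψ ↦ ?_⟩
    rw [← h4 ψ hψ, ← h2 (fun x ↦ ψ (f (j + n) x)) (hψ.comp (hf _).continuous)]
    rfl

/-- Exponential loss of memory. -/
lemma abs_integral_comp_le (hf : ∀ i, IsContracting μ C θ (f i)) (hu : IsDiff μ C m u) (j n : ℕ)
    {ψ : M → ℝ} {B : ℝ} (hψ : Continuous ψ) (hB : ∀ x, |ψ x| ≤ B) :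
    |∫ x, ψ (comp f j n x) * u x ∂μ| ≤ 2 * B * ((1 - θ) ^ n * m) := by
  obtain ⟨u', h1, h2⟩ := exists_comp_isDiff hf hu j n
  rw [h2 ψ hψ]
  exact h1.abs_integral_le hψ hB

omit [NeZero μ] [CompactSpace M] [BorelSpace M] [MetricSpace M] in
-- Duality against indicators shows that the image measure has density h' and no singular part, so
-- its Radon–Nikodym derivative is h' almost everywhere.
lemma transferOp_ae_eq {g : M → M} (hg : Measurable g) {h' : M → ℝ} (hh : Integrable h μ)
    (hh' : Integrable h' μ)
    (H : ∀ ψ : M → ℝ, Measurable ψ → ∫ x, ψ (g x) * h x ∂μ = ∫ x, ψ x * h' x ∂μ) :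
    transferOp μ g h =ᵐ[μ] h' := by
  refine (SignedMeasure.eq_rnDeriv 0 h' hh' VectorMeasure.MutuallySingular.zero_left ?_).symm
  rw [zero_add]
  ext B hB
  rw [VectorMeasure.map_apply _ hg hB, withDensityᵥ_apply hh (hg hB), withDensityᵥ_apply hh' hB,
    ← integral_indicator hB, ← integral_indicator (hg hB)]
  have := H (B.indicator fun _ ↦ 1) (measurable_const.indicator hB)
  convert this using 3 with x x
  · by_cases hx : g x ∈ B
    · rw [indicator_of_mem (show x ∈ g ⁻¹' B from hx), indicator_of_mem hx, one_mul]
    · rw [indicator_of_notMem (show x ∉ g ⁻¹' B from hx), indicator_of_notMem hx, zero_mul]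
  · by_cases hx : x ∈ B
    · rw [indicator_of_mem hx, indicator_of_mem hx, one_mul]
    · rw [indicator_of_notMem hx, indicator_of_notMem hx, zero_mul]

omit [NeZero μ] [IsFiniteMeasure μ] [CompactSpace M] [BorelSpace M] [MetricSpace M] in
lemma transferOp_congr {h h' : M → ℝ} (H : h =ᵐ[μ] h') (g : M → M) :
    transferOp μ g h = transferOp μ g h' := by
  rw [transferOp, transferOp, WithDensityᵥEq.congr_ae H]

omit [NeZero μ] in
lemma exists_transferIter (hf : ∀ i, IsContracting μ C θ (f i)) (hh : LogLip C h) (j n : ℕ) :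
    ∃ h', LogLip C h' ∧ transferIter μ f j n h =ᵐ[μ] h' ∧ ∀ ψ : M → ℝ, Measurable ψ →
      ∫ x, ψ (comp f j n x) * h x ∂μ = ∫ x, ψ x * h' x ∂μ := by
  induction n with
  | zero => exact ⟨h, hh, EventuallyEq.rfl, fun ψ _ ↦ rfl⟩
  | succ n ih =>
    obtain ⟨v, h1, h2, h3⟩ := ih
    obtain ⟨w, h4, h5⟩ := (hf (j + n)).push v h1
    refine ⟨w, h4, ?_, fun ψ hψ ↦ ?_⟩
    · change transferOp μ (f (j + n)) (transferIter μ f j n h) =ᵐ[μ] w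
      rw [transferOp_congr h2]
      exact transferOp_ae_eq (hf _).continuous.measurable (integrable_of_continuous h1.continuous)
        (integrable_of_continuous h4.continuous) h5
    · rw [← h5 ψ hψ, ← h3 (fun x ↦ ψ (f (j + n) x)) (hψ.comp (hf _).continuous.measurable)]
      rfl

omit [NeZero μ] in
lemma gammaAvg_eq (hC : 0 ≤ C) (hf : ∀ i, IsContracting μ C θ (f i)) {g : ℕ → M → ℝ}
    (hg : ∀ k, Continuous (g k)) (S k : ℕ) :
    gammaAvg μ f g S k =
      (μ.real univ)⁻¹ * ∫ x, g k (comp f (k - S) (k - (k - S)) x) ∂μ := by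
  obtain ⟨h', -, h2, h3⟩ := exists_transferIter hf
    (LogLip.const (M := M) hC one_pos) (k - S) (k - (k - S))
  have h4 := h3 _ (hg k).measurable
  simp only [mul_one] at h4
  rw [gammaAvg, h4, integral_const, smul_eq_mul, mul_one]
  congr 1
  refine integral_congr_ae ?_
  filter_upwards [h2] with x hx
  rw [hx]

omit [MeasurableSpace M] [CompactSpace M] [BorelSpace M] in
lemma comp_congr {f f' : ℕ → M → M} {j j' n : ℕ} (h : ∀ k < n, f (j + k) = f' (j' + k)) :
    comp f j n = comp f' j' n := by
  induction n with
  | zero => rfl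
  | succ n ih =>
    simp only [comp]
    rw [ih fun k hk ↦ h k (by omega), h n (by omega)]

/-- The averages `γ_{S,i}` approximate the means along any orbit ending with the same maps. -/
lemma abs_gammaAvg_sub_le (hC : 0 ≤ C) (hf : ∀ i, IsContracting μ C θ (f i)) {f' : ℕ → M → M}
    (hf' : ∀ i, IsContracting μ C θ (f' i)) {g : ℕ → M → ℝ}
    (hg : ∀ k, Continuous (g k)) {B : ℝ} (hB : ∀ k x, |g k x| ≤ B) {ρ : M → ℝ} (hρ : LogLip C ρ)
    (hρ1 : ∫ x, ρ x ∂μ = 1) (S r i : ℕ) (hff' : ∀ k < i, f k = f' (r + k)) :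
    |gammaAvg μ f g S i - ∫ x, g i (comp f' 0 (r + i) x) * ρ x ∂μ| ≤
      2 * B * (1 - θ) ^ (i - (i - S)) := by
  -- With truncated subtraction n = min(i, S), the number of maps after the time at which memory is
  -- cut.
  set n := i - (i - S) with hn
  have hV := measureReal_univ_pos' (μ := μ)
  obtain ⟨h', h1, -, h3⟩ := exists_transferIter hf' hρ 0 (r + (i - S))
  have hcomp : ∀ x, comp f' 0 (r + i) x = comp f (i - S) n (comp f' 0 (r + (i - S)) x) := by
    intro x
    rw [show r + i = (r + (i - S)) + n by omega, comp_add, zero_add]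
    refine congrFun (comp_congr fun k hk ↦ ?_).symm _
    rw [hff' _ (by omega), add_assoc]
  have hcont : Continuous fun x ↦ g i (comp f (i - S) n x) :=
    (hg i).comp (continuous_comp (fun k ↦ (hf k).continuous) _ _)
  have h4 := h3 _ hcont.measurable
  simp only [hcomp]
  rw [h4, gammaAvg_eq hC hf hg, ← integral_const_mul, ← integral_sub]
  · have hmass : ∫ x, h' x ∂μ = 1 := by
      have := h3 (fun _ ↦ 1) measurable_const
      simpa [hρ1] using this.symm
    -- γ starts the last n maps from the normalized volume, the true mean from the density h' of the
    -- orbit; both are cone densities of mass 1.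
    have hd : IsDiff μ C 1 fun x ↦ (μ.real univ)⁻¹ - h' x :=
      ⟨fun _ ↦ (μ.real univ)⁻¹, h', LogLip.const hC (inv_pos.2 hV), h1, by
        rw [integral_const, smul_eq_mul, mul_inv_cancel₀ hV.ne'], hmass, fun _ ↦ rfl⟩
    have := abs_integral_comp_le hf hd (i - S) n (hg i) (hB i)
    rw [mul_one] at this
    refine (congrArg abs (integral_congr_ae (Eventually.of_forall fun x ↦ ?_))).trans_le this
    simp only [mul_sub]
    ring
  · exact (integrable_of_continuous hcont).const_mul _
  · exact integrable_of_continuous (hcont.mul h1.continuous)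

end MemoryLoss


/-! ### Elementary estimates with ln L -/

section Constants

lemma one_sub_inv_pow_ceil_le {q L : ℕ} (hq : 0 < q) (hL : 0 < L) :
    (1 - 1 / (q : ℝ)) ^ ⌈(q : ℝ) * Real.log L⌉₊ ≤ 1 / L := by
  have hq' : (1 : ℝ) ≤ q := by exact_mod_cast hq
  have hL' : (0 : ℝ) < L := by exact_mod_cast hL
  have h0 : (0 : ℝ) ≤ 1 - 1 / (q : ℝ) := by
    rw [sub_nonneg, div_le_one (by linarith)]; exact hq'
  have h1 : 1 - 1 / (q : ℝ) ≤ Real.exp (-(1 / (q : ℝ))) := Real.one_sub_le_exp_neg _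
  refine (pow_le_pow_left₀ h0 h1 _).trans ?_
  rw [← Real.exp_nat_mul, ← Real.le_log_iff_exp_le (by positivity), Real.log_div one_ne_zero hL'.ne',
    Real.log_one, zero_sub, mul_neg, neg_le_neg_iff, mul_one_div, le_div_iff₀ (by linarith),
    mul_comm]
  exact Nat.le_ceil _

/-- The exponent is min(i, S): the indices i ≤ S form part of a geometric series, and the others
contribute at most L terms of size 1/L. -/
lemma sum_pow_sub_sub_le {x : ℝ} (h0 : 0 ≤ x) (h1 : x < 1) {S L : ℕ} (hS : x ^ S ≤ 1 / L) :
    ∑ i ∈ Finset.Icc 1 L, x ^ (i - (i - S)) ≤ (1 - x)⁻¹ + 1 := by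
  have h2 : ∀ i ∈ Finset.Icc 1 L, x ^ (i - (i - S)) ≤ x ^ i + 1 / L := by
    intro i _
    rcases le_total i S with h | h
    · rw [Nat.sub_eq_zero_of_le h, Nat.sub_zero]
      have : (0 : ℝ) ≤ 1 / L := by positivity
      linarith
    · rw [Nat.sub_sub_self h]
      have := pow_nonneg h0 i
      linarith
  refine (Finset.sum_le_sum h2).trans ?_
  rw [Finset.sum_add_distrib, Finset.sum_const, Nat.card_Icc, Nat.add_sub_cancel, nsmul_eq_mul]
  refine add_le_add ?_ ?_
  · rw [← tsum_geometric_of_lt_one h0 h1]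
    exact (summable_geometric_of_lt_one h0 h1).sum_le_tsum _ fun i _ ↦ pow_nonneg h0 i
  · rw [mul_one_div]; exact div_self_le_one _

lemma mul_log_lt {κ L : ℕ} (hL : 0 < L) (h : 4 * κ ^ 2 ≤ L) : κ * Real.log L < L := by
  have hL' : (0 : ℝ) < L := by exact_mod_cast hL
  have hs := Real.sqrt_pos.2 hL'
  have h1 : Real.log L < 2 * √L := by
    have h2 := Real.log_le_sub_one_of_pos hs
    rw [Real.log_sqrt hL'.le] at h2
    linarith
  have h2 : 2 * (κ : ℝ) ≤ √L := by
    refine Real.le_sqrt_of_sq_le ?_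
    have : (4 * κ ^ 2 : ℝ) ≤ L := by exact_mod_cast h
    linarith
  rcases Nat.eq_zero_or_pos κ with rfl | hκ
  · simpa using hL'
  · have hκ' : (0 : ℝ) < κ := by exact_mod_cast hκ
    calc κ * Real.log L < κ * (2 * √L) := by gcongr
      _ = 2 * κ * √L := by ring
      _ ≤ √L * √L := by gcongr
      _ = L := Real.mul_self_sqrt hL'.le

lemma one_le_log {L : ℕ} (hL : 3 ≤ L) : 1 ≤ Real.log L := by
  have hL' : (3 : ℝ) ≤ L := by exact_mod_cast hL
  rw [Real.le_log_iff_exp_le (by linarith)]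
  linarith [Real.exp_one_lt_d9]

/-- By Bernoulli (1 + 1/p)^p ≥ 2, and 3 ln 2 ≥ 2. This is the source of the gap p⌈3 ln L⌉. -/
lemma sq_le_one_add_inv_pow {p L : ℕ} (hp : 0 < p) (hL : 3 ≤ L) :
    (L : ℝ) ^ 2 ≤ (1 + 1 / (p : ℝ)) ^ (p * ⌈3 * Real.log L⌉₊) := by
  have hp' : (0 : ℝ) < p := by exact_mod_cast hp
  have hL' : (3 : ℝ) ≤ L := by exact_mod_cast hL
  have h1 : (2 : ℝ) ≤ (1 + 1 / (p : ℝ)) ^ p := by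
    have := one_add_mul_le_pow (a := 1 / (p : ℝ)) (by have := one_div_pos.2 hp'; linarith) p
    rwa [mul_one_div_cancel hp'.ne', one_add_one_eq_two] at this
  rw [pow_mul]
  refine le_trans ?_ (pow_le_pow_left₀ zero_le_two h1 _)
  rw [← Real.log_le_log_iff (by positivity) (by positivity), Real.log_pow, Real.log_pow]
  have h2 := Nat.le_ceil (3 * Real.log L)
  have h3 := Real.log_two_gt_d9
  have h4 := one_le_log hL
  push_cast
  nlinarith

end Constants

/-! ### From the checkable condition to the variance hypotheses -/

section Condition

variable {d : ℕ} {M : Type*} [MetricSpace M] [CompactSpace M] [MeasurableSpace M] [BorelSpace M]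
  [ChartedSpace (EuclideanSpace ℝ (Fin d)) M]
  [RiemannianBundle (fun x : M ↦ TangentSpace (𝓡 d) x)]
  [IsFiniteMeasure (riemannianVolume d M)] [NeZero (riemannianVolume d M)]
  {N N' : ℕ} {F : Fin N → M → M} {G : Fin N' → M → ℝ} {ρ : M → ℝ}

lemma abs_centered_le {M : Type*} [TopologicalSpace M] [MeasurableSpace M] {μ : Measure M}
    {ρ : M → ℝ} {f : ℕ → M → M} {g : ℕ → M → ℝ} {Γ : ℝ} (hρ : ∀ x, 0 ≤ ρ x)
    (hρi : Integrable ρ μ) (hρ1 : ∫ x, ρ x ∂μ = 1) (hg : ∀ k x, |g k x| ≤ Γ) (k : ℕ) (x : M) :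
    |centered μ ρ f g k x| ≤ 2 * Γ := by
  have h1 : |∫ y, g k (comp f 0 k y) * ρ y ∂μ| ≤ Γ := by
    calc |∫ y, g k (comp f 0 k y) * ρ y ∂μ| ≤ ∫ y, Γ * ρ y ∂μ := by
          rw [← Real.norm_eq_abs]
          refine norm_integral_le_of_norm_le (hρi.const_mul Γ) (Eventually.of_forall fun y ↦ ?_)
          rw [norm_mul, Real.norm_eq_abs, Real.norm_eq_abs, abs_of_nonneg (hρ y)]
          exact mul_le_mul_of_nonneg_right (hg _ _) (hρ y)
      _ = Γ := by rw [integral_const_mul, hρ1, mul_one]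
  have h2 := abs_sub (g k x) (∫ y, g k (comp f 0 k y) * ρ y ∂μ)
  have h3 := hg k x
  rw [centered]
  linarith

/-- The averages in the checkable condition may be replaced by the means along any sequence. -/
lemma CheckableCondition.exists_le_sum_centered {C κ b Γ : ℝ} {q L : ℕ} (hC : 0 ≤ C) (hq : 1 < q)
    (hL : 0 < L) (hF : ∀ i, IsContracting (riemannianVolume d M) C (1 / q) (F i))
    (hG : ∀ j, Continuous (G j)) (hΓ : ∀ j x, |G j x| ≤ Γ) (hρ : LogLip C ρ)
    (hρ1 : ∫ x, ρ x ∂(riemannianVolume d M) = 1) (hb : b = q)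
    (h : CheckableCondition d F G κ b L) (α : ℕ → Fin N) (η : ℕ → Fin N') (r : ℕ) :
    ∃ x : M, 2 * κ * Real.log L - 2 * Γ * (q + 1) ≤ ∑ i ∈ Finset.Icc 1 L,
        centered (riemannianVolume d M) ρ (fun i ↦ F (α i)) (fun i ↦ G (η i)) (r + i)
          (comp (fun i ↦ F (α i)) r i x) := by
  subst hb
  have hq' : (1 : ℝ) < q := by exact_mod_cast hq
  -- The condition is applied to the word read at the times r, …, r + L. The reduction of indices
  -- modulo L + 1 has no effect on those that enter.
  obtain ⟨x, hx⟩ := h fun j ↦ (α (r + j), η (r + j))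
  refine ⟨x, ?_⟩
  set f : ℕ → M → M := fun i ↦ F (α (r + (Fin.ofNat (L + 1) i : Fin (L + 1)))) with hf
  set g : ℕ → M → ℝ := fun i ↦ G (η (r + (Fin.ofNat (L + 1) i : Fin (L + 1)))) with hg
  set S := ⌈(q : ℝ) * Real.log L⌉₊ with hS
  have hval : ∀ i ≤ L, ((Fin.ofNat (L + 1) i : Fin (L + 1)) : ℕ) = i := fun i hi ↦
    Nat.mod_eq_of_lt (by omega)
  have hfi : ∀ i ≤ L, f i = F (α (r + i)) := fun i hi ↦ by rw [hf]; simp only [hval i hi]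
  have hgi : ∀ i ≤ L, g i = G (η (r + i)) := fun i hi ↦ by rw [hg]; simp only [hval i hi]
  have hθ0 : (0 : ℝ) ≤ 1 - 1 / q := by
    rw [sub_nonneg, div_le_one (by linarith)]; exact hq'.le
  have hθ1 : 1 - 1 / (q : ℝ) < 1 := by
    have : (0 : ℝ) < 1 / q := by positivity
    linarith
  have hΓ0 : 0 ≤ Γ := (abs_nonneg _).trans (hΓ (η 0) x)
  have hterm : ∀ i ∈ Finset.Icc 1 L, g i (comp f 0 i x) -
      gammaAvg (riemannianVolume d M) f g S i ≤
      centered (riemannianVolume d M) ρ (fun i ↦ F (α i)) (fun i ↦ G (η i)) (r + i)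
          (comp (fun i ↦ F (α i)) r i x) + 2 * Γ * (1 - 1 / q) ^ (i - (i - S)) := by
    intro i hi
    have hiL := (Finset.mem_Icc.1 hi).2
    have hc : comp f 0 i = comp (fun i ↦ F (α i)) r i :=
      comp_congr fun k hk ↦ by rw [zero_add, hfi k (by omega)]
    have h1 := abs_gammaAvg_sub_le hC (f := f) (fun _ ↦ hF _) (f' := fun i ↦ F (α i)) (fun _ ↦ hF _)
      (g := g) (fun _ ↦ hG _) (fun _ ↦ hΓ _) hρ hρ1 S r i fun k hk ↦ hfi k (by omega)
    rw [hgi i hiL] at h1 ⊢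
    rw [hc, centered]
    linarith [(abs_le.1 h1).1]
  have h2 := hx.trans (Finset.sum_le_sum hterm)
  rw [Finset.sum_add_distrib, ← Finset.mul_sum] at h2
  have h3 := sum_pow_sub_sub_le hθ0 hθ1 (one_sub_inv_pow_ceil_le (by omega : 0 < q) hL)
  -- For x = 1 - 1/q the bound (1 - x)⁻¹ + 1 is q + 1.
  rw [sub_sub_cancel, one_div, inv_inv, ← one_div] at h3
  have h4 := mul_le_mul_of_nonneg_left h3 (by positivity : 0 ≤ 2 * Γ)
  linarith

/-- The checkable condition implies the hypotheses of the variance growth proposition. -/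
lemma CheckableCondition.varianceHypotheses {C : ℝ} {Δ p Γ q κ L : ℕ} (hC : 0 ≤ C) (hq : 1 < q)
    (hp : 0 < p) (hκ : 64 * Γ * p + 2 * Γ * (q + 1) + 1 ≤ κ)
    (hL : 4 * κ ^ 2 + 4 * Δ * (Γ + 1) + 3 ≤ L)
    (hΔ : ∀ x y : M, dist x y ≤ Δ) (hlift : ∀ i, HasLift (1 + 1 / (p : ℝ)) (F i))
    (hF : ∀ i, IsContracting (riemannianVolume d M) C (1 / q) (F i))
    (hG : ∀ j, Continuous (G j)) (hΓ : ∀ j, (∀ x, |G j x| ≤ Γ) ∧ GradBound d (G j) Γ)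
    (hρ : LogLip C ρ) (hρ1 : ∫ x, ρ x ∂(riemannianVolume d M) = 1)
    (h : CheckableCondition d F G κ q L) : VarianceHypotheses d F G ρ L := by
  have hκ' : (64 * Γ * p + 2 * Γ * (q + 1) + 1 : ℝ) ≤ κ := by exact_mod_cast hκ
  have hL' : (4 * κ ^ 2 + 4 * Δ * (Γ + 1) + 3 : ℝ) ≤ L := by exact_mod_cast hL
  have hL3 : 3 ≤ L := by omega
  have hp' : (0 : ℝ) < p := by exact_mod_cast hp
  have hL0 : (0 : ℝ) < L := by exact_mod_cast (by omega : 0 < L)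
  have hlog := one_le_log hL3
  have hκ0 : (1 : ℝ) ≤ κ := le_trans (by have : (0 : ℝ) ≤ 64 * Γ * p + 2 * Γ * (q + 1) := by positivity
                                         linarith) hκ'
  have hκL : κ * Real.log L < L := mul_log_lt (by omega) (by nlinarith)
  set j := ⌈3 * Real.log L⌉₊ with hj
  have hj4 : (j : ℝ) ≤ 4 * Real.log L := by
    have := Nat.ceil_lt_add_one (a := 3 * Real.log L) (by linarith)
    linarith
  -- Chosen so that aL = κ ln L; then a < 1 because L ≥ 4κ². Below, ε is such that a/(4ε) = Γ + 1,
  -- the added 1 keeping ε meaningful for Γ = 0.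
  set a := κ * Real.log L / L with ha
  have haL : a * L = κ * Real.log L := by rw [ha]; field_simp
  have ha0 : 0 < a := by positivity
  have hε : 0 < a / (4 * (Γ + 1)) := by positivity
  refine ⟨a, a / (4 * (Γ + 1)), p * j, ha0, (div_lt_one hL0).2 hκL, hε, ?_, ?_, ?_, ?_⟩
  · refine isSpecificationGap (ϑ := 1 + 1 / (p : ℝ)) (Δ := Δ) ?_ hlift (fun i ↦ (hF i).continuous)
      hΔ ?_
    · have : (0 : ℝ) ≤ 1 / p := by positivity
      linarith
    -- It suffices that Δ ≤ L²ε. Indeed L²a = L κ ln L ≥ L, and L ≥ 4Δ(Γ + 1).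
    · refine le_trans ?_ (mul_le_mul_of_nonneg_right (sq_le_one_add_inv_pow hp hL3) hε.le)
      rw [mul_div_assoc', le_div_iff₀ (by positivity), sq, mul_assoc (L : ℝ), mul_comm (L : ℝ) a,
        haL]
      have h1 : (1 : ℝ) ≤ κ * Real.log L := by nlinarith
      have h2 : (Δ : ℝ) * (4 * (Γ + 1)) ≤ L := by nlinarith [sq_nonneg (κ : ℝ)]
      nlinarith
  · intro i x v
    refine ((hΓ i).2 x v).trans (mul_le_mul_of_nonneg_right ?_ (norm_nonneg _))
    have : a / (4 * (a / (4 * ((Γ : ℝ) + 1)))) = Γ + 1 := by field_simp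
    rw [this]
    linarith
  · intro α η k x
    have h1 := abs_centered_le (μ := riemannianVolume d M) (f := fun i ↦ F (α i))
      (g := fun i ↦ G (η i)) (fun x ↦ (hρ.1 x).le) (integrable_of_continuous hρ.continuous) hρ1
      (fun i ↦ (hΓ (η i)).1) k x
    rw [haL]
    -- The centered observables are at most 2Γ and the gap is pj with j ≤ 4 ln L; this accounts for
    -- the summand 64Γp of κ.
    calc 8 * ((p * j : ℕ) : ℝ) * _ ≤ 8 * ((p * j : ℕ) : ℝ) * (2 * Γ) := by gcongr
      _ = 16 * Γ * p * j := by push_cast; ring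
      _ ≤ 16 * Γ * p * (4 * Real.log L) := by gcongr
      _ = 64 * Γ * p * Real.log L := by ring
      _ ≤ κ * Real.log L := by
        gcongr
        have : (0 : ℝ) ≤ 2 * Γ * (q + 1) := by positivity
        linarith
  · intro α η r
    obtain ⟨x, hx⟩ := h.exists_le_sum_centered hC hq (by omega) hF hG (fun j ↦ (hΓ j).1) hρ hρ1 rfl
      α η r
    refine ⟨x, le_trans ?_ hx⟩
    rw [haL]
    -- The error of the averages is at most κ ≤ κ ln L, so half of 2κ ln L survives.
    have h1 : (2 * Γ * (q + 1) : ℝ) ≤ κ := by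
      have : (0 : ℝ) ≤ 64 * Γ * p := by positivity
      linarith
    nlinarith

end Condition


/-! ### Correctors, martingale differences and uniform bounds -/

section Martingale

variable {M : Type*} [MetricSpace M] [CompactSpace M] [MeasurableSpace M] [BorelSpace M]
  {μ : Measure M} [IsFiniteMeasure μ] {C C' θ Δ A m : ℝ} {f : ℕ → M → M}

lemma exists_densities {ρ : M → ℝ} (hf : ∀ i, IsContracting μ C θ (f i)) (hρ : LogLip C ρ) :
    ∃ h : ℕ → M → ℝ, h 0 = ρ ∧ (∀ k, LogLip C (h k)) ∧ ∀ k, ∀ ψ : M → ℝ, Measurable ψ →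
      ∫ x, ψ (f k x) * h k x ∂μ = ∫ x, ψ x * h (k + 1) x ∂μ := by
  have h1 : ∀ k (h : M → ℝ), ∃ h', LogLip C h → LogLip C h' ∧ ∀ ψ : M → ℝ, Measurable ψ →
      ∫ x, ψ (f k x) * h x ∂μ = ∫ x, ψ x * h' x ∂μ := by
    intro k h
    by_cases hh : LogLip C h
    · obtain ⟨h', h2⟩ := (hf k).push h hh
      exact ⟨h', fun _ ↦ h2⟩
    · exact ⟨h, fun h3 ↦ absurd h3 hh⟩
  choose P hP using h1
  have h2 : ∀ k, LogLip C (Nat.rec (motive := fun _ ↦ M → ℝ) ρ (fun k h ↦ P k h) k) := by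
    intro k
    induction k with
    | zero => exact hρ
    | succ k ih => exact (hP k _ ih).1
  exact ⟨fun k ↦ Nat.rec (motive := fun _ ↦ M → ℝ) ρ (fun k h ↦ P k h) k, rfl, h2,
    fun k ↦ (hP k _ (h2 k)).2⟩

omit [CompactSpace M] [BorelSpace M] [IsFiniteMeasure μ] in
lemma integral_comp_densities {h : ℕ → M → ℝ} (hf : ∀ i, Measurable (f i))
    (hh : ∀ k, ∀ ψ : M → ℝ, Measurable ψ →
      ∫ x, ψ (f k x) * h k x ∂μ = ∫ x, ψ x * h (k + 1) x ∂μ) (k : ℕ) {ψ : M → ℝ}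
    (hψ : Measurable ψ) : ∫ x, ψ (comp f 0 k x) * h 0 x ∂μ = ∫ x, ψ x * h k x ∂μ := by
  induction k generalizing ψ with
  | zero => rfl
  | succ k ih =>
    rw [← hh k ψ hψ, ← ih (ψ := fun x ↦ ψ (f k x)) (hψ.comp (hf k))]
    simp only [comp, zero_add, Function.comp_apply]

variable [NeZero μ]

/-- The recursion is v_{k+1} = ℒ_k(w_k + v_k). Its size stays bounded because m = A(1 - θ)/θ solves
(1 - θ)(A + m) = m. -/
lemma exists_corrector (hC : 0 ≤ C) (hA : 0 < A) (hθ : 0 < θ) (hθ1 : θ < 1)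
    (hf : ∀ i, IsContracting μ C θ (f i)) {w : ℕ → M → ℝ} (hw : ∀ k, IsDiff μ C A (w k)) :
    ∃ v : ℕ → M → ℝ, (∀ x, v 0 x = 0) ∧ (∀ k, IsDiff μ C (A * (1 - θ) / θ) (v k)) ∧
      ∀ k, ∀ ψ : M → ℝ, Continuous ψ →
        ∫ x, ψ (f k x) * (w k x + v k x) ∂μ = ∫ x, ψ x * v (k + 1) x ∂μ := by
  have hV := measureReal_univ_pos' (μ := μ)
  have hmass : (1 - θ) * (A + A * (1 - θ) / θ) = A * (1 - θ) / θ := by field_simp; ring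
  have hpos : 0 < A * (1 - θ) / θ := by
    have : 0 < 1 - θ := by linarith
    positivity
  have h1 : ∀ k (v : M → ℝ), ∃ v', IsDiff μ C (A * (1 - θ) / θ) v →
      IsDiff μ C (A * (1 - θ) / θ) v' ∧ ∀ ψ : M → ℝ, Continuous ψ →
        ∫ x, ψ (f k x) * (w k x + v x) ∂μ = ∫ x, ψ x * v' x ∂μ := by
    intro k v
    by_cases hv : IsDiff μ C (A * (1 - θ) / θ) v
    · obtain ⟨v', h2, h3⟩ := (hf k).push_isDiff ((hw k).add hv)
      rw [hmass] at h2
      exact ⟨v', fun _ ↦ ⟨h2, h3⟩⟩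
    · exact ⟨v, fun h3 ↦ absurd h3 hv⟩
  choose P hP using h1
  set V : ℕ → M → ℝ := fun k ↦
    Nat.rec (motive := fun _ ↦ M → ℝ) (fun _ ↦ 0) (fun k h ↦ P k h) k with hVdef
  have h2 : ∀ k, IsDiff μ C (A * (1 - θ) / θ) (V k) := by
    intro k
    induction k with
    | zero =>
      have h3 : LogLip (M := M) C fun _ ↦ A * (1 - θ) / θ / μ.real univ :=
        LogLip.const hC (by positivity)
      have h4 : ∫ _, A * (1 - θ) / θ / μ.real univ ∂μ = A * (1 - θ) / θ := by
        rw [integral_const, smul_eq_mul]; field_simp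
      exact ⟨_, _, h3, h3, h4, h4, fun x ↦ (sub_self _).symm⟩
    | succ k ih => exact (hP k _ ih).1
  exact ⟨V, fun _ ↦ rfl, h2, fun k ↦ (hP k _ (h2 k)).2⟩

omit [NeZero μ] in
/-- The variance of a Birkhoff sum with a martingale decomposition is at least the sum of the
variances of the martingale differences. -/
lemma sum_integral_sq_le {g h χ : ℕ → M → ℝ} (hf : ∀ k, Continuous (f k))
    (hg : ∀ k, Continuous (g k)) (hh : ∀ k, LogLip C (h k)) (hχ : ∀ k, Continuous (χ k))
    (hpush : ∀ k, ∀ ψ : M → ℝ, Measurable ψ →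
      ∫ x, ψ (f k x) * h k x ∂μ = ∫ x, ψ x * h (k + 1) x ∂μ)
    (horth : ∀ k, ∀ ψ : M → ℝ, Continuous ψ →
      ∫ x, ψ (f k x) * ((g k x + χ k x - χ (k + 1) (f k x)) * h k x) ∂μ = 0) (l j : ℕ) :
    ∑ i ∈ Finset.range l, ∫ x, (g (j + i) x + χ (j + i) x -
        χ (j + i + 1) (f (j + i) x)) ^ 2 * h (j + i) x ∂μ ≤
      ∫ x, (χ j x + ∑ i ∈ Finset.range l, g (j + i) (comp f j i x)) ^ 2 * h j x ∂μ := by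
  induction l generalizing j with
  | zero =>
    simp only [Finset.range_zero, Finset.sum_empty]
    exact integral_nonneg fun x ↦ mul_nonneg (sq_nonneg _) ((hh j).1 x).le
  | succ l ih =>
    set T : M → ℝ := fun x ↦ χ (j + 1) x + ∑ i ∈ Finset.range l, g (j + 1 + i) (comp f (j + 1) i x)
      with hT
    set D : M → ℝ := fun x ↦ g j x + χ j x - χ (j + 1) (f j x) with hD
    have hTc : Continuous T := (hχ _).add (continuous_finsetSum _ fun i _ ↦
      (hg _).comp (continuous_comp hf _ _))
    have hDc : Continuous D := ((hg j).add (hχ j)).sub ((hχ _).comp (hf j))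
    -- The first difference D is split off; the rest is T ∘ f_j, with T the same expression from
    -- time j + 1. After squaring, orthogonality kills the cross term and `hpush` turns T² ∘ f_j
    -- against h_j into T² against h_{j+1}.
    have h1 : ∀ x, χ j x + ∑ i ∈ Finset.range (l + 1), g (j + i) (comp f j i x) =
        D x + T (f j x) := by
      intro x
      have h3 : ∑ i ∈ Finset.range l, g (j + (i + 1)) (comp f j (i + 1) x) =
          ∑ i ∈ Finset.range l, g (j + 1 + i) (comp f (j + 1) i (f j x)) :=
        Finset.sum_congr rfl fun i _ ↦ by rw [comp_succ', show j + (i + 1) = j + 1 + i by ring]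
      rw [Finset.sum_range_succ', h3, hD, hT]
      simp only [add_zero, comp, id_eq]
      ring
    have hTf : Continuous fun x ↦ T (f j x) := hTc.comp (hf j)
    have h2 : ∫ x, (D x + T (f j x)) ^ 2 * h j x ∂μ =
        ∫ x, D x ^ 2 * h j x ∂μ + (2 * ∫ x, T (f j x) * (D x * h j x) ∂μ +
          ∫ x, T (f j x) ^ 2 * h j x ∂μ) := by
      rw [← integral_const_mul, ← integral_add, ← integral_add]
      · refine integral_congr_ae (Eventually.of_forall fun x ↦ ?_)
        ring
      · exact integrable_of_continuous ((hDc.pow 2).mul (hh j).continuous)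
      · exact integrable_of_continuous ((continuous_const.mul
          (hTf.mul (hDc.mul (hh j).continuous))).add ((hTf.pow 2).mul (hh j).continuous))
      · exact integrable_of_continuous (continuous_const.mul
          (hTf.mul (hDc.mul (hh j).continuous)))
      · exact integrable_of_continuous ((hTf.pow 2).mul (hh j).continuous)
    simp only [h1]
    rw [h2, horth j T hTc, mul_zero, zero_add, hpush j (fun x ↦ T x ^ 2) (hTc.pow 2).measurable,
      Finset.sum_range_succ', add_comm]
    refine add_le_add le_rfl ?_
    refine le_of_eq_of_le (Finset.sum_congr rfl fun i _ ↦ ?_) (ih (j + 1))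
    rw [show j + (i + 1) = j + 1 + i by ring]

omit [CompactSpace M] [MeasurableSpace M] [BorelSpace M] in
lemma LogLip.mul {C₁ C₂ : ℝ} {h₁ h₂ : M → ℝ} (h1 : LogLip C₁ h₁) (h2 : LogLip C₂ h₂) :
    LogLip (C₁ + C₂) fun x ↦ h₁ x * h₂ x := by
  refine ⟨fun x ↦ mul_pos (h1.1 x) (h2.1 x), fun x y ↦ ?_⟩
  rw [add_mul, Real.exp_add]
  calc h₁ x * h₂ x ≤ (Real.exp (C₁ * dist x y) * h₁ y) * (Real.exp (C₂ * dist x y) * h₂ y) :=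
        mul_le_mul (h1.2 x y) (h2.2 x y) (h2.1 x).le
          (mul_nonneg (Real.exp_pos _).le (h1.1 y).le)
    _ = _ := by ring

omit [CompactSpace M] [MeasurableSpace M] [BorelSpace M] in
lemma LogLip.inv {h : M → ℝ} (hh : LogLip C h) : LogLip C fun x ↦ (h x)⁻¹ := by
  refine ⟨fun x ↦ inv_pos.2 (hh.1 x), fun x y ↦ ?_⟩
  have := hh.2 y x
  rw [dist_comm y x] at this
  rw [← div_eq_mul_inv, le_div_iff₀ (hh.1 y), inv_mul_le_iff₀ (hh.1 x)]
  linarith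

omit [CompactSpace M] [MeasurableSpace M] [BorelSpace M] in
lemma LogLip.abs_sub_le {h : M → ℝ} (hC : 0 ≤ C) (hh : LogLip C h) {B : ℝ} (hB : ∀ x, h x ≤ B)
    (x y : M) : |h x - h y| ≤ B * (Real.exp (C * dist x y) - 1) := by
  have h1 : ∀ x y, h x - h y ≤ B * (Real.exp (C * dist x y) - 1) := by
    intro x y
    have h2 : 0 ≤ Real.exp (C * dist x y) - 1 :=
      sub_nonneg.2 (Real.one_le_exp (mul_nonneg hC dist_nonneg))
    have h3 := hh.2 x y
    have h4 := mul_le_mul_of_nonneg_right (hB y) h2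
    linarith
  rw [abs_sub_le_iff]
  refine ⟨h1 x y, ?_⟩
  rw [dist_comm]
  exact h1 y x

lemma LogLip.div_le {h u : M → ℝ} (hC : 0 ≤ C) (hC' : 0 ≤ C') (hΔ : ∀ x y : M, dist x y ≤ Δ)
    (hu : LogLip C u) (hh : LogLip C' h) (hh1 : ∫ x, h x ∂μ = 1) (x : M) :
    u x * (h x)⁻¹ ≤ Real.exp ((C + C') * Δ) * ∫ y, u y ∂μ := by
  have hV := measureReal_univ_pos' (μ := μ)
  have h1 := hu.mul_measureReal_le (μ := μ) hC hΔ x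
  have h2 := hh.integral_le (μ := μ) hC' hΔ x
  rw [hh1] at h2
  have h3 := hu.integral_pos (μ := μ)
  rw [← div_eq_mul_inv, div_le_iff₀ (hh.1 x)]
  refine le_of_mul_le_mul_right ?_ hV
  calc u x * μ.real univ ≤ Real.exp (C * Δ) * (∫ y, u y ∂μ) * 1 := by rwa [mul_one]
    _ ≤ Real.exp (C * Δ) * (∫ y, u y ∂μ) * (Real.exp (C' * Δ) * (h x * μ.real univ)) := by gcongr
    _ = _ := by rw [add_mul, Real.exp_add]; ring

/-- A quotient of log-Lipschitz densities is log-Lipschitz, and bounded since both stay within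
exponential factors of their means. This gives the coboundary terms v / h a bound and a modulus of
continuity depending only on the constants. -/
lemma IsDiff.div_bounds {h u : M → ℝ} (hC : 0 ≤ C) (hC' : 0 ≤ C')
    (hΔ : ∀ x y : M, dist x y ≤ Δ) (hu : IsDiff μ C m u) (hh : LogLip C' h)
    (hh1 : ∫ x, h x ∂μ = 1) :
    (∀ x, |u x / h x| ≤ Real.exp ((C + C') * Δ) * m) ∧ ∀ x y, |u x / h x - u y / h y| ≤
      2 * (Real.exp ((C + C') * Δ) * m) * (Real.exp ((C + C') * dist x y) - 1) := by
  obtain ⟨u₁, u₂, h1, h2, h3, h4, h5⟩ := hu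
  have k1 := h1.mul hh.inv
  have k2 := h2.mul hh.inv
  have b1 := h1.div_le hC hC' hΔ hh hh1
  have b2 := h2.div_le hC hC' hΔ hh hh1
  rw [h3] at b1
  rw [h4] at b2
  have hq : ∀ x, u x / h x = u₁ x * (h x)⁻¹ - u₂ x * (h x)⁻¹ := fun x ↦ by
    rw [h5, div_eq_mul_inv, sub_mul]
  refine ⟨fun x ↦ ?_, fun x y ↦ ?_⟩
  · rw [hq, abs_sub_le_iff]
    constructor <;> linarith [b1 x, b2 x, k1.1 x, k2.1 x]
  · rw [hq, hq]
    have e1 := abs_le.1 (k1.abs_sub_le (add_nonneg hC hC') b1 x y)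
    have e2 := abs_le.1 (k2.abs_sub_le (add_nonneg hC hC') b2 x y)
    rw [abs_le]
    constructor <;> linarith [e1.1, e1.2, e2.1, e2.2]

omit [NeZero μ] in
-- Every ball of radius s contains one of the finitely many balls of radius s/2 of a cover.
lemma exists_pos_le_measureReal_ball [μ.IsOpenPosMeasure] {s : ℝ} (hs : 0 < s) :
    ∃ c > 0, ∀ x : M, c ≤ μ.real (Metric.ball x s) := by
  obtain ⟨t, -, ht, hcov⟩ := _root_.finite_cover_balls_of_compact (isCompact_univ (X := M))
    (half_pos hs)
  have h1 : ∀ y : M, 0 < μ.real (Metric.ball y (s / 2)) := fun y ↦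
    ENNReal.toReal_pos (Metric.isOpen_ball.measure_pos μ ⟨y, Metric.mem_ball_self (half_pos hs)⟩).ne'
      (measure_ne_top _ _)
  have h2 : ∃ c > 0, ∀ y ∈ t, c ≤ μ.real (Metric.ball y (s / 2)) := by
    rcases t.eq_empty_or_nonempty with rfl | hne
    · exact ⟨1, one_pos, by simp⟩
    · obtain ⟨y, hy, hmin⟩ := ht.exists_minimalFor (fun y ↦ μ.real (Metric.ball y (s / 2))) _ hne
      refine ⟨_, h1 y, fun z hz ↦ ?_⟩
      rcases le_total (μ.real (Metric.ball z (s / 2))) (μ.real (Metric.ball y (s / 2))) with h | h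
      · exact hmin hz h
      · exact h
  obtain ⟨c, hc, h3⟩ := h2
  refine ⟨c, hc, fun x ↦ ?_⟩
  obtain ⟨y, hy, hxy⟩ := mem_iUnion₂.1 (hcov (mem_univ x))
  refine (h3 y hy).trans (measureReal_mono fun z hz ↦ ?_)
  rw [Metric.mem_ball] at *
  have := dist_triangle_right z x y
  linarith

end Martingale


/-! ### The martingale decomposition and large sums by shadowing -/

section Growth

variable {M : Type*} [MetricSpace M] [CompactSpace M] [MeasurableSpace M] [BorelSpace M]

/-- Families of contracting maps and Lipschitz observables, with uniform constants. -/
structure IsContractingSystem (μ : Measure M) {N N' : ℕ} (F : Fin N → M → M) (G : Fin N' → M → ℝ)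
    (ρ : M → ℝ) (C θ Γ Δ : ℝ) : Prop where
  C_nonneg : 0 ≤ C
  θ_pos : 0 < θ
  θ_lt_one : θ < 1
  Γ_nonneg : 0 ≤ Γ
  contracting : ∀ i, IsContracting μ C θ (F i)
  contracting_add_one : ∀ i, IsContracting μ (C + 1) θ (F i)
  bound : ∀ j x, |G j x| ≤ Γ
  lipschitz : ∀ j x y, |G j x - G j y| ≤ Γ * dist x y
  density : LogLip C ρ
  mass : ∫ x, ρ x ∂μ = 1
  diam : ∀ x y : M, dist x y ≤ Δ

/-- A martingale decomposition of the sequence `g` along the sequence of maps `f`, with densities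
`h` and coboundary terms `χ`. -/
structure IsDecomposition (μ : Measure M) (f : ℕ → M → M) (g : ℕ → M → ℝ) (ρ : M → ℝ) (C C' X : ℝ)
    (h χ : ℕ → M → ℝ) : Prop where
  h_zero : h 0 = ρ
  logLip : ∀ k, LogLip C (h k)
  push : ∀ k, ∀ ψ : M → ℝ, Measurable ψ →
    ∫ x, ψ (f k x) * h k x ∂μ = ∫ x, ψ x * h (k + 1) x ∂μ
  mass : ∀ k, ∫ x, h k x ∂μ = 1
  χ_zero : ∀ x, χ 0 x = 0
  χ_continuous : ∀ k, Continuous (χ k)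
  χ_bound : ∀ k x, |χ k x| ≤ X
  χ_modulus : ∀ k x y, |χ k x - χ k y| ≤ 2 * X * (Real.exp (C' * dist x y) - 1)
  orthogonal : ∀ k, ∀ ψ : M → ℝ, Continuous ψ →
    ∫ x, ψ (f k x) * ((g k x + χ k x - χ (k + 1) (f k x)) * h k x) ∂μ = 0

variable {μ : Measure M} [IsFiniteMeasure μ] {N N' : ℕ} {F : Fin N → M → M} {G : Fin N' → M → ℝ}
  {ρ : M → ℝ} {C θ Γ Δ : ℝ}

omit [CompactSpace M] [BorelSpace M] [IsFiniteMeasure μ] in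
lemma IsContractingSystem.abs_centered_sub_le (hs : IsContractingSystem μ F G ρ C θ Γ Δ)
    (α : ℕ → Fin N) (η : ℕ → Fin N') (k : ℕ) (x y : M) :
    |centered μ ρ (fun i ↦ F (α i)) (fun i ↦ G (η i)) k x -
      centered μ ρ (fun i ↦ F (α i)) (fun i ↦ G (η i)) k y| ≤ Γ * dist x y := by
  rw [centered, centered, sub_sub_sub_cancel_right]
  exact hs.lipschitz _ _ _

omit [CompactSpace M] [MeasurableSpace M] [BorelSpace M] in
lemma continuous_of_abs_sub_le {u : M → ℝ} {K : ℝ} (h : ∀ x y, |u x - u y| ≤ K * dist x y) :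
    Continuous u := by
  refine (LipschitzWith.of_dist_le_mul (K := K.toNNReal) fun x y ↦ ?_).continuous
  rw [Real.dist_eq]
  exact (h x y).trans (mul_le_mul_of_nonneg_right (Real.le_coe_toNNReal K) dist_nonneg)

omit [BorelSpace M] [IsFiniteMeasure μ] in
lemma IsContractingSystem.continuous_centered (hs : IsContractingSystem μ F G ρ C θ Γ Δ)
    (α : ℕ → Fin N) (η : ℕ → Fin N') (k : ℕ) :
    Continuous (centered μ ρ (fun i ↦ F (α i)) (fun i ↦ G (η i)) k) :=
  continuous_of_abs_sub_le (hs.abs_centered_sub_le α η k)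

lemma IsContractingSystem.abs_centered_le (hs : IsContractingSystem μ F G ρ C θ Γ Δ)
    (α : ℕ → Fin N) (η : ℕ → Fin N') (k : ℕ) (x : M) :
    |centered μ ρ (fun i ↦ F (α i)) (fun i ↦ G (η i)) k x| ≤ 2 * Γ :=
  SeqExpanding.abs_centered_le (fun x ↦ (hs.density.1 x).le)
    (integrable_of_continuous hs.density.continuous) hs.mass (fun _ _ ↦ hs.bound _ _) k x

variable [NeZero μ]

/-- Take χ = v / h with v the corrector of ĝ h. Its recursion says that ℒ_k maps (ĝ_k + χ_k) h_k to
χ_{k+1} h_{k+1}, which is the orthogonality. The bound X serves all sequences at once. -/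
lemma IsContractingSystem.exists_decomposition (hs : IsContractingSystem μ F G ρ C θ Γ Δ) :
    ∃ X, ∀ (α : ℕ → Fin N) (η : ℕ → Fin N'), ∃ h χ, IsDecomposition μ (fun i ↦ F (α i))
      (centered μ ρ (fun i ↦ F (α i)) (fun i ↦ G (η i))) ρ C (C + 1 + C) X h χ := by
  set A := 3 * Γ + 1 with hA
  have hA0 : 0 < A := by have := hs.Γ_nonneg; positivity
  refine ⟨Real.exp ((C + 1 + C) * Δ) * (A * (1 - θ) / θ), fun α η ↦ ?_⟩
  set f : ℕ → M → M := fun i ↦ F (α i) with hf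
  set g := centered μ ρ f (fun i ↦ G (η i)) with hg
  have hfc : ∀ i, Continuous (f i) := fun i ↦ (hs.contracting _).continuous
  have hgc : ∀ k, Continuous (g k) := hs.continuous_centered α η
  have hgb : ∀ k x, |g k x| ≤ 2 * Γ := hs.abs_centered_le α η
  have hgl : ∀ k x y, |g k x - g k y| ≤ Γ * dist x y := hs.abs_centered_sub_le α η
  obtain ⟨h, h0, hh, hpush⟩ := exists_densities (f := f) (fun i ↦ hs.contracting _) hs.density
  have hcomp := fun k ψ hψ ↦
    integral_comp_densities (fun i ↦ (hfc i).measurable) hpush k (ψ := ψ) hψ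
  have hmass : ∀ k, ∫ x, h k x ∂μ = 1 := fun k ↦ by
    have := hcomp k (fun _ ↦ 1) measurable_const
    simp only [one_mul] at this
    rw [← this, h0, hs.mass]
  have hhi : ∀ k, Integrable (h k) μ := fun k ↦ integrable_of_continuous (hh k).continuous
  have hmean : ∀ k, ∫ x, g k x * h k x ∂μ = 0 := by
    intro k
    have hGc : Continuous (G (η k)) := continuous_of_abs_sub_le (hs.lipschitz _)
    have h1 : ∀ x, g k x * h k x =
        G (η k) x * h k x - (∫ y, G (η k) y * h k y ∂μ) * h k x := fun x ↦ by
      rw [hg, centered, ← h0, hcomp k _ hGc.measurable]; ring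
    simp only [h1]
    rw [integral_sub (integrable_of_continuous (hGc.fun_mul (hh k).continuous))
      ((hhi k).const_mul _), integral_const_mul, hmass, mul_one, sub_self]
  have hw : ∀ k, IsDiff μ (C + 1) A fun x ↦ g k x * h k x := by
    intro k
    -- As g ≥ -2Γ, the sum g + A with A = 3Γ + 1 exceeds the Lipschitz constant Γ of g, so it has
    -- log-Lipschitz constant 1. Thus g h = (g + A)h - A h is a difference of densities with
    -- constant C + 1, of equal mass because g h has mean zero.
    have h1 : LogLip 1 fun x ↦ g k x + A := by
      refine ⟨fun x ↦ ?_, fun x y ↦ ?_⟩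
      · have := (abs_le.1 (hgb k x)).1
        have := hs.Γ_nonneg
        linarith
      · have h2 := (abs_le.1 (hgb k y)).1
        have h3 := (abs_le.1 (hgl k x y)).2
        have h4 := hs.Γ_nonneg
        have h5 := Real.add_one_le_exp (1 * dist x y)
        have h6 : (0 : ℝ) ≤ dist x y := dist_nonneg
        have h7 : Γ ≤ g k y + A := by linarith
        have h8 := mul_le_mul_of_nonneg_right h7 h6
        have h9 := mul_le_mul_of_nonneg_right h5 (h4.trans h7)
        linarith
    refine ⟨fun x ↦ (g k x + A) * h k x, fun x ↦ A * h k x, ?_,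
      ((hh k).const_mul hA0).mono (by linarith), ?_, ?_, fun x ↦ by ring⟩
    · rw [add_comm C 1]; exact h1.mul (hh k)
    · simp only [add_mul]
      rw [integral_add (integrable_of_continuous ((hgc k).fun_mul (hh k).continuous))
        ((hhi k).const_mul A), hmean, integral_const_mul, hmass, zero_add, mul_one]
    · rw [integral_const_mul, hmass, mul_one]
  have hC1 : 0 ≤ C + 1 := by linarith [hs.C_nonneg]
  obtain ⟨v, v0, hv, hvp⟩ := exists_corrector hC1 hA0 hs.θ_pos hs.θ_lt_one
    (fun i ↦ hs.contracting_add_one (α i)) hw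
  have hb := fun k ↦ (hv k).div_bounds hC1 hs.C_nonneg hs.diam (hh k) (hmass k)
  have hχc : ∀ k, Continuous fun x ↦ v k x / h k x := fun k ↦
    (hv k).continuous.div (hh k).continuous fun x ↦ ((hh k).1 x).ne'
  refine ⟨h, fun k x ↦ v k x / h k x, h0, hh, hpush, hmass, fun x ↦ by simp only [v0, zero_div],
    hχc, fun k ↦ (hb k).1, fun k ↦ (hb k).2, fun k ψ hψ ↦ ?_⟩
  have h1 : ∀ x, ψ (f k x) * ((g k x + v k x / h k x - v (k + 1) (f k x) / h (k + 1) (f k x)) *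
      h k x) = ψ (f k x) * (g k x * h k x + v k x) -
        (ψ (f k x) * (v (k + 1) (f k x) / h (k + 1) (f k x))) * h k x := fun x ↦ by
    have := ((hh k).1 x).ne'
    field_simp
  simp only [h1]
  have hψf := hψ.comp (hfc k)
  rw [integral_sub, hvp k ψ hψ,
    hpush k (fun x ↦ ψ x * (v (k + 1) x / h (k + 1) x)) (hψ.mul (hχc _)).measurable, sub_eq_zero]
  · refine integral_congr_ae (Eventually.of_forall fun x ↦ ?_)
    have := ((hh (k + 1)).1 x).ne'
    field_simp
  · exact integrable_of_continuous
      (hψf.mul (((hgc k).mul (hh k).continuous).add (hv k).continuous))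
  · exact integrable_of_continuous
      ((hψf.mul ((hχc (k + 1)).comp (hfc k))).mul (hh k).continuous)

omit [NeZero μ] [IsFiniteMeasure μ] in
-- The bounds on ĝ and χ are uniform in time and in the sequences, and the finitely many maps share
-- a modulus of continuity; so all martingale differences do.
lemma IsContractingSystem.exists_modulus (hs : IsContractingSystem μ F G ρ C θ Γ Δ) (C' X : ℝ)
    {τ : ℝ} (hτ : 0 < τ) : ∃ s > 0, ∀ (α : ℕ → Fin N) (η : ℕ → Fin N') (h χ : ℕ → M → ℝ),
      IsDecomposition μ (fun i ↦ F (α i))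
        (centered μ ρ (fun i ↦ F (α i)) (fun i ↦ G (η i))) ρ C C' X h χ →
      ∀ k x y, dist x y < s →
        (centered μ ρ (fun i ↦ F (α i)) (fun i ↦ G (η i)) k x + χ k x - χ (k + 1) (F (α k) x)) -
          (centered μ ρ (fun i ↦ F (α i)) (fun i ↦ G (η i)) k y + χ k y - χ (k + 1) (F (α k) y))
          ≤ τ := by
  have h1 : Tendsto (fun t : ℝ ↦ Γ * t + 2 * X * (Real.exp (C' * t) - 1)) (𝓝 0)
      (𝓝 (Γ * 0 + 2 * X * (Real.exp (C' * 0) - 1))) :=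
    Continuous.tendsto (by fun_prop) 0
  have h2 : Tendsto (fun t : ℝ ↦ 2 * X * (Real.exp (C' * t) - 1)) (𝓝 0)
      (𝓝 (2 * X * (Real.exp (C' * 0) - 1))) :=
    Continuous.tendsto (by fun_prop) 0
  simp only [mul_zero, Real.exp_zero, sub_self, add_zero] at h1 h2
  obtain ⟨s₁, hs₁, k1⟩ := Metric.eventually_nhds_iff.1 (h1.eventually_lt_const (half_pos hτ))
  obtain ⟨s₂, hs₂, k2⟩ := Metric.eventually_nhds_iff.1 (h2.eventually_lt_const (half_pos hτ))
  have h3 : ∀ i, ∃ s > 0, ∀ x y, dist x y < s → dist (F i x) (F i y) < s₂ := fun i ↦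
    (Metric.uniformContinuous_iff.1
      (CompactSpace.uniformContinuous_of_continuous (hs.contracting i).continuous) s₂ hs₂).imp
      fun s h ↦ ⟨h.1, fun x y hd ↦ h.2 hd⟩
  choose S hS hSd using h3
  have h4 : ∃ s > 0, ∀ i, s ≤ S i := by
    rcases isEmpty_or_nonempty (Fin N) with he | hne
    · exact ⟨1, one_pos, fun i ↦ (he.false i).elim⟩
    · obtain ⟨i, hi⟩ := Finite.exists_min S
      exact ⟨S i, hS i, hi⟩
  obtain ⟨s₃, hs₃, k3⟩ := h4
  refine ⟨min s₁ s₃, lt_min hs₁ hs₃, fun α η h χ hd k x y hxy ↦ ?_⟩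
  have e1 := @k1 (dist x y) (by
    rw [Real.dist_eq, sub_zero, abs_of_nonneg dist_nonneg]; exact hxy.trans_le (min_le_left _ _))
  have e2 := @k2 (dist (F (α k) x) (F (α k) y)) (by
    rw [Real.dist_eq, sub_zero, abs_of_nonneg dist_nonneg]
    exact hSd _ _ _ (hxy.trans_le ((min_le_right _ _).trans (k3 _))))
  have e3 := (abs_le.1 (hs.abs_centered_sub_le α η k x y)).2
  have e4 := (abs_le.1 (hd.χ_modulus k x y)).2
  have e5 := (abs_le.1 (hd.χ_modulus (k + 1) (F (α k) x) (F (α k) y))).1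
  linarith

/-- By specification, the large sums over blocks add up along some orbit. -/
lemma exists_large_sum {N : ℕ} {F : Fin N → M → M} {α : ℕ → Fin N} {g : ℕ → M → ℝ}
    {a ε : ℝ} {L D : ℕ} (ha : 0 ≤ a) (hε : 0 < ε) (hsp : IsSpecificationGap F ε L D)
    (hlip : ∀ k x y, |g k x - g k y| ≤ a / (4 * ε) * dist x y)
    (hgap : ∀ k x, 8 * D * |g k x| ≤ a * L)
    (hblock : ∀ r, ∃ x, a * L ≤ ∑ i ∈ Finset.Icc 1 L, g (r + i) (comp (fun i ↦ F (α i)) r i x))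
    (r m : ℕ) : ∃ y, 5 / 8 * a * L * m ≤ ∑ i ∈ Finset.range (m * (L + D)),
      g (r + 1 + i) (comp (fun i ↦ F (α i)) (r + 1) i y) := by
  set f : ℕ → M → M := fun i ↦ F (α i) with hf
  choose x hx using hblock
  obtain ⟨z, hz⟩ := hsp α (fun k ↦ r + k * (L + D)) (fun k ↦ x (r + k * (L + D)))
    (fun k ↦ by rw [add_mul]; omega)
  -- Blocks start at r + k(L + D), but their sums cover the times 1, …, L after the start; hence the
  -- shift to time r + 1.
  refine ⟨comp f 0 (r + 1) z, ?_⟩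
  have hterm : ∀ i, comp f (r + 1) i (comp f 0 (r + 1) z) = comp f 0 (r + 1 + i) z := fun i ↦ by
    rw [comp_add f 0 (r + 1) i, zero_add]
  simp only [hterm]
  induction m with
  | zero => simp
  | succ m ih =>
    rw [add_mul, one_mul, Finset.sum_range_add, Finset.sum_range_add]
    -- Shadowing within ε loses at most a/4 per term of a block, and a gap of D terms loses at most
    -- aL/8; each period gains at least 5aL/8.
    have h1 : a * L - a / 4 * L ≤ ∑ i ∈ Finset.range L, g (r + 1 + (m * (L + D) + i))
        (comp f 0 (r + 1 + (m * (L + D) + i)) z) := by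
      have h2 := hx (r + m * (L + D))
      rw [← Finset.Ico_add_one_right_eq_Icc, Finset.sum_Ico_eq_sum_range, Nat.add_sub_cancel] at h2
      have h3 : ∀ i ∈ Finset.range L,
          g (r + m * (L + D) + (1 + i)) (comp f (r + m * (L + D)) (1 + i) (x (r + m * (L + D)))) -
            a / 4 ≤ g (r + 1 + (m * (L + D) + i)) (comp f 0 (r + 1 + (m * (L + D) + i)) z) := by
        intro i hi
        have h4 := hz m i (Finset.mem_range.1 hi)
        rw [show r + 1 + (m * (L + D) + i) = r + m * (L + D) + (1 + i) by ring]
        rw [add_assoc _ i 1, add_comm i 1, dist_comm] at h4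
        have h5 := (abs_le.1 (hlip (r + m * (L + D) + (1 + i)) (comp f (r + m * (L + D)) (1 + i)
          (x (r + m * (L + D)))) (comp f 0 (r + m * (L + D) + (1 + i)) z))).2
        have h6 := mul_le_mul_of_nonneg_left h4 (by positivity : 0 ≤ a / (4 * ε))
        have h7 : a / (4 * ε) * ε = a / 4 := by field_simp
        linarith
      refine le_trans ?_ (Finset.sum_le_sum h3)
      rw [Finset.sum_sub_distrib, Finset.sum_const, Finset.card_range, nsmul_eq_mul]
      linarith
    have h3 : -(a * L / 8) ≤ ∑ i ∈ Finset.range D, g (r + 1 + (m * (L + D) + (L + i)))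
        (comp f 0 (r + 1 + (m * (L + D) + (L + i))) z) := by
      rcases Nat.eq_zero_or_pos D with rfl | hD
      · have : 0 ≤ a * L := by positivity
        simp
        linarith
      · have hD' : (0 : ℝ) < D := by exact_mod_cast hD
        have h4 := Finset.card_nsmul_le_sum (Finset.range D) (fun i ↦
          g (r + 1 + (m * (L + D) + (L + i))) (comp f 0 (r + 1 + (m * (L + D) + (L + i))) z))
          (-(a * L / (8 * D))) fun i _ ↦ by
            have h5 := hgap (r + 1 + (m * (L + D) + (L + i)))
              (comp f 0 (r + 1 + (m * (L + D) + (L + i))) z)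
            have h6 := neg_abs_le (g (r + 1 + (m * (L + D) + (L + i)))
              (comp f 0 (r + 1 + (m * (L + D) + (L + i))) z))
            rw [← le_div_iff₀' (by positivity)] at h5
            linarith
        rw [Finset.card_range, nsmul_eq_mul] at h4
        refine le_of_eq_of_le ?_ h4
        field_simp
    push_cast
    simp only [add_assoc] at *
    linarith

end Growth


/-! ### Linear growth of the variance -/

section VarianceGrowth

variable {M : Type*} [MetricSpace M] [CompactSpace M] [MeasurableSpace M] [BorelSpace M]
  {μ : Measure M} [IsFiniteMeasure μ] [NeZero μ] {N N' : ℕ} {F : Fin N → M → M}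
  {G : Fin N' → M → ℝ} {ρ : M → ℝ} {C θ Γ Δ : ℝ}

lemma variance_nonneg {M : Type*} [MeasurableSpace M] (μ : Measure M) {ρ : M → ℝ}
    (hρ : ∀ x, 0 ≤ ρ x) (f : ℕ → M → M) (g : ℕ → M → ℝ) (n : ℕ) : 0 ≤ variance μ ρ f g n :=
  integral_nonneg fun x ↦ mul_nonneg (sq_nonneg _) (hρ x)

lemma sum_comp_eq_telescope {M : Type*} (f : ℕ → M → M) (g χ : ℕ → M → ℝ) (j l : ℕ) (y : M) :
    ∑ i ∈ Finset.range l, g (j + i) (comp f j i y) =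
      ∑ i ∈ Finset.range l, (g (j + i) (comp f j i y) + χ (j + i) (comp f j i y) -
        χ (j + i + 1) (f (j + i) (comp f j i y))) - χ j y + χ (j + l) (comp f j l y) := by
  induction l with
  | zero => simp [comp]
  | succ l ih =>
    rw [Finset.sum_range_succ, Finset.sum_range_succ, ih]
    simp only [comp, Function.comp_apply, ← add_assoc]
    ring

/-- The martingale differences sum to at least 1 along the shadowing orbit, so one of them is at
least 1/l there, and at least 1/(2l) on a ball of uniform radius. Ball measures and densities have
uniform positive lower bounds. -/
lemma IsContractingSystem.exists_window [μ.IsOpenPosMeasure]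
    (hs : IsContractingSystem μ F G ρ C θ Γ Δ) (C' X : ℝ) {a ε : ℝ} {L D : ℕ} (ha : 0 < a)
    (hL : 0 < L) (hε : 0 < ε) (hsp : IsSpecificationGap F ε L D)
    (hlip : ∀ j x y, |G j x - G j y| ≤ a / (4 * ε) * dist x y)
    (hgap : ∀ (α : ℕ → Fin N) (η : ℕ → Fin N') (k : ℕ) (x : M),
      8 * D * |centered μ ρ (fun i ↦ F (α i)) (fun i ↦ G (η i)) k x| ≤ a * L)
    (hblock : ∀ (α : ℕ → Fin N) (η : ℕ → Fin N') (r : ℕ), ∃ x : M,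
      a * L ≤ ∑ i ∈ Finset.Icc 1 L, centered μ ρ (fun i ↦ F (α i)) (fun i ↦ G (η i)) (r + i)
          (comp (fun i ↦ F (α i)) r i x)) :
    ∃ (l : ℕ) (δ : ℝ), 0 < l ∧ 0 < δ ∧ ∀ (α : ℕ → Fin N) (η : ℕ → Fin N') (h χ : ℕ → M → ℝ),
      IsDecomposition μ (fun i ↦ F (α i))
        (centered μ ρ (fun i ↦ F (α i)) (fun i ↦ G (η i))) ρ C C' X h χ →
      ∀ r, δ ≤ ∑ i ∈ Finset.range l,
        ∫ x, (centered μ ρ (fun i ↦ F (α i)) (fun i ↦ G (η i)) (r + 1 + i) x + χ (r + 1 + i) x -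
          χ (r + 1 + i + 1) (F (α (r + 1 + i)) x)) ^ 2 * h (r + 1 + i) x ∂μ := by
  have hL' : (0 : ℝ) < L := by exact_mod_cast hL
  -- So many blocks make the sum at least 2X + 1, where 2X bounds the two boundary terms of the
  -- telescoping sum.
  obtain ⟨m, hm⟩ := exists_nat_ge (max 1 ((2 * X + 1) / (5 / 8 * a * L)))
  have hm1 : (1 : ℝ) ≤ m := (le_max_left _ _).trans hm
  have hm2 : 2 * X + 1 ≤ 5 / 8 * a * L * m := by
    have := (le_max_right _ _).trans hm
    rwa [div_le_iff₀' (by positivity)] at this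
  set l := m * (L + D) with hl
  have hl0 : 0 < l := Nat.mul_pos (by exact_mod_cast hm1) (by omega)
  have hl0' : (0 : ℝ) < l := by exact_mod_cast hl0
  have hτ : (0 : ℝ) < 1 / (2 * l) := by positivity
  obtain ⟨s, hs0, hmod⟩ := hs.exists_modulus C' X hτ
  obtain ⟨c, hc, hball⟩ := exists_pos_le_measureReal_ball (μ := μ) hs0
  have hV := measureReal_univ_pos' (μ := μ)
  set b := (Real.exp (C * Δ) * μ.real univ)⁻¹ with hb
  have hb0 : 0 < b := by positivity
  refine ⟨l, c * ((1 / (2 * l)) ^ 2 * b), hl0, by positivity, fun α η h χ hd r ↦ ?_⟩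
  set f : ℕ → M → M := fun i ↦ F (α i) with hf
  set g := centered μ ρ f (fun i ↦ G (η i)) with hg
  have hhb : ∀ k x, b ≤ h k x := by
    intro k x
    have := (hd.logLip k).integral_le (μ := μ) hs.C_nonneg hs.diam x
    rw [hd.mass] at this
    rw [hb, inv_le_iff_one_le_mul₀ (by positivity)]
    linarith
  obtain ⟨y, hy⟩ := exists_large_sum (α := α) (g := g) ha.le hε hsp
    (fun k x y ↦ by
      rw [hg, centered, centered, sub_sub_sub_cancel_right]; exact hlip _ _ _)
    (hgap α η) (hblock α η) r m
  rw [← hl, ← hf, sum_comp_eq_telescope f g χ] at hy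
  have h1 : 1 ≤ ∑ i ∈ Finset.range l, (g (r + 1 + i) (comp f (r + 1) i y) +
      χ (r + 1 + i) (comp f (r + 1) i y) -
        χ (r + 1 + i + 1) (f (r + 1 + i) (comp f (r + 1) i y))) := by
    have h2 := (abs_le.1 (hd.χ_bound (r + 1) y)).1
    have h3 := (abs_le.1 (hd.χ_bound (r + 1 + l) (comp f (r + 1) l y))).2
    linarith
  obtain ⟨i, hi, h2⟩ : ∃ i ∈ Finset.range l, 1 / (l : ℝ) ≤ g (r + 1 + i) (comp f (r + 1) i y) +
      χ (r + 1 + i) (comp f (r + 1) i y) -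
        χ (r + 1 + i + 1) (f (r + 1 + i) (comp f (r + 1) i y)) := by
    by_contra! hcon
    have h3 := Finset.sum_lt_sum_of_nonempty (Finset.nonempty_range_iff.2 hl0.ne') hcon
    rw [Finset.sum_const, Finset.card_range, nsmul_eq_mul, mul_one_div_cancel hl0'.ne'] at h3
    linarith
  refine le_trans ?_ (Finset.single_le_sum (fun k _ ↦ integral_nonneg fun x ↦
    mul_nonneg (sq_nonneg _) ((hd.logLip (r + 1 + k)).1 x).le) hi)
  set k := r + 1 + i with hk
  set z := comp f (r + 1) i y with hz
  calc c * ((1 / (2 * (l : ℝ))) ^ 2 * b)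
      ≤ μ.real (Metric.ball z s) * ((1 / (2 * l)) ^ 2 * b) := by gcongr; exact hball z
    _ = ∫ x, (Metric.ball z s).indicator (fun _ ↦ (1 / (2 * (l : ℝ))) ^ 2 * b) x ∂μ := by
      rw [integral_indicator_const _ measurableSet_ball, smul_eq_mul]
    _ ≤ _ := by
      refine integral_mono ((integrable_const _).indicator measurableSet_ball)
        (integrable_of_continuous ?_) fun x ↦ ?_
      · exact ((((hs.continuous_centered α η k).add (hd.χ_continuous k)).sub
          ((hd.χ_continuous (k + 1)).comp (hs.contracting _).continuous)).pow 2).mul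
            (hd.logLip k).continuous
      · by_cases hx : x ∈ Metric.ball z s
        · simp only [indicator_of_mem hx]
          have h3 := hmod α η h χ hd k z x (by rwa [dist_comm])
          have h4 : 1 / (l : ℝ) = 1 / (2 * l) + 1 / (2 * l) := by field_simp; norm_num
          refine mul_le_mul (pow_le_pow_left₀ hτ.le ?_ 2) (hhb k x) hb0.le (sq_nonneg _)
          linarith
        · simp only [indicator_of_notMem hx]
          exact mul_nonneg (sq_nonneg _) ((hd.logLip k).1 x).le

lemma IsDecomposition.mul_le_variance {f : ℕ → M → M} {g : ℕ → M → ℝ} {C' X δ : ℝ} {l : ℕ}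
    {h χ : ℕ → M → ℝ} (hd : IsDecomposition μ f (centered μ ρ f g) ρ C C' X h χ)
    (hf : ∀ k, Continuous (f k)) (hg : ∀ k, Continuous (centered μ ρ f g k))
    (hδ : ∀ r, δ ≤ ∑ i ∈ Finset.range l, ∫ x, (centered μ ρ f g (r + 1 + i) x + χ (r + 1 + i) x -
          χ (r + 1 + i + 1) (f (r + 1 + i) x)) ^ 2 * h (r + 1 + i) x ∂μ) {k n : ℕ}
    (hn : k * l < n) : k * δ ≤ variance μ ρ f g n := by
  set e : ℕ → ℝ := fun j ↦ ∫ x, (centered μ ρ f g j x + χ j x - χ (j + 1) (f j x)) ^ 2 * h j x ∂μ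
    with he
  have he0 : ∀ j, 0 ≤ e j := fun j ↦ integral_nonneg fun x ↦
    mul_nonneg (sq_nonneg _) ((hd.logLip j).1 x).le
  -- The k disjoint windows occupy the times 1, …, kl; time 0 belongs to none, hence the strict
  -- inequality in `hn`.
  have h1 : ∀ k : ℕ, k * δ ≤ ∑ j ∈ Finset.range (k * l + 1), e j := by
    intro k
    induction k with
    | zero => simpa using he0 0
    | succ k ih =>
      rw [show (k + 1) * l + 1 = (k * l + 1) + l by ring, Finset.sum_range_add]
      push_cast
      linarith [hδ (k * l)]
  have h2 := sum_integral_sq_le hf hg hd.logLip hd.χ_continuous hd.push hd.orthogonal n 0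
  simp only [zero_add, hd.χ_zero, hd.h_zero] at h2
  exact (h1 k).trans ((Finset.sum_le_sum_of_subset_of_nonneg
    (Finset.range_mono (by omega)) fun j _ _ ↦ he0 j).trans h2)

omit [NeZero μ] in
lemma IsContractingSystem.integral_sum_centered (hs : IsContractingSystem μ F G ρ C θ Γ Δ)
    (α : ℕ → Fin N) (η : ℕ → Fin N') (n : ℕ) :
    ∫ x, (∑ k ∈ Finset.range n, centered μ ρ (fun i ↦ F (α i)) (fun i ↦ G (η i)) k
      (comp (fun i ↦ F (α i)) 0 k x)) * ρ x ∂μ = 0 := by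
  have hc : ∀ k, Continuous (comp (fun i ↦ F (α i)) 0 k) := fun k ↦
    continuous_comp (fun i ↦ (hs.contracting (α i)).continuous) _ _
  have hρ := hs.density.continuous
  simp only [Finset.sum_mul]
  rw [integral_finsetSum _ fun k _ ↦ integrable_of_continuous
    (((hs.continuous_centered α η k).comp' (hc k)).fun_mul hρ)]
  refine Finset.sum_eq_zero fun k _ ↦ ?_
  simp only [centered, sub_mul]
  rw [integral_sub (integrable_of_continuous
    (((continuous_of_abs_sub_le (hs.lipschitz (η k))).comp' (hc k)).fun_mul hρ))
    ((integrable_of_continuous hρ).const_mul _), integral_const_mul, hs.mass, mul_one, sub_self]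

omit [NeZero μ] in
/-- If a Birkhoff sum vanishes, then its periodic repetition has vanishing variances, too. -/
lemma IsContractingSystem.variance_pos [μ.IsOpenPosMeasure]
    (hs : IsContractingSystem μ F G ρ C θ Γ Δ) {l : ℕ}
    (hl : ∀ (α : ℕ → Fin N) (η : ℕ → Fin N') (n : ℕ), l < n →
      0 < variance μ ρ (fun i ↦ F (α i)) (fun i ↦ G (η i)) n)
    (α : ℕ → Fin N) (η : ℕ → Fin N') {n : ℕ} (hn : 0 < n) :
    0 < variance μ ρ (fun i ↦ F (α i)) (fun i ↦ G (η i)) n := by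
  have hρ := hs.density.continuous
  refine lt_of_le_of_ne (variance_nonneg _ (fun x ↦ (hs.density.1 x).le) _ _ _) fun h0 ↦ ?_
  set f : ℕ → M → M := fun i ↦ F (α i) with hf
  have hfc : ∀ k, Continuous (comp f 0 k) := fun k ↦
    continuous_comp (fun i ↦ (hs.contracting (α i)).continuous) _ _
  have hSc : Continuous fun x ↦ ∑ k ∈ Finset.range n,
      centered μ ρ f (fun i ↦ G (η i)) k (comp f 0 k x) :=
    continuous_finsetSum _ fun k _ ↦ (hs.continuous_centered α η k).comp (hfc k)
  have hc : Continuous fun x ↦ (∑ k ∈ Finset.range n,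
      centered μ ρ f (fun i ↦ G (η i)) k (comp f 0 k x)) ^ 2 * ρ x := (hSc.pow 2).mul hρ
  have h1 := (integral_eq_zero_iff_of_nonneg (fun x ↦ mul_nonneg (sq_nonneg _)
    (hs.density.1 x).le) (integrable_of_continuous hc)).1 h0.symm
  have h2 := (Continuous.ae_eq_iff_eq μ hc continuous_const).1 h1
  -- By continuity the centered sum vanishes everywhere, so the uncentered one is constant. The
  -- latter can be repeated, whereas the centering changes with time.
  obtain ⟨c, h3⟩ : ∃ c, ∀ x, ∑ k ∈ Finset.range n, G (η k) (comp f 0 k x) = c := by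
    refine ⟨∑ k ∈ Finset.range n, ∫ y, G (η k) (comp f 0 k y) * ρ y ∂μ, fun x ↦ ?_⟩
    have h4 : (∑ k ∈ Finset.range n, centered μ ρ f (fun i ↦ G (η i)) k (comp f 0 k x)) ^ 2 *
        ρ x = 0 := congrFun h2 x
    replace h4 := (pow_eq_zero_iff two_ne_zero).1
      ((mul_eq_zero.1 h4).resolve_right (hs.density.1 x).ne')
    simp only [centered, Finset.sum_sub_distrib] at h4
    linarith
  set f' : ℕ → M → M := fun i ↦ F (α (i % n)) with hf'
  have hcomp : ∀ b i, i < n → comp f' (b * n) i = comp f 0 i := by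
    intro b i hi
    refine comp_congr fun k hk ↦ ?_
    simp only [hf', hf, zero_add]
    rw [Nat.mul_add_mod_self_right, Nat.mod_eq_of_lt (by omega)]
  have h5 : ∀ b x, ∑ k ∈ Finset.range (b * n), G (η (k % n)) (comp f' 0 k x) = b * c := by
    intro b x
    induction b with
    | zero => simp
    | succ b ih =>
      rw [add_mul, one_mul, Finset.sum_range_add, ih]
      have h6 : ∑ i ∈ Finset.range n, G (η ((b * n + i) % n)) (comp f' 0 (b * n + i) x) = c := by
        rw [← h3 (comp f' 0 (b * n) x)]
        refine Finset.sum_congr rfl fun i hi ↦ ?_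
        rw [comp_add, zero_add, hcomp b i (Finset.mem_range.1 hi),
          Nat.mul_add_mod_self_right, Nat.mod_eq_of_lt (Finset.mem_range.1 hi)]
      rw [h6]; push_cast; ring
  -- Over l + 1 periods the centered sum is again constant, and it is zero because its mean is. The
  -- time (l + 1)n > l contradicts `hl`.
  obtain ⟨e, h7⟩ : ∃ e, ∀ x, ∑ k ∈ Finset.range ((l + 1) * n),
      centered μ ρ f' (fun i ↦ G (η (i % n))) k (comp f' 0 k x) = e :=
    ⟨_, fun x ↦ by simp only [centered, Finset.sum_sub_distrib, h5]; rfl⟩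
  have h8 := hs.integral_sum_centered (fun i ↦ α (i % n)) (fun i ↦ η (i % n)) ((l + 1) * n)
  simp only [← hf', h7] at h8
  rw [integral_const_mul, hs.mass, mul_one] at h8
  have h9 := hl (fun i ↦ α (i % n)) (fun i ↦ η (i % n)) ((l + 1) * n) (by nlinarith)
  rw [← hf', variance] at h9
  simp [h7, h8] at h9

lemma variance_congr {M : Type*} [MeasurableSpace M] {μ : Measure M} {ρ : M → ℝ}
    {f f' : ℕ → M → M} {g g' : ℕ → M → ℝ} {n : ℕ} (hf : ∀ k < n, f k = f' k)
    (hg : ∀ k < n, g k = g' k) : variance μ ρ f g n = variance μ ρ f' g' n := by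
  have h1 : ∀ k < n, comp f 0 k = comp f' 0 k := by
    intro k
    induction k with
    | zero => exact fun _ ↦ rfl
    | succ k ih =>
      intro hk
      simp only [comp, zero_add]
      rw [ih (by omega), hf k (by omega)]
  rw [variance, variance]
  congr 1
  ext x
  congr 2
  refine Finset.sum_congr rfl fun k hk ↦ ?_
  have hk := Finset.mem_range.1 hk
  rw [centered, centered, h1 k hk, hg k hk]

/-- Positive variances are bounded below, since there are finitely many words of each length. -/
lemma exists_pos_le_variance {M : Type*} [MeasurableSpace M] {μ : Measure M} {ρ : M → ℝ} {N N' : ℕ}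
    {F : Fin N → M → M} {G : Fin N' → M → ℝ} {n : ℕ} (hn : 0 < n)
    (h : ∀ (α : ℕ → Fin N) (η : ℕ → Fin N'),
      0 < variance μ ρ (fun i ↦ F (α i)) (fun i ↦ G (η i)) n) :
    ∃ B > 0, ∀ (α : ℕ → Fin N) (η : ℕ → Fin N'),
      B ≤ variance μ ρ (fun i ↦ F (α i)) (fun i ↦ G (η i)) n := by
  let φ : (Fin n → Fin N × Fin N') → ℝ := fun w ↦ variance μ ρ
    (fun i ↦ F (w ⟨i % n, Nat.mod_lt _ hn⟩).1) (fun i ↦ G (w ⟨i % n, Nat.mod_lt _ hn⟩).2) n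
  have h1 : ∀ (α : ℕ → Fin N) (η : ℕ → Fin N'), φ (fun i ↦ (α i, η i)) =
      variance μ ρ (fun i ↦ F (α i)) (fun i ↦ G (η i)) n := fun α η ↦
    variance_congr (fun k hk ↦ by simp only [Nat.mod_eq_of_lt hk])
      (fun k hk ↦ by simp only [Nat.mod_eq_of_lt hk])
  rcases isEmpty_or_nonempty (Fin n → Fin N × Fin N') with he | hne
  · exact ⟨1, one_pos, fun α η ↦ (he.false fun i ↦ (α i, η i)).elim⟩
  · obtain ⟨w, hw⟩ := Finite.exists_min φ
    exact ⟨φ w, h (fun i ↦ (w ⟨i % n, Nat.mod_lt _ hn⟩).1)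
      (fun i ↦ (w ⟨i % n, Nat.mod_lt _ hn⟩).2), fun α η ↦
        (hw fun i ↦ (α i, η i)).trans_eq (h1 α η)⟩

/-- Linear growth of the variance. -/
lemma IsContractingSystem.exists_mul_le_variance [μ.IsOpenPosMeasure]
    (hs : IsContractingSystem μ F G ρ C θ Γ Δ) {a ε : ℝ} {L D : ℕ} (ha : 0 < a)
    (hL : 0 < L) (hε : 0 < ε) (hsp : IsSpecificationGap F ε L D)
    (hlip : ∀ j x y, |G j x - G j y| ≤ a / (4 * ε) * dist x y)
    (hgap : ∀ (α : ℕ → Fin N) (η : ℕ → Fin N') (k : ℕ) (x : M),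
      8 * D * |centered μ ρ (fun i ↦ F (α i)) (fun i ↦ G (η i)) k x| ≤ a * L)
    (hblock : ∀ (α : ℕ → Fin N) (η : ℕ → Fin N') (r : ℕ), ∃ x : M,
      a * L ≤ ∑ i ∈ Finset.Icc 1 L, centered μ ρ (fun i ↦ F (α i)) (fun i ↦ G (η i)) (r + i)
          (comp (fun i ↦ F (α i)) r i x)) :
    ∃ B : ℝ, 0 < B ∧ ∀ (α : ℕ → Fin N) (η : ℕ → Fin N') (n : ℕ),
      B * n ≤ variance μ ρ (fun i ↦ F (α i)) (fun i ↦ G (η i)) n := by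
  obtain ⟨X, hdec⟩ := hs.exists_decomposition
  obtain ⟨l, δ, hl, hδ, hwin⟩ := hs.exists_window (C + 1 + C) X ha hL hε hsp hlip hgap hblock
  have hl' : (0 : ℝ) < l := by exact_mod_cast hl
  have hmul : ∀ (α : ℕ → Fin N) (η : ℕ → Fin N') (k n : ℕ), k * l < n →
      k * δ ≤ variance μ ρ (fun i ↦ F (α i)) (fun i ↦ G (η i)) n := by
    intro α η k n hn
    obtain ⟨h, χ, hd⟩ := hdec α η
    exact hd.mul_le_variance (fun i ↦ (hs.contracting (α i)).continuous)
      (hs.continuous_centered α η) (hwin α η h χ hd) hn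
  have hpos : ∀ n : ℕ, 0 < n → ∃ B > 0, ∀ (α : ℕ → Fin N) (η : ℕ → Fin N'),
      B ≤ variance μ ρ (fun i ↦ F (α i)) (fun i ↦ G (η i)) n := fun n hn ↦
    exists_pos_le_variance hn fun α η ↦ hs.variance_pos (l := l)
      (fun α η n hn ↦ hδ.trans_le (by simpa using hmul α η 1 n (by omega))) α η hn
  choose! b hb hbv using hpos
  have hβ : ∃ β > 0, ∀ n, 0 < n → n ≤ l → β ≤ b n := by
    obtain ⟨i, hi, hmin⟩ := (Finset.Icc 1 l).exists_min_image b ⟨1, Finset.mem_Icc.2 ⟨le_rfl, hl⟩⟩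
    exact ⟨b i, hb i (Finset.mem_Icc.1 hi).1, fun n h0 h1 ↦ hmin n (Finset.mem_Icc.2 ⟨h0, h1⟩)⟩
  obtain ⟨β, hβ0, hβ⟩ := hβ
  -- For n ≤ l the uniform bound β is used. For n > l, k = ⌊(n - 1)/l⌋ windows fit and n ≤ 2kl.
  refine ⟨min (δ / (2 * l)) (β / l), lt_min (by positivity) (by positivity), fun α η n ↦ ?_⟩
  rcases Nat.eq_zero_or_pos n with rfl | hn
  · simpa using variance_nonneg μ (fun x ↦ (hs.density.1 x).le) _ _ 0
  have hn' : (0 : ℝ) < n := by exact_mod_cast hn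
  rcases le_or_gt n l with hnl | hnl
  · refine le_trans ?_ ((hβ n hn hnl).trans (hbv n hn α η))
    refine (mul_le_mul_of_nonneg_right (min_le_right _ _) hn'.le).trans ?_
    rw [div_mul_eq_mul_div, div_le_iff₀ hl']
    have : (n : ℝ) ≤ l := by exact_mod_cast hnl
    gcongr
  · set k := (n - 1) / l with hk
    have h1 : k * l < n := by
      have h := Nat.div_mul_le_self (n - 1) l
      rw [← hk] at h
      omega
    have hk1 : 1 ≤ k := (Nat.one_le_div_iff hl).2 (by omega)
    have h2 : n ≤ 2 * (k * l) := by
      have h3 := Nat.lt_div_mul_add (a := n - 1) hl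
      rw [← hk] at h3
      have h4 : l ≤ k * l := Nat.le_mul_of_pos_left l hk1
      omega
    have h2' : (n : ℝ) ≤ 2 * (k * l) := by exact_mod_cast h2
    refine le_trans ?_ (hmul α η k n h1)
    refine (mul_le_mul_of_nonneg_right (min_le_left _ _) hn'.le).trans ?_
    rw [div_mul_eq_mul_div, div_le_iff₀ (by positivity)]
    calc δ * n ≤ δ * (2 * (k * l)) := by gcongr
      _ = _ := by ring

end VarianceGrowth


/-! ### Explicit constants and assembly -/

section System

variable {d : ℕ} {M : Type*} [MetricSpace M] [CompactSpace M]
  [ChartedSpace (EuclideanSpace ℝ (Fin d)) M] [IsManifold (𝓡 d) ∞ M]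
  [RiemannianBundle (fun x : M ↦ TangentSpace (𝓡 d) x)]
  [IsContMDiffRiemannianBundle (𝓡 d) ∞ (EuclideanSpace ℝ (Fin d))
    (fun x : M ↦ TangentSpace (𝓡 d) x)]

lemma hasChains [IsRiemannianManifold (𝓡 d) M] : HasChains M :=
  fun x y _ _ hr hδ ↦ exists_chain (𝓡 d) x y hr hδ

lemma ExpandsBy.mono {M : Type*} [MetricSpace M] [ChartedSpace (EuclideanSpace ℝ (Fin d)) M]
    [RiemannianBundle (fun x : M ↦ TangentSpace (𝓡 d) x)] {f : M → M} {ϑ ϑ' : ℝ}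
    (h : ExpandsBy d f ϑ) (hϑ : ϑ' ≤ ϑ) : ExpandsBy d f ϑ' :=
  fun x v ↦ (mul_le_mul_of_nonneg_right hϑ (norm_nonneg _)).trans (h x v)

lemma GradBound.mono {M : Type*} [MetricSpace M] [ChartedSpace (EuclideanSpace ℝ (Fin d)) M]
    [RiemannianBundle (fun x : M ↦ TangentSpace (𝓡 d) x)] {u : M → ℝ} {C C' : ℝ}
    (h : GradBound d u C) (hC : C ≤ C') : GradBound d u C' :=
  fun x v ↦ (h x v).trans (mul_le_mul_of_nonneg_right hC (norm_nonneg _))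

lemma isExpandingMap [IsRiemannianManifold (𝓡 d) M] [MeasurableSpace M] [BorelSpace M]
    {f : M → M} {ϑ : ℝ} (hϑ : 0 < ϑ)
    (hf : ContMDiff (𝓡 d) (𝓡 d) 2 f) (h : ExpandsBy d f ϑ) :
    IsExpandingMap (riemannianVolume d M) (jacobian d f) ϑ f where
  continuous := hf.continuous
  jac_continuous := (contMDiff_jacobian hf (h.injective hϑ)).continuous
  jac_pos x := jacobian_pos (h.injective hϑ x)
  lift := h.exists_local_lift hϑ (hf.of_le one_le_two)
  image := exists_riemannianVolume_image (hf.of_le one_le_two)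
    (contMDiff_jacobian hf (h.injective hϑ)).continuous.measurable

lemma logLip_of_gradBound [IsRiemannianManifold (𝓡 d) M] {ρ : M → ℝ} {R : ℝ} (hR : 0 ≤ R)
    (hρ : ∀ x, 0 < ρ x)
    (hρs : ContMDiff (𝓡 d) 𝓘(ℝ, ℝ) 1 (fun x ↦ Real.log (ρ x)))
    (h : GradBound d (fun x ↦ Real.log (ρ x)) R) : LogLip R ρ := by
  refine ⟨hρ, fun x y ↦ ?_⟩
  have h1 := (abs_le.1 (h.abs_sub_le hR hρs x y)).2
  rw [← Real.log_le_log_iff (hρ x) (mul_pos (Real.exp_pos _) (hρ y)),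
    Real.log_mul (Real.exp_pos _).ne' (hρ y).ne', Real.log_exp]
  linarith

/-- The integral is nonzero, so ρ is integrable, and ρ has a positive minimum by compactness; the
total mass is therefore finite. -/
lemma isFiniteMeasure_of_integral_eq_one {M : Type*} [TopologicalSpace M] [CompactSpace M]
    [MeasurableSpace M] [OpensMeasurableSpace M] {μ : Measure M} {ρ : M → ℝ} (hρ : ∀ x, 0 < ρ x)
    (hc : Continuous ρ) (h1 : ∫ x, ρ x ∂μ = 1) : IsFiniteMeasure μ ∧ NeZero μ := by
  have hne : μ ≠ 0 := by rintro rfl; simp at h1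
  have hM : Nonempty M := by
    by_contra hM
    rw [not_nonempty_iff] at hM
    exact hne (Measure.eq_zero_of_isEmpty μ)
  refine ⟨⟨?_⟩, ⟨hne⟩⟩
  have hi : Integrable ρ μ := by
    by_contra hi
    rw [integral_undef hi] at h1
    exact zero_ne_one h1
  obtain ⟨x₀, -, hx₀⟩ := isCompact_univ.exists_isMinOn univ_nonempty hc.continuousOn
  have h2 := hi.lintegral_lt_top
  have h3 : ENNReal.ofReal (ρ x₀) * μ univ ≤ ∫⁻ x, ENNReal.ofReal (ρ x) ∂μ := by
    rw [← lintegral_const]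
    exact lintegral_mono fun x ↦ ENNReal.ofReal_le_ofReal (hx₀ (mem_univ x))
  by_contra hcon
  rw [not_lt, top_le_iff] at hcon
  rw [hcon, ENNReal.mul_top (ENNReal.ofReal_pos.2 (hρ x₀)).ne'] at h3
  exact absurd (top_le_iff.1 h3) h2.ne

lemma exists_nat_forall_le {N : ℕ} (c : Fin N → ℝ) : ∃ n : ℕ, ∀ j, c j ≤ n :=
  ⟨Finset.univ.sup fun j ↦ ⌈c j⌉₊, fun j ↦ (Nat.le_ceil _).trans
    (Nat.cast_le.2 (Finset.le_sup (f := fun j ↦ ⌈c j⌉₊) (Finset.mem_univ j)))⟩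

lemma exists_hasBounds [IsRiemannianManifold (𝓡 d) M] {N N' : ℕ} {F : Fin N → M → M}
    {G : Fin N' → M → ℝ} {ρ : M → ℝ}
    (hF : ∀ j, ContMDiff (𝓡 d) (𝓡 d) 2 (F j)) (hϑ : ∃ ϑ : ℝ, 1 < ϑ ∧ ∀ j, ExpandsBy d (F j) ϑ)
    (hG : ∀ j, ContMDiff (𝓡 d) 𝓘(ℝ, ℝ) 1 (G j))
    (hρ : ContMDiff (𝓡 d) 𝓘(ℝ, ℝ) 1 (fun x ↦ Real.log (ρ x))) :
    ∃ t, HasBounds d F G ρ t := by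
  obtain ⟨ϑ, hϑ1, hexp⟩ := hϑ
  have hϑ0 : 0 < ϑ := by linarith
  obtain ⟨Δ, hΔ⟩ := exists_nat_ge (Metric.diam (univ : Set M))
  obtain ⟨p, hp⟩ := exists_nat_gt (1 / (ϑ - 1))
  have hp0 : (0 : ℝ) < p := (one_div_pos.2 (by linarith)).trans hp
  have hp1 : 1 + 1 / (p : ℝ) ≤ ϑ := by
    have := (one_div_lt (by linarith : 0 < ϑ - 1) hp0).1 hp
    linarith
  have hlog := fun j ↦ contMDiff_log_jacobian (hF j) ((hexp j).injective hϑ0)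
  choose k hk0 hk using fun j ↦ exists_gradBound (hlog j)
  obtain ⟨K, hK⟩ := exists_nat_forall_le k
  choose c hc0 hc using fun j ↦ exists_gradBound (hG j)
  have hb : ∀ j, ∃ b, ∀ x, |G j x| ≤ b := fun j ↦ by
    obtain ⟨b, hb⟩ := isCompact_univ.exists_bound_of_continuousOn (hG j).continuous.continuousOn
    exact ⟨b, fun x ↦ hb x (mem_univ x)⟩
  choose b hb using hb
  obtain ⟨Γ, hΓ⟩ := exists_nat_forall_le fun j ↦ max (b j) (c j)
  obtain ⟨r, -, hr⟩ := exists_gradBound hρ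
  obtain ⟨R, hR⟩ := exists_nat_ge r
  refine ⟨(Δ, p, K, Γ, R), fun x y ↦ ?_, by exact_mod_cast hp0, fun j ↦ (hexp j).mono hp1,
    fun j x y ↦ ?_, fun j ↦ ⟨fun x ↦ ?_, ?_⟩, hr.mono hR⟩
  · exact (Metric.dist_le_diam_of_mem isCompact_univ.isBounded (mem_univ x) (mem_univ y)).trans hΔ
  · exact ((hk j).abs_sub_le (hk0 j) (hlog j) x y).trans
      (mul_le_mul_of_nonneg_right (hK j) dist_nonneg)
  · exact (hb j x).trans ((le_max_left _ _).trans (hΓ j))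
  · exact (hc j).mono ((le_max_right _ _).trans (hΓ j))

/-- The reciprocal of the rate of memory loss. -/
def memoryConst : ℕ × ℕ × ℕ × ℕ × ℕ → ℕ
  | (Δ, p, K, _, R) => 3 ^ ((2 * p * K + R) * Δ) * (2 * p + 1)

/-- The factor `κ` in the checkable condition. -/
def sumConst : ℕ × ℕ × ℕ × ℕ × ℕ → ℕ
  | t@(_, p, _, Γ, _) => 64 * Γ * p + 2 * Γ * (memoryConst t + 1) + 1

/-- The smallest admissible length in the checkable condition. -/
def lengthConst : ℕ × ℕ × ℕ × ℕ × ℕ → ℕ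
  | t@(Δ, _, _, Γ, _) => 4 * sumConst t ^ 2 + 4 * Δ * (Γ + 1) + 3

lemma primrec_memoryConst : Primrec memoryConst := by
  have hΔ : Primrec fun t : ℕ × ℕ × ℕ × ℕ × ℕ ↦ t.1 := Primrec.fst
  have hp : Primrec fun t : ℕ × ℕ × ℕ × ℕ × ℕ ↦ t.2.1 := Primrec.fst.comp Primrec.snd
  have hK : Primrec fun t : ℕ × ℕ × ℕ × ℕ × ℕ ↦ t.2.2.1 :=
    Primrec.fst.comp (Primrec.snd.comp Primrec.snd)
  have hR : Primrec fun t : ℕ × ℕ × ℕ × ℕ × ℕ ↦ t.2.2.2.2 :=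
    Primrec.snd.comp (Primrec.snd.comp (Primrec.snd.comp Primrec.snd))
  have h2p := Primrec.nat_mul.comp (Primrec.const 2) hp
  have hpow : Primrec fun n : ℕ ↦ 3 ^ n := by
    refine (Primrec.nat_rec₁ 1 (f := fun _ m ↦ 3 * m)
      (Primrec.nat_mul.comp (Primrec.const 3) Primrec.snd)).of_eq fun n ↦ ?_
    induction n with
    | zero => rfl
    | succ n ih => rw [pow_succ', ← ih]
  exact Primrec.nat_mul.comp (hpow.comp (Primrec.nat_mul.comp
    (Primrec.nat_add.comp (Primrec.nat_mul.comp h2p hK) hR) hΔ)) (Primrec.succ.comp h2p)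

lemma primrec_sumConst : Primrec sumConst := by
  have hp : Primrec fun t : ℕ × ℕ × ℕ × ℕ × ℕ ↦ t.2.1 := Primrec.fst.comp Primrec.snd
  have hΓ : Primrec fun t : ℕ × ℕ × ℕ × ℕ × ℕ ↦ t.2.2.2.1 :=
    Primrec.fst.comp (Primrec.snd.comp (Primrec.snd.comp Primrec.snd))
  exact Primrec.succ.comp (Primrec.nat_add.comp
    (Primrec.nat_mul.comp (Primrec.nat_mul.comp (Primrec.const 64) hΓ) hp)
    (Primrec.nat_mul.comp (Primrec.nat_mul.comp (Primrec.const 2) hΓ)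
      (Primrec.succ.comp primrec_memoryConst)))

lemma primrec_lengthConst : Primrec lengthConst := by
  have hΔ : Primrec fun t : ℕ × ℕ × ℕ × ℕ × ℕ ↦ t.1 := Primrec.fst
  have hΓ : Primrec fun t : ℕ × ℕ × ℕ × ℕ × ℕ ↦ t.2.2.2.1 :=
    Primrec.fst.comp (Primrec.snd.comp (Primrec.snd.comp Primrec.snd))
  refine (Primrec.nat_add.comp (Primrec.nat_add.comp
    (Primrec.nat_mul.comp (Primrec.const 4)
      (Primrec.nat_mul.comp primrec_sumConst primrec_sumConst))
    (Primrec.nat_mul.comp (Primrec.nat_mul.comp (Primrec.const 4) hΔ) (Primrec.succ.comp hΓ)))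
    (Primrec.const 3)).of_eq fun t ↦ ?_
  rw [← sq]
  rfl

/-- The checkable condition implies the variance hypotheses and linear growth of the variance. -/
lemma HasBounds.varianceHypotheses_and_growth [IsRiemannianManifold (𝓡 d) M] [MeasurableSpace M]
    [BorelSpace M] {N N' : ℕ} {F : Fin N → M → M} {G : Fin N' → M → ℝ} {ρ : M → ℝ}
    {t : ℕ × ℕ × ℕ × ℕ × ℕ} (ht : HasBounds d F G ρ t)
    (hF : ∀ j, ContMDiff (𝓡 d) (𝓡 d) 2 (F j)) (hG : ∀ j, ContMDiff (𝓡 d) 𝓘(ℝ, ℝ) 1 (G j))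
    (hρ : ∀ x, 0 < ρ x) (hρs : ContMDiff (𝓡 d) 𝓘(ℝ, ℝ) 1 (fun x ↦ Real.log (ρ x)))
    (hρ1 : ∫ x, ρ x ∂riemannianVolume d M = 1) {L : ℕ} (hL : lengthConst t ≤ L)
    (hc : CheckableCondition d F G (sumConst t) (memoryConst t) L) :
    VarianceHypotheses d F G ρ L ∧
      ∃ B : ℝ, 0 < B ∧ ∀ (α : ℕ → Fin N) (η : ℕ → Fin N') (n : ℕ),
        B * n ≤ variance (riemannianVolume d M) ρ (fun i ↦ F (α i)) (fun i ↦ G (η i)) n := by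
  obtain ⟨Δ, p, K, Γ, R⟩ := t
  obtain ⟨hΔ, hp, hexp, hK, hΓ, hR⟩ := ht
  have hp' : (0 : ℝ) < p := by exact_mod_cast hp
  have hρL : LogLip R ρ := logLip_of_gradBound R.cast_nonneg hρ hρs hR
  obtain ⟨hfin, hnz⟩ := isFiniteMeasure_of_integral_eq_one hρ hρL.continuous hρ1
  have hop := isOpenPosMeasure_riemannianVolume (d := d) (M := M)
  -- The part 2pK makes the cone invariant, and R puts ρ into it.
  set C : ℝ := ((2 * p * K + R : ℕ) : ℝ) with hC
  have hC0 : 0 ≤ C := Nat.cast_nonneg _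
  have hCK : 2 * p * K ≤ C := by
    rw [hC]; push_cast; have : (0 : ℝ) ≤ R := R.cast_nonneg
    linarith
  have hCR : (R : ℝ) ≤ C := by
    rw [hC]; push_cast; have : (0 : ℝ) ≤ 2 * p * K := by positivity
    linarith
  have hexpm : ∀ i, IsExpandingMap (riemannianVolume d M) (jacobian d (F i)) (1 + 1 / (p : ℝ))
      (F i) := fun i ↦ isExpandingMap (by positivity) (hF i) (hexp i)
  have hchains : HasChains M := hasChains (d := d)
  have hcontr : ∀ (C' θ : ℝ), C ≤ C' → 0 < θ → θ * (2 * p + 1) * Real.exp (C' * Δ) ≤ 1 →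
      ∀ i, IsContracting (riemannianVolume d M) C' θ (F i) := fun C' θ h1 h2 h3 i ↦
    (hexpm i).isContracting hp hchains K.cast_nonneg (hK i) (hCK.trans h1) hΔ h2 h3
  set q := memoryConst (Δ, p, K, Γ, R) with hq
  have hqdef : q = 3 ^ ((2 * p * K + R) * Δ) * (2 * p + 1) := rfl
  have hq1 : 1 < q := by
    rw [hqdef]
    have : 0 < 3 ^ ((2 * p * K + R) * Δ) := by positivity
    nlinarith
  have hq0 : (0 : ℝ) < q := by exact_mod_cast (by omega : 0 < q)
  -- The exponent CΔ is a natural number, so the integer power of 3 in q dominates e^(CΔ).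
  have hqC : 1 / (q : ℝ) * (2 * p + 1) * Real.exp (C * Δ) ≤ 1 := by
    rw [mul_assoc, one_div_mul_eq_div, div_le_one hq0, hqdef]
    push_cast
    rw [mul_comm]
    gcongr
    have h1 : C * Δ = (((2 * p * K + R) * Δ : ℕ) : ℝ) * 1 := by rw [hC]; push_cast; ring
    rw [h1, Real.exp_nat_mul]
    exact pow_le_pow_left₀ (Real.exp_pos _).le (by linarith [Real.exp_one_lt_d9]) _
  have hvar : VarianceHypotheses d F G ρ L :=
    hc.varianceHypotheses hC0 hq1 hp le_rfl hL hΔ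
      (fun i ↦ (hexpm i).hasLift (by positivity) hchains)
      (hcontr C _ le_rfl (by positivity) hqC) (fun j ↦ (hG j).continuous) hΓ (hρL.mono hCR) hρ1
  refine ⟨hvar, ?_⟩
  obtain ⟨a, ε, D, ha, -, hε, hsp, hgrad, hgap, hblock⟩ := hvar
  have hL0 : 0 < L := lt_of_lt_of_le (Nat.succ_pos _) hL
  -- The decomposition needs contraction also for the constant C + 1, hence a smaller θ. It affects
  -- only B, which need not be computable.
  set θ : ℝ := ((2 * p + 1) * Real.exp ((C + 1) * Δ))⁻¹ with hθ
  have hθ1 : θ * (2 * p + 1) * Real.exp ((C + 1) * Δ) = 1 := by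
    rw [hθ, mul_assoc]; exact inv_mul_cancel₀ (by positivity)
  have hs : IsContractingSystem (riemannianVolume d M) F G ρ C θ Γ Δ :=
    { C_nonneg := hC0
      θ_pos := by positivity
      θ_lt_one := by
        refine inv_lt_one_of_one_lt₀ ?_
        have h1 : 1 ≤ Real.exp ((C + 1) * Δ) := Real.one_le_exp (by positivity)
        nlinarith
      Γ_nonneg := Γ.cast_nonneg
      contracting := hcontr C θ le_rfl (by positivity) (by
        refine le_trans ?_ hθ1.le
        gcongr
        linarith)
      contracting_add_one := hcontr (C + 1) θ (by linarith) (by positivity) hθ1.le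
      bound := fun j ↦ (hΓ j).1
      lipschitz := fun j ↦ (hΓ j).2.abs_sub_le Γ.cast_nonneg (hG j)
      density := hρL.mono hCR
      mass := hρ1
      diam := hΔ }
  exact hs.exists_mul_le_variance ha hL0 hε hsp
    (fun j ↦ (hgrad j).abs_sub_le (by positivity) (hG j)) hgap hblock

end System

end SeqExpanding

theorem mainTheorem12 :
    ∃ κ b L₀ : ℕ × ℕ × ℕ × ℕ × ℕ → ℕ,
      Computable κ ∧ Computable b ∧ Computable L₀ ∧ (∀ t, 0 < κ t ∧ 0 < b t ∧ 0 < L₀ t) ∧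
      ∀ (d : ℕ) (M : Type*) [MetricSpace M] [CompactSpace M] [ConnectedSpace M]
        [MeasurableSpace M] [BorelSpace M]
        [ChartedSpace (EuclideanSpace ℝ (Fin d)) M] [IsManifold (𝓡 d) ∞ M]
        [RiemannianBundle (fun x : M ↦ TangentSpace (𝓡 d) x)]
        [IsContMDiffRiemannianBundle (𝓡 d) ∞ (EuclideanSpace ℝ (Fin d))
          (fun x : M ↦ TangentSpace (𝓡 d) x)]
        [IsRiemannianManifold (𝓡 d) M]
        (N N' : ℕ) (F : Fin N → M → M) (G : Fin N' → M → ℝ) (ρ : M → ℝ),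
        (∀ j, ContMDiff (𝓡 d) (𝓡 d) 2 (F j)) →
        (∃ ϑ : ℝ, 1 < ϑ ∧ ∀ j, SeqExpanding.ExpandsBy d (F j) ϑ) →
        (∀ j, ContMDiff (𝓡 d) 𝓘(ℝ, ℝ) 1 (G j)) →
        (∀ x, 0 < ρ x) →
        ContMDiff (𝓡 d) 𝓘(ℝ, ℝ) 1 (fun x ↦ Real.log (ρ x)) →
        ∫ x, ρ x ∂SeqExpanding.riemannianVolume d M = 1 →
        (∃ t, SeqExpanding.HasBounds d F G ρ t) ∧
        ∀ t, SeqExpanding.HasBounds d F G ρ t →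
          ∀ L : ℕ, L₀ t ≤ L → SeqExpanding.CheckableCondition d F G (κ t) (b t) L →
            SeqExpanding.VarianceHypotheses d F G ρ L ∧
            ∃ B : ℝ, 0 < B ∧ ∀ (α : ℕ → Fin N) (η : ℕ → Fin N') (n : ℕ),
              B * n ≤ SeqExpanding.variance (SeqExpanding.riemannianVolume d M) ρ
                (fun i ↦ F (α i)) (fun i ↦ G (η i)) n := by
  refine ⟨SeqExpanding.sumConst, SeqExpanding.memoryConst, SeqExpanding.lengthConst,
    SeqExpanding.primrec_sumConst.to_comp, SeqExpanding.primrec_memoryConst.to_comp,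
    SeqExpanding.primrec_lengthConst.to_comp, fun ⟨Δ, p, K, Γ, R⟩ ↦ ⟨Nat.succ_pos _, ?_,
    Nat.succ_pos _⟩, ?_⟩
  · exact Nat.mul_pos (Nat.pow_pos (by norm_num)) (Nat.succ_pos _)
  · intro d M _ _ _ _ _ _ _ _ _ _ N N' F G ρ hF hϑ hG hρ hρs hρ1
    exact ⟨SeqExpanding.exists_hasBounds hF hϑ hG hρs, fun t ht L hL hc ↦
      ht.varianceHypotheses_and_growth hF hG hρ hρs hρ1 hL hc⟩
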